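/- Let $\Omega\subset\mathbb R^n$ be a bounded Lipschitz domain. For $Q\in\partial\Omega$ and $r>0$ put $\Delta(Q,r)=B(Q,r)\cap\partial\Omega$ and $T(Q,r)=B(Q,r)\cap\Omega$; let $\sigma$ be surface measure on $\partial\Omega$, let $\Gamma(P)=\{x\in\Omega:\ |x-P|<2\,\mathrm{dist}(x,\partial\Omega)\}$ for $P\in\partial\Omega$, and let $(w)^*(P)=\sup_{x\in\Gamma(P)}|w(x)|$ be the nontangential maximal function of a function $w$ on $\Omega$. For a function $u$ on $\Omega$, $\nabla^k u$ denotes the tensor of all partial derivatives of order $k$ of $u$. For integers $\ell\ge 1$ and $m$, consider systems $\mathcal L(D)u=0$ for $u=(u^1,\dots,u^m)$, where $$\big(\mathcal L(D)u\big)^j=\sum_{k=1}^m\ \sum_{|\alpha|=|\beta|=\ell}a^{jk}_{\alpha\beta}D^\alpha D^\beta u^k ,\qquad 1\le j\le m,$$ with real constants $a^{jk}_{\alpha\beta}$ such that $\mathcal L^{jk}(\xi)=\sum_{|\alpha|=|\beta|=\ell}a^{jk}_{\alpha\beta}\xi^\alpha\xi^\beta$ satisfies the symmetry condition $\mathcal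 L^{jk}(\xi)=\mathcal L^{kj}(\xi)$ and, for some $\mu>0$, the Legendre--Hadamard condition $$\mu|\xi|^{2\ell}|\eta|^2\le\sum_{j,k=1}^m\mathcal L^{jk}(\xi)\eta_j\eta_k\le\frac1\mu|\xi|^{2\ell}|\eta|^2\qquad(\xi\in\mathbb R^n,\ \eta\in\mathbb R^m).$$ There is $r_0>0$, depending only on $\Omega$, such that the following holds for all $Q\in\partial\Omega$ and $0<R_0\le r_0$. Let $u$ be a solution of $\mathcal L(D)u=0$ in $\Omega$ such that $(\nabla^\ell u)^*\in L^2(\Delta(Q,R_0),d\sigma)$ and, for all $|\alpha|\le\ell-1$, $D^\alpha u=0$ on $\Delta(Q,R_0)$ in the sense of nontangential convergence $\sigma$-almost everywhere, that is, $D^\alpha u(x)\to0$ as $x\to P$ with $x\in\Gamma(P)$, for $\sigma$-a.e. $P\in\Delta(Q,R_0)$. Suppose that for some $\lambda_0>0$ and $C>0$, $$\int_{T(Q,r)}|u|^2\,dx\le C\Big(\frac rR\Big)^{\lambda_0+2\ell-2}\int_{T(Q,R)}|u|^2\,dx\qquad\text{for all }0<r<R<R_0 .$$ Then for every $0<\lambda<\lambda_0$,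 $$\int_{T(Q,r)}|\nabla^{\ell-1}u|^2\,dx\le C_\lambda\Big(\frac rR\Big)^{\lambda}\int_{T(Q,R)}|\nabla^{\ell-1}u|^2\,dx\qquad\text{for all }0<r<R<R_0 ,$$ where $C_\lambda$ depends only on $\Omega$, $m$, $\ell$, $\mu$, $\lambda_0$, $\lambda$ and $C$; in particular it does not depend on $u$, $Q$, $R_0$, or (beyond $\mu$) on the coefficients. -/

import Mathlib

open Set Filter Topology MeasureTheory
open scoped NNReal ENNReal RealInnerProductSpace

noncomputable section

/-- The space `ℝⁿ` with its Euclidean norm. -/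
abbrev Eucl (n : ℕ) : Type := EuclideanSpace ℝ (Fin n)

/-- A bounded Lipschitz domain: a bounded, connected open set which near each of its boundary points
is, in suitable orthogonal coordinates `x = x' + xₙ e` with `e` a unit vector and `x' ⟂ e`, the
region `xₙ > ψ x'` above the graph of a Lipschitz function `ψ`. -/
structure IsBoundedLipschitzDomain {n : ℕ} (Ω : Set (Eucl n)) : Prop where
  isOpen : IsOpen Ω
  isConnected : IsConnected Ω
  isBounded : Bornology.IsBounded Ω
  locallyGraph : ∀ Q ∈ frontier Ω, ∃ (e : Eucl n) (ψ : (ℝ ∙ e)ᗮ → ℝ) (K : ℝ≥0) (ρ : ℝ),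
    ‖e‖ = 1 ∧ LipschitzWith K ψ ∧ 0 < ρ ∧
      Ω ∩ Metric.ball Q ρ =
        {x | ψ ((ℝ ∙ e)ᗮ.orthogonalProjectionOnto x) < ⟪e, x⟫} ∩ Metric.ball Q ρ

/-- Surface balls `Δ(Q, r) = B(Q, r) ∩ ∂Ω`. -/
def surfaceBall {n : ℕ} (Ω : Set (Eucl n)) (Q : Eucl n) (r : ℝ) : Set (Eucl n) :=
  Metric.ball Q r ∩ frontier Ω

/-- `T(Q, r) = B(Q, r) ∩ Ω`. -/
def tent {n : ℕ} (Ω : Set (Eucl n)) (Q : Eucl n) (r : ℝ) : Set (Eucl n) :=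
  Metric.ball Q r ∩ Ω

/-- Surface measure: the `(n - 1)`-dimensional Hausdorff measure on `ℝⁿ` (it is only used on subsets
of `∂Ω`). -/
def surfaceMeasure (n : ℕ) : Measure (Eucl n) := μH[(n : ℝ) - 1]

/-- The nontangential approach region `Γ(P) = {x ∈ Ω : |x - P| < 2 dist(x, ∂Ω)}`. -/
def approachRegion {n : ℕ} (Ω : Set (Eucl n)) (P : Eucl n) : Set (Eucl n) :=
  {x | x ∈ Ω ∧ dist x P < 2 * Metric.infDist x (frontier Ω)}

/-- The nontangential maximal function `(w)^*(P) = sup {|w x| : x ∈ Γ(P)}`, with values in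
`[0, ∞]`. -/
def ntMax {n : ℕ} (Ω : Set (Eucl n)) (w : Eucl n → ℝ) (P : Eucl n) : ℝ≥0∞ :=
  ⨆ x ∈ approachRegion Ω P, ‖w x‖ₑ

/-- The partial derivative `Dᵢ f = ∂f/∂xᵢ`. -/
def partialD {n : ℕ} {F : Type*} [NormedAddCommGroup F] [NormedSpace ℝ F] (i : Fin n)
    (f : Eucl n → F) : Eucl n → F :=
  fun x => fderiv ℝ f x (EuclideanSpace.single i 1)

/-- For a multi-index `α`, the derivative `D^α f = D₁^α₁ D₂^α₂ ⋯ Dₙ^αₙ f`. -/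
def multiD {n : ℕ} {F : Type*} [NormedAddCommGroup F] [NormedSpace ℝ F] (α : Fin n → ℕ)
    (f : Eucl n → F) : Eucl n → F :=
  (List.finRange n).foldr (fun i g => (partialD i)^[α i] g) f

/-- The finite set of all multi-indices `α` of length `|α| = α₁ + ⋯ + αₙ = k`. -/
def multiIndices (n k : ℕ) : Finset (Fin n → ℕ) := Finset.piAntidiag Finset.univ k

/-- The length `|∇^k u|` of the tensor of all partial derivatives of order `k` of `u`. -/
def gradNorm {n m : ℕ} (k : ℕ) (u : Eucl n → Eucl m) (x : Eucl n) : ℝ :=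
  √(∑ α ∈ multiIndices n k, ‖multiD α u x‖ ^ 2)

/-- Real constant coefficients `a^{jk}_{αβ}`, as `a α β j k`; for an operator of order `2ℓ` only
those with `|α| = |β| = ℓ` play a role. -/
abbrev Coeffs (n m : ℕ) : Type := (Fin n → ℕ) → (Fin n → ℕ) → Fin m → Fin m → ℝ

/-- The symbol `L^{jk}(ξ) = ∑_{|α| = |β| = ℓ} a^{jk}_{αβ} ξ^α ξ^β`. -/
def symbol {n m : ℕ} (ℓ : ℕ) (a : Coeffs n m) (j k : Fin m) (ξ : Eucl n) : ℝ :=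
  ∑ α ∈ multiIndices n ℓ, ∑ β ∈ multiIndices n ℓ,
    a α β j k * (∏ i, ξ i ^ α i) * (∏ i, ξ i ^ β i)

/-- The `j`-th component of `L(D) u`, that is
`∑_k ∑_{|α| = |β| = ℓ} a^{jk}_{αβ} D^α D^β u^k`. -/
def systemOp {n m : ℕ} (ℓ : ℕ) (a : Coeffs n m) (u : Eucl n → Eucl m) (j : Fin m) (x : Eucl n) :
    ℝ :=
  ∑ k, ∑ α ∈ multiIndices n ℓ, ∑ β ∈ multiIndices n ℓ,
    a α β j k * multiD α (multiD β (fun y => u y k)) x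

/-- The symmetry condition and the Legendre-Hadamard ellipticity condition with constant `μ`. -/
structure IsSymmElliptic {n m : ℕ} (ℓ : ℕ) (μ : ℝ) (a : Coeffs n m) : Prop where
  symm : ∀ (j k : Fin m) (ξ : Eucl n), symbol ℓ a j k ξ = symbol ℓ a k j ξ
  lower : ∀ (ξ : Eucl n) (η : Eucl m),
    μ * ‖ξ‖ ^ (2 * ℓ) * ‖η‖ ^ 2 ≤ ∑ j, ∑ k, symbol ℓ a j k ξ * η j * η k
  upper : ∀ (ξ : Eucl n) (η : Eucl m),
    ∑ j, ∑ k, symbol ℓ a j k ξ * η j * η k ≤ 1 / μ * ‖ξ‖ ^ (2 * ℓ) * ‖η‖ ^ 2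

/-- `u` is a (classical) solution of `L(D) u = 0` in `Ω`. -/
structure IsSolution {n m : ℕ} (ℓ : ℕ) (a : Coeffs n m) (Ω : Set (Eucl n))
    (u : Eucl n → Eucl m) : Prop where
  contDiffOn : ContDiffOn ℝ ((2 * ℓ : ℕ) : WithTop ℕ∞) u Ω
  eq_zero : ∀ x ∈ Ω, ∀ j, systemOp ℓ a u j x = 0

/-- `w = 0` on the subset `S` of `∂Ω` in the sense of nontangential convergence at almost every
point with respect to surface measure. -/
def VanishesNT {n : ℕ} {F : Type*} [NormedAddCommGroup F] (Ω S : Set (Eucl n))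
    (w : Eucl n → F) : Prop :=
  ∀ᵐ P ∂((surfaceMeasure n).restrict S), Tendsto w (𝓝[approachRegion Ω P] P) (𝓝 0)

end

/-!
The estimate is obtained by lowering the order of the derivative on a small ball, where the decay of
`u` is assumed, and raising it again on a large one. Three facts are combined, for balls centred at
a boundary point `Q` and with `ℓ - 1` written as `k`:

* the Caccioppoli inequality `r ^ (2k) ∫_{T(Q,r)} |∇^k u|² ≤ K ∫_{T(Q,2r)} |u|²`
  (`exists_caccioppoli`), with only `u` itself on the right-hand side;
* the assumed decay of `∫ |u|²` with the exponent `λ₀ + 2k`;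
* Poincaré's inequality `∫_{T(Q,cR)} |u|² ≤ D R ^ (2k) ∫_{T(Q,R)} |∇^k u|²` (`exists_poincare`),
  which holds since `u` vanishes on the boundary to the order `k`.

The factors `r ^ (-2k)`, `(r / R) ^ (2k)` and `R ^ (2k)` cancel and the power `(r / R) ^ λ₀` remains
(`exists_gradNorm_decay`). As the boundary is compact, it is covered by graph charts with a common
size and Lipschitz constant (`IsBoundedLipschitzDomain.exists_uniform_chart`), so that all constants
are uniform in `Q`.

*The Caccioppoli inequality.* By Plancherel's theorem, the Legendre–Hadamard condition gives the
coercivity of the bilinear form on test functions (`IsSymmElliptic.garding`). If `v` is a test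
function close to `u`, inserting a cutoff of `v` in this inequality and testing the system with a
cutoff of `v` bounds the energy of order `ℓ` by those of lower order (`exists_energy_bound`). The
intermediate orders are absorbed by a weighted interpolation inequality (`exists_interpolation`,
`exists_absorption`); the powers of the cutoff function are chosen such that each derivative costs
one of them. The constants depend on the coefficients only through `μ`, because the coefficients
can be replaced by averages with the same symbol, which are bounded in terms of `μ`
(`exists_averagedCoeffs_bound`).

*Approximation by test functions.* This is where the boundary conditions and the bound of the
nontangential maximal function enter. Since the aperture of the approach regions is fixed, a region
`Γ(P)` need not contain the vertical line through `P`. Near a density point of a set of boundary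
points with uniform convergence, however, every point of the vertical line lies in `Γ(P)` for some
`P` in that set, so the derivatives of order less than `ℓ` tend to zero along almost every vertical
line (`IsGraphChart.ae_tendsto_vertical`). By averaging, `|∇^ℓ u|²` is integrable near `Q`
(`IsGraphChart.lintegral_sq_lt_top`). Both use that the vertical projection of Lebesgue measure to
the boundary is bounded by a multiple of surface measure (`IsGraphChart.exists_map_foot_le`).
Integration along vertical lines now yields an iterated Hardy inequality in strips of height `ε`
(`IsGraphChart.exists_strip_bound`), which shows that cutting `u` off at height `ε` costs an error
in the Sobolev norm of order `ℓ` that tends to zero with `ε` (`IsGraphChart.sobolevApprox`). The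
same inequality in a strip of height comparable to `R` is Poincaré's inequality.
-/

noncomputable section

open scoped ContDiff

/-! ### Calculus of multi-indices -/

section Calculus

variable {n : ℕ} {F G : Type*} [NormedAddCommGroup F] [NormedSpace ℝ F]
  [NormedAddCommGroup G] [NormedSpace ℝ G] {U : Set (Eucl n)} {f g : Eucl n → F}

theorem partialD_congr (hU : IsOpen U) (h : EqOn f g U) (i : Fin n) :
    EqOn (partialD i f) (partialD i g) U := fun x hx => by
  have : f =ᶠ[𝓝 x] g := Filter.eventuallyEq_of_mem (hU.mem_nhds hx) h
  simp only [partialD, this.fderiv_eq]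

theorem ContDiffOn.partialD (hU : IsOpen U) {k : ℕ} (hf : ContDiffOn ℝ ((k + 1 : ℕ) : ℕ∞ω) f U)
    (i : Fin n) : ContDiffOn ℝ (k : ℕ∞ω) (partialD i f) U :=
  (hf.fderiv_of_isOpen hU (m := (k : ℕ∞ω)) (by norm_cast)).clm_apply contDiffOn_const

theorem partialD_comm (hU : IsOpen U) (hf : ContDiffOn ℝ ((2 : ℕ) : ℕ∞ω) f U) (i j : Fin n) :
    EqOn (partialD i (partialD j f)) (partialD j (partialD i f)) U := fun x hx => by
  have hx' := hU.mem_nhds hx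
  have hs : IsSymmSndFDerivAt ℝ f x :=
    (hf.contDiffAt hx').isSymmSndFDerivAt (by simp)
  have hd : DifferentiableAt ℝ (fderiv ℝ f) x :=
    ((hf.fderiv_of_isOpen hU (m := ((1 : ℕ) : ℕ∞ω)) (by norm_cast)).contDiffAt hx').differentiableAt
      (by simp)
  have key : ∀ v w : Eucl n, fderiv ℝ (fun y => fderiv ℝ f y v) x w = fderiv ℝ (fderiv ℝ f) x w v := by
    intro v w
    rw [fderiv_clm_apply hd (differentiableAt_const v)]
    simp
  change fderiv ℝ (fun y => fderiv ℝ f y _) x _ = fderiv ℝ (fun y => fderiv ℝ f y _) x _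
  rw [key, key]
  exact hs.eq _ _

/-- The iterated partial derivative along a list of coordinates, the head being applied last. -/
def listD (I : List (Fin n)) (f : Eucl n → F) : Eucl n → F := I.foldr partialD f

@[simp] theorem listD_nil : listD [] f = f := rfl

@[simp] theorem listD_cons (i : Fin n) (I : List (Fin n)) :
    listD (i :: I) f = partialD i (listD I f) := rfl

theorem listD_append (I J : List (Fin n)) : listD (I ++ J) f = listD I (listD J f) := by
  simp [listD]

theorem listD_congr (hU : IsOpen U) (h : EqOn f g U) (I : List (Fin n)) :
    EqOn (listD I f) (listD I g) U := by
  induction I with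
  | nil => exact h
  | cons i I ih => exact partialD_congr hU ih i

theorem ContDiffOn.listD (hU : IsOpen U) {N : ℕ} (hf : ContDiffOn ℝ (N : ℕ∞ω) f U)
    (I : List (Fin n)) : ∀ {k : ℕ}, k + I.length ≤ N →
    ContDiffOn ℝ (k : ℕ∞ω) (listD I f) U := by
  induction I with
  | nil => intro k hk; exact hf.of_le (by exact_mod_cast hk)
  | cons i I ih =>
    intro k hk
    exact (ih (k := k + 1) (by simp at hk; omega)).partialD hU i

/-- Partial derivatives commute, so only the multiset of coordinates matters. -/
theorem listD_perm (hU : IsOpen U) {N : ℕ} (hf : ContDiffOn ℝ (N : ℕ∞ω) f U)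
    {I J : List (Fin n)} (h : I.Perm J) : I.length ≤ N → EqOn (listD I f) (listD J f) U := by
  induction h with
  | nil => intro _ x _; rfl
  | cons i _ ih => intro hN; exact partialD_congr hU (ih (by simp at hN; omega)) i
  | swap i j I =>
    intro hN
    exact partialD_comm hU (hf.listD hU I (by simp at hN; omega)) _ _
  | trans h₁ _ ih₁ ih₂ =>
    intro hN
    exact (ih₁ hN).trans (ih₂ (h₁.length_eq ▸ hN))

/-- The list of coordinates in which each `i` occurs `α i` times, in increasing order. -/
def coordList (α : Fin n → ℕ) : List (Fin n) :=
  (List.finRange n).flatMap fun i => List.replicate (α i) i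

theorem listD_replicate (k : ℕ) (i : Fin n) :
    listD (List.replicate k i) f = (partialD i)^[k] f := by
  induction k with
  | zero => rfl
  | succ k ih => rw [List.replicate_succ, listD_cons, ih, Function.iterate_succ_apply']

/-- Multi-index derivatives are derivatives along lists; inductions on the order of a derivative
are carried out on lists. -/
theorem multiD_eq_listD (α : Fin n → ℕ) : multiD α f = listD (coordList α) f := by
  unfold multiD coordList
  induction List.finRange n with
  | nil => rfl
  | cons i L ih => rw [List.foldr_cons, List.flatMap_cons, listD_append, ih, listD_replicate]

theorem count_coordList (α : Fin n → ℕ) (i : Fin n) : (coordList α).count i = α i := by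
  have : ∀ j : Fin n, List.count i (List.replicate (α j) j) = if j = i then α i else 0 := by
    intro j
    rw [List.count_replicate]
    by_cases h : j = i <;> simp [h]
  rw [coordList, List.count_flatMap]
  simp only [Function.comp_def, this]
  rw [← List.ofFn_eq_map, List.sum_ofFn]
  simp

theorem length_coordList (α : Fin n → ℕ) : (coordList α).length = ∑ i, α i := by
  rw [coordList, List.length_flatMap]
  simp only [List.length_replicate]
  rw [← List.ofFn_eq_map, List.sum_ofFn]

theorem multiD_zero : multiD (0 : Fin n → ℕ) f = f := by
  rw [multiD_eq_listD]
  have : coordList (0 : Fin n → ℕ) = [] := by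
    rw [← List.length_eq_zero_iff, length_coordList]; simp
  rw [this]; rfl

theorem multiD_congr (hU : IsOpen U) (h : EqOn f g U) (α : Fin n → ℕ) :
    EqOn (multiD α f) (multiD α g) U := by
  simp only [multiD_eq_listD]; exact listD_congr hU h _

theorem ContDiffOn.multiD (hU : IsOpen U) {N : ℕ} (hf : ContDiffOn ℝ (N : ℕ∞ω) f U)
    (α : Fin n → ℕ) {k : ℕ} (hk : k + ∑ i, α i ≤ N) : ContDiffOn ℝ (k : ℕ∞ω) (multiD α f) U := by
  rw [multiD_eq_listD]; exact hf.listD hU _ (by rwa [length_coordList])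

theorem listD_eq_multiD (hU : IsOpen U) {N : ℕ} (hf : ContDiffOn ℝ (N : ℕ∞ω) f U)
    (I : List (Fin n)) (hI : I.length ≤ N) : EqOn (listD I f) (multiD (fun i => I.count i) f) U := by
  rw [multiD_eq_listD]
  exact listD_perm hU hf (List.perm_iff_count.2 fun i =>
    (count_coordList (fun i => I.count i) i).symm) hI

theorem multiD_multiD (hU : IsOpen U) {N : ℕ} (hf : ContDiffOn ℝ (N : ℕ∞ω) f U)
    (α β : Fin n → ℕ) (h : ∑ i, α i + ∑ i, β i ≤ N) :
    EqOn (multiD α (multiD β f)) (multiD (α + β) f) U := by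
  simp only [multiD_eq_listD, ← listD_append]
  refine listD_perm hU hf (List.perm_iff_count.2 fun i => ?_) (by simpa [length_coordList] using h)
  simp [count_coordList]

theorem partialD_multiD (hU : IsOpen U) {N : ℕ} (hf : ContDiffOn ℝ (N : ℕ∞ω) f U)
    (α : Fin n → ℕ) (i : Fin n) (h : ∑ i, α i + 1 ≤ N) :
    EqOn (partialD i (multiD α f)) (multiD (α + Pi.single i 1) f) U := by
  simp only [multiD_eq_listD, ← listD_cons]
  refine listD_perm hU hf (List.perm_iff_count.2 fun j => ?_)
    (by simpa [length_coordList] using h)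
  rw [List.count_cons, count_coordList, count_coordList]
  by_cases hj : i = j
  · subst hj; simp
  · simp [hj, Ne.symm hj]

theorem partialD_clm_comp (L : F →L[ℝ] G) (i : Fin n) {x : Eucl n} (hf : DifferentiableAt ℝ f x) :
    partialD i (fun y => L (f y)) x = L (partialD i f x) := by
  have := (L.hasFDerivAt.comp x hf.hasFDerivAt).fderiv
  simp only [partialD]
  change fderiv ℝ (L ∘ f) x _ = _
  rw [this]; rfl

theorem listD_clm_comp (hU : IsOpen U) {N : ℕ} (hf : ContDiffOn ℝ (N : ℕ∞ω) f U) (L : F →L[ℝ] G)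
    (I : List (Fin n)) : I.length ≤ N →
    EqOn (listD I (fun y => L (f y))) (fun x => L (listD I f x)) U := by
  induction I with
  | nil => intro _ x _; rfl
  | cons i I ih =>
    intro hN x hx
    have h1 : I.length + 1 ≤ N := by simpa using hN
    rw [listD_cons, partialD_congr hU (ih (by omega)) i hx, partialD_clm_comp]
    · rfl
    · exact ((hf.listD hU I (k := 1) (by omega)).contDiffAt (hU.mem_nhds hx)).differentiableAt
        (by simp)

theorem multiD_clm_comp (hU : IsOpen U) {N : ℕ} (hf : ContDiffOn ℝ (N : ℕ∞ω) f U) (L : F →L[ℝ] G)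
    (α : Fin n → ℕ) (hα : ∑ i, α i ≤ N) :
    EqOn (multiD α (fun y => L (f y))) (fun x => L (multiD α f x)) U := by
  simp only [multiD_eq_listD]
  exact listD_clm_comp hU hf L _ (by rwa [length_coordList])

theorem partialD_sub (i : Fin n) {x : Eucl n} (hf : DifferentiableAt ℝ f x)
    (hg : DifferentiableAt ℝ g x) :
    partialD i (fun y => f y - g y) x = partialD i f x - partialD i g x := by
  simp only [partialD]; rw [fderiv_fun_sub hf hg]; rfl

theorem listD_sub (hU : IsOpen U) {N : ℕ} (hf : ContDiffOn ℝ (N : ℕ∞ω) f U)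
    (hg : ContDiffOn ℝ (N : ℕ∞ω) g U) (I : List (Fin n)) : I.length ≤ N →
    EqOn (listD I (fun y => f y - g y)) (fun x => listD I f x - listD I g x) U := by
  induction I with
  | nil => intro _ x _; rfl
  | cons i I ih =>
    intro hN x hx
    have h1 : I.length + 1 ≤ N := by simpa using hN
    rw [listD_cons, partialD_congr hU (ih (by omega)) i hx, partialD_sub]
    · rfl
    · exact ((hf.listD hU I (k := 1) (by omega)).contDiffAt (hU.mem_nhds hx)).differentiableAt
        (by simp)
    · exact ((hg.listD hU I (k := 1) (by omega)).contDiffAt (hU.mem_nhds hx)).differentiableAt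
        (by simp)

theorem multiD_sub (hU : IsOpen U) {N : ℕ} (hf : ContDiffOn ℝ (N : ℕ∞ω) f U)
    (hg : ContDiffOn ℝ (N : ℕ∞ω) g U) (α : Fin n → ℕ) (hα : ∑ i, α i ≤ N) :
    EqOn (multiD α (fun y => f y - g y)) (fun x => multiD α f x - multiD α g x) U := by
  simp only [multiD_eq_listD]
  exact listD_sub hU hf hg _ (by rwa [length_coordList])

theorem partialD_const_smul (i : Fin n) (c : ℝ) :
    partialD i (fun y => c • f y) = fun x => c • partialD i f x := by
  funext x
  simp only [partialD]
  have h : fderiv ℝ (c • f) x = c • fderiv ℝ f x := by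
    rw [fderiv_const_smul_field]; rfl
  exact congrArg (fun T => T (EuclideanSpace.single i 1)) h

theorem partialD_comp_affine (i : Fin n) (Q : Eucl n) (r : ℝ) :
    partialD i (fun y => f (Q + r • y)) = fun y => r • partialD i f (Q + r • y) := by
  funext y
  simp only [partialD]
  have h1 := fderiv_comp_smul (𝕜 := ℝ) (f := fun z => f (Q + z)) (x := y) r
  rw [h1, fderiv_comp_add_left]; rfl

theorem listD_comp_affine (I : List (Fin n)) (Q : Eucl n) (r : ℝ) :
    listD I (fun y => f (Q + r • y)) = fun y => r ^ I.length • listD I f (Q + r • y) := by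
  induction I with
  | nil => simp
  | cons i I ih =>
    rw [listD_cons, ih, partialD_const_smul]
    funext y
    rw [partialD_comp_affine, List.length_cons, listD_cons, smul_smul, pow_succ]

theorem multiD_comp_affine (α : Fin n → ℕ) (Q : Eucl n) (r : ℝ) :
    multiD α (fun y => f (Q + r • y)) = fun y => r ^ (∑ i, α i) • multiD α f (Q + r • y) := by
  simp only [multiD_eq_listD, listD_comp_affine, length_coordList]

/-! ### Comparison of partial derivatives with the iterated Fréchet derivative -/

theorem iteratedFDeriv_apply_single (hU : IsOpen U) {N : ℕ} (hf : ContDiffOn ℝ (N : ℕ∞ω) f U)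
    {k : ℕ} : k ≤ N → ∀ (I : Fin k → Fin n), ∀ x ∈ U,
    iteratedFDeriv ℝ k f x (fun j => EuclideanSpace.single (I j) 1) = listD (List.ofFn I) f x := by
  induction k with
  | zero => intro _ I x _; simp
  | succ k ih =>
    intro hk I x hx
    rw [iteratedFDeriv_succ_apply_left, List.ofFn_succ, listD_cons]
    have h2 : EqOn (listD (List.ofFn fun j => I (Fin.succ j)) f)
        (fun y => iteratedFDeriv ℝ k f y (fun j => EuclideanSpace.single (I (Fin.succ j)) 1)) U :=
      fun y hy => (ih (by omega) (fun j => I (Fin.succ j)) y hy).symm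
    rw [partialD_congr hU h2 _ hx, partialD]
    have hd : DifferentiableAt ℝ (iteratedFDeriv ℝ k f) x := by
      have h3 := (hf.contDiffAt (hU.mem_nhds hx)).differentiableAt_iteratedFDeriv (m := k)
        (by exact_mod_cast hk)
      exact h3
    rw [fderiv_continuousMultilinear_apply_const_apply hd]
    rfl

theorem norm_multiD_le (hU : IsOpen U) {N : ℕ} (hf : ContDiffOn ℝ (N : ℕ∞ω) f U)
    (α : Fin n → ℕ) (hα : ∑ i, α i ≤ N) {x : Eucl n} (hx : x ∈ U) :
    ‖multiD α f x‖ ≤ ‖iteratedFDeriv ℝ (∑ i, α i) f x‖ := by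
  rw [multiD_eq_listD]
  have h := iteratedFDeriv_apply_single hU hf (length_coordList α ▸ hα) (coordList α).get x hx
  rw [List.ofFn_get] at h
  rw [← h, ← length_coordList]
  refine (ContinuousMultilinearMap.le_opNorm _ _).trans ?_
  simp

theorem ContinuousMultilinearMap.opNorm_le_sum_single {k : ℕ}
    (T : ContinuousMultilinearMap ℝ (fun _ : Fin k => Eucl n) F) :
    ‖T‖ ≤ ∑ I : Fin k → Fin n, ‖T fun j => EuclideanSpace.single (I j) 1‖ := by
  refine T.opNorm_le_bound (by positivity) fun v => ?_
  have hv : v = fun j => ∑ i, v j i • (EuclideanSpace.single i 1 : Eucl n) := by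
    funext j
    ext l
    simp [Finset.sum_apply, Pi.single_apply]
  have h1 : T v = ∑ I : Fin k → Fin n, (∏ j, v j (I j)) •
      T fun j => (EuclideanSpace.single (I j) 1 : Eucl n) := by
    conv_lhs => rw [hv]
    rw [T.map_sum]
    exact Finset.sum_congr rfl fun I _ => T.map_smul_univ _ _
  rw [h1, Finset.sum_mul]
  refine (norm_sum_le _ _).trans (Finset.sum_le_sum fun I _ => ?_)
  rw [norm_smul, mul_comm]
  gcongr
  rw [norm_prod]
  exact Finset.prod_le_prod (fun _ _ => norm_nonneg _) fun j _ => PiLp.norm_apply_le (v j) (I j)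

theorem mem_multiIndices {k : ℕ} {α : Fin n → ℕ} : α ∈ multiIndices n k ↔ ∑ i, α i = k := by
  simp [multiIndices]

/-- Together with `norm_multiD_le`, this makes the Leibniz estimates of Mathlib, which are stated
for the iterated Fréchet derivative, available for multi-index derivatives. -/
theorem norm_iteratedFDeriv_le_sum (hU : IsOpen U) {N : ℕ} (hf : ContDiffOn ℝ (N : ℕ∞ω) f U)
    {k : ℕ} (hk : k ≤ N) {x : Eucl n} (hx : x ∈ U) :
    ‖iteratedFDeriv ℝ k f x‖ ≤ (n : ℝ) ^ k * ∑ α ∈ multiIndices n k, ‖multiD α f x‖ := by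
  refine (ContinuousMultilinearMap.opNorm_le_sum_single _).trans ?_
  have : ∀ I : Fin k → Fin n, ‖iteratedFDeriv ℝ k f x fun j => EuclideanSpace.single (I j) 1‖ ≤
      ∑ α ∈ multiIndices n k, ‖multiD α f x‖ := by
    intro I
    rw [iteratedFDeriv_apply_single hU hf hk I x hx,
      listD_eq_multiD hU hf _ (by simpa using hk) hx]
    refine Finset.single_le_sum (f := fun α => ‖multiD α f x‖) (fun _ _ => norm_nonneg _) ?_
    rw [mem_multiIndices]
    have := Multiset.sum_count_eq_card (s := Finset.univ) (m := ((List.ofFn I : List (Fin n)) : Multiset (Fin n)))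
      (fun _ _ => Finset.mem_univ _)
    simpa using this
  refine (Finset.sum_le_sum fun I _ => this I).trans ?_
  simp

end Calculus

/-! ### Leibniz estimates -/

section Leibniz

variable {n : ℕ} {F : Type*} [NormedAddCommGroup F] [NormedSpace ℝ F] {U : Set (Eucl n)}

/-- The sum `∑_{|β| = k} |D^β f|`. -/
def derivSum (k : ℕ) (f : Eucl n → F) (x : Eucl n) : ℝ :=
  ∑ β ∈ multiIndices n k, ‖multiD β f x‖

theorem derivSum_nonneg (k : ℕ) (f : Eucl n → F) (x : Eucl n) : 0 ≤ derivSum k f x :=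
  Finset.sum_nonneg fun _ _ => norm_nonneg _

theorem norm_multiD_le_derivSum {k : ℕ} {α : Fin n → ℕ} (hα : ∑ i, α i = k) (f : Eucl n → F)
    (x : Eucl n) : ‖multiD α f x‖ ≤ derivSum k f x :=
  Finset.single_le_sum (f := fun β => ‖multiD β f x‖) (fun _ _ => norm_nonneg _)
    (mem_multiIndices.2 hα)

/-- The commutator of `D^α` with multiplication by a smooth function only involves derivatives of
that function: subtract its value at the point and apply the Leibniz estimate. -/
theorem norm_multiD_smul_sub_le (hU : IsOpen U) {N : ℕ} {χ : Eucl n → ℝ} (hχ : ContDiff ℝ ∞ χ)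
    {f : Eucl n → F} (hf : ContDiffOn ℝ (N : ℕ∞ω) f U) (α : Fin n → ℕ) (hα : ∑ i, α i ≤ N)
    {x : Eucl n} (hx : x ∈ U) :
    ‖multiD α (fun y => χ y • f y) x - χ x • multiD α f x‖ ≤
      ∑ j ∈ Finset.range (∑ i, α i), ((∑ i, α i).choose (j + 1) : ℝ) *
        ‖iteratedFDeriv ℝ (j + 1) χ x‖ * ‖iteratedFDeriv ℝ (∑ i, α i - (j + 1)) f x‖ := by
  set k := ∑ i, α i with hk
  have hχN : ContDiff ℝ (N : ℕ∞ω) χ := hχ.of_le (by exact_mod_cast le_top)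
  have h1 : ContDiffOn ℝ (N : ℕ∞ω) (fun y => χ y • f y) U := hχN.contDiffOn.smul hf
  have h2 : ContDiffOn ℝ (N : ℕ∞ω) (fun y => χ x • f y) U := contDiffOn_const.smul hf
  have h3 : multiD α (fun y => χ x • f y) x = χ x • multiD α f x :=
    multiD_clm_comp hU hf (χ x • ContinuousLinearMap.id ℝ F) α hα hx
  have hsub : ContDiff ℝ (N : ℕ∞ω) (fun y => χ y - χ x) := hχN.sub contDiff_const
  have h4 : multiD α (fun y => (χ y - χ x) • f y) x =
      multiD α (fun y => χ y • f y) x - χ x • multiD α f x := by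
    have h5 := multiD_sub hU h1 h2 α hα hx
    simp only [sub_smul]
    rw [← h3]
    exact h5
  rw [← h4]
  refine (norm_multiD_le hU (hsub.contDiffOn.smul hf) α hα hx).trans ?_
  rw [← iteratedFDerivWithin_of_isOpen _ hU hx]
  refine (norm_iteratedFDerivWithin_smul_le hsub.contDiffOn hf hU.uniqueDiffOn hx
    (n := ∑ i, α i) (by exact_mod_cast hα)).trans ?_
  rw [Finset.sum_range_succ', ← hk]
  have h0 : ‖iteratedFDerivWithin ℝ 0 (fun y => χ y - χ x) U x‖ = 0 := by simp
  rw [h0, mul_zero, zero_mul, add_zero]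
  refine le_of_eq (Finset.sum_congr rfl fun j _ => ?_)
  rw [iteratedFDerivWithin_of_isOpen _ hU hx, iteratedFDerivWithin_of_isOpen _ hU hx]
  congr 2
  have h5 := iteratedFDeriv_sub_apply (𝕜 := ℝ) (i := j + 1) (f := χ) (g := fun _ => χ x) (x := x)
    (hχ.of_le (by exact_mod_cast le_top)).contDiffAt contDiff_const.contDiffAt
  rw [iteratedFDeriv_const_of_ne (Nat.succ_ne_zero j)] at h5
  rw [Pi.zero_apply, sub_zero] at h5
  exact congrArg norm h5

/-- The derivatives of order `j` of a power of a cutoff function retain all but `j` of its factors. -/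
theorem norm_iteratedFDeriv_pow_le {Φ : Eucl n → ℝ} (hΦ : ContDiff ℝ ∞ Φ)
    (hc : HasCompactSupport Φ) (h0 : ∀ x, 0 ≤ Φ x) (h1 : ∀ x, Φ x ≤ 1) (p : ℕ) : ∀ j : ℕ,
    ∃ C : ℝ, 0 ≤ C ∧ ∀ x, ‖iteratedFDeriv ℝ j (fun y => Φ y ^ p) x‖ ≤ C * Φ x ^ (p - j) := by
  have hb : ∀ j : ℕ, ∃ B : ℝ, 0 ≤ B ∧ ∀ x, ‖iteratedFDeriv ℝ j Φ x‖ ≤ B := by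
    intro j
    obtain ⟨B, hB⟩ := (hc.iteratedFDeriv j).exists_bound_of_continuous
      (hΦ.continuous_iteratedFDeriv (m := j) (by exact_mod_cast le_top))
    exact ⟨max B 0, le_max_right _ _, fun x => (hB x).trans (le_max_left _ _)⟩
  choose B hB0 hB using hb
  induction p with
  | zero =>
    intro j
    refine ⟨1, zero_le_one, fun x => ?_⟩
    simp only [pow_zero, Nat.zero_sub, mul_one]
    rcases j with _ | j
    · simp
    · rw [iteratedFDeriv_const_of_ne (Nat.succ_ne_zero j)]; simp
  | succ p ih =>
    choose C hC0 hC using ih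
    intro j
    refine ⟨(∑ i ∈ Finset.range (j + 1), (j.choose i : ℝ) * B i * C (j - i)) + C j,
      add_nonneg (Finset.sum_nonneg fun i _ => mul_nonneg (mul_nonneg (by positivity) (hB0 i))
        (hC0 _)) (hC0 _), fun x => ?_⟩
    have hp : ContDiff ℝ ∞ (fun y => Φ y ^ p) := hΦ.pow p
    have := norm_iteratedFDeriv_mul_le (n := j) hΦ hp x (by exact_mod_cast le_top)
    simp only [pow_succ']
    refine this.trans ?_
    rw [Finset.sum_range_succ', Finset.sum_range_succ', add_mul, add_mul, Finset.sum_mul, add_assoc]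
    refine add_le_add (Finset.sum_le_sum fun i hi => ?_) ?_
    · rw [mul_assoc, mul_assoc, mul_assoc]
      refine mul_le_mul_of_nonneg_left ?_ (by positivity)
      refine mul_le_mul (hB _ x) ?_ (norm_nonneg _) (hB0 _)
      refine (hC _ x).trans (mul_le_mul_of_nonneg_left ?_ (hC0 _))
      have := Finset.mem_range.1 hi
      exact pow_le_pow_of_le_one (h0 x) (h1 x) (by omega)
    · refine le_add_of_nonneg_of_le (mul_nonneg (mul_nonneg (mul_nonneg (by positivity) (hB0 _))
        (hC0 _)) (pow_nonneg (h0 x) _)) ?_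
      simp only [Nat.choose_zero_right, Nat.cast_one, one_mul, Nat.sub_zero,
        norm_iteratedFDeriv_zero]
      rw [Real.norm_of_nonneg (h0 x)]
      calc Φ x * ‖iteratedFDeriv ℝ j (fun y => Φ y ^ p) x‖
          ≤ Φ x * (C j * Φ x ^ (p - j)) := mul_le_mul_of_nonneg_left (hC j x) (h0 x)
        _ = C j * Φ x ^ (p - j + 1) := by ring
        _ ≤ C j * Φ x ^ (p + 1 - j) := mul_le_mul_of_nonneg_left
            (pow_le_pow_of_le_one (h0 x) (h1 x) (by omega)) (hC0 _)

/-- Commutators of `D^α` with multiplication by a power of a cutoff function: each derivative that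
falls on the cutoff costs one power of it. -/
theorem exists_norm_multiD_pow_smul_sub_le {Φ : Eucl n → ℝ} (hΦ : ContDiff ℝ ∞ Φ)
    (hc : HasCompactSupport Φ) (h0 : ∀ x, 0 ≤ Φ x) (h1 : ∀ x, Φ x ≤ 1) (p k : ℕ) :
    ∃ C : ℝ, 0 ≤ C ∧ ∀ v : Eucl n → F, ContDiff ℝ ∞ v → ∀ α : Fin n → ℕ, ∑ i, α i = k → ∀ x,
      ‖multiD α (fun y => Φ y ^ p • v y) x - Φ x ^ p • multiD α v x‖ ≤
        C * ∑ j ∈ Finset.range k, Φ x ^ (p - (k - j)) * derivSum j v x := by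
  choose C hC0 hC using norm_iteratedFDeriv_pow_le hΦ hc h0 h1 p
  have hK0 : ∀ j, 0 ≤ (k.choose (j + 1) : ℝ) * C (j + 1) * (n : ℝ) ^ (k - (j + 1)) := fun j =>
    mul_nonneg (mul_nonneg (by positivity) (hC0 _)) (by positivity)
  refine ⟨∑ j ∈ Finset.range k, (k.choose (j + 1) : ℝ) * C (j + 1) * (n : ℝ) ^ (k - (j + 1)),
    Finset.sum_nonneg fun j _ => hK0 j, fun v hv α hα x => ?_⟩
  have hvk : ContDiffOn ℝ (k : ℕ∞ω) v univ := (hv.of_le (by exact_mod_cast le_top)).contDiffOn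
  refine (norm_multiD_smul_sub_le isOpen_univ (hΦ.pow p) hvk α hα.le (mem_univ x)).trans ?_
  rw [hα, Finset.sum_mul]
  refine Finset.sum_le_sum fun j hj => ?_
  have hj' := Finset.mem_range.1 hj
  have h2 := norm_iteratedFDeriv_le_sum isOpen_univ hvk (k := k - (j + 1)) (Nat.sub_le _ _)
    (mem_univ x)
  have h3 : Φ x ^ (p - (j + 1)) * derivSum (k - (j + 1)) v x ≤
      ∑ j ∈ Finset.range k, Φ x ^ (p - (k - j)) * derivSum j v x := by
    have := Finset.single_le_sum (f := fun j => Φ x ^ (p - (k - j)) * derivSum j v x)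
      (s := Finset.range k) (fun i _ => mul_nonneg (pow_nonneg (h0 x) _) (derivSum_nonneg _ _ _))
      (Finset.mem_range.2 (show k - (j + 1) < k by omega))
    have h4 : k - (k - (j + 1)) = j + 1 := by omega
    simpa only [h4] using this
  calc (k.choose (j + 1) : ℝ) * ‖iteratedFDeriv ℝ (j + 1) (fun y => Φ y ^ p) x‖ *
        ‖iteratedFDeriv ℝ (k - (j + 1)) v x‖
      ≤ (k.choose (j + 1) : ℝ) * (C (j + 1) * Φ x ^ (p - (j + 1))) *
        ((n : ℝ) ^ (k - (j + 1)) * derivSum (k - (j + 1)) v x) := by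
        gcongr
        · exact mul_nonneg (by positivity) (mul_nonneg (hC0 _) (pow_nonneg (h0 x) _))
        · exact hC _ x
        · exact h2
    _ = (k.choose (j + 1) : ℝ) * C (j + 1) * (n : ℝ) ^ (k - (j + 1)) *
        (Φ x ^ (p - (j + 1)) * derivSum (k - (j + 1)) v x) := by ring
    _ ≤ _ := mul_le_mul_of_nonneg_left h3 (hK0 j)

end Leibniz

/-! ### Normalisation of the coefficients -/

section Coefficients

variable {n m : ℕ}

theorem continuous_monomial (γ : Fin n → ℕ) : Continuous fun ξ : Eucl n => ∏ i, ξ i ^ γ i := by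
  fun_prop

theorem monomial_smul (γ : Fin n → ℕ) (t : ℝ) (ξ : Eucl n) :
    ∏ i, (t • ξ) i ^ γ i = t ^ (∑ i, γ i) * ∏ i, ξ i ^ γ i := by
  simp only [PiLp.smul_apply, smul_eq_mul, mul_pow, Finset.prod_mul_distrib,
    Finset.prod_pow_eq_pow_sum]

/-- A homogeneous polynomial that vanishes on the unit ball has vanishing coefficients. -/
theorem coeff_eq_zero_of_forall_unitBall {N : ℕ} (c : (Fin n → ℕ) → ℝ)
    (h : ∀ ξ : Eucl n, ‖ξ‖ ≤ 1 → ∑ γ ∈ multiIndices n N, c γ * ∏ i, ξ i ^ γ i = 0)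
    {γ : Fin n → ℕ} (hγ : γ ∈ multiIndices n N) : c γ = 0 := by
  have hall : ∀ ξ : Eucl n, ∑ γ ∈ multiIndices n N, c γ * ∏ i, ξ i ^ γ i = 0 := by
    intro ξ
    have ht : 0 < ‖ξ‖ + 1 := by positivity
    have h1 := h ((‖ξ‖ + 1)⁻¹ • ξ) (by
      rw [norm_smul, norm_inv, Real.norm_of_nonneg ht.le, inv_mul_le_iff₀ ht]; simp)
    have h2 : ∑ γ ∈ multiIndices n N, c γ * ∏ i, ((‖ξ‖ + 1)⁻¹ • ξ) i ^ γ i =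
        ((‖ξ‖ + 1)⁻¹) ^ N * ∑ γ ∈ multiIndices n N, c γ * ∏ i, ξ i ^ γ i := by
      rw [Finset.mul_sum]
      refine Finset.sum_congr rfl fun γ hγ => ?_
      rw [monomial_smul, mem_multiIndices.1 hγ]; ring
    rw [h2] at h1
    exact (mul_eq_zero.1 h1).resolve_left (by positivity)
  set p : MvPolynomial (Fin n) ℝ :=
    ∑ γ ∈ multiIndices n N, MvPolynomial.monomial (Finsupp.equivFunOnFinite.symm γ) (c γ) with hp
  have hp0 : p = 0 := by
    refine MvPolynomial.funext fun x => ?_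
    rw [hp, map_sum, map_zero, ← hall (WithLp.toLp 2 x)]
    refine Finset.sum_congr rfl fun γ _ => ?_
    rw [MvPolynomial.eval_monomial, Finsupp.prod_fintype _ _ (by simp)]
    simp
  have h3 : MvPolynomial.coeff (Finsupp.equivFunOnFinite.symm γ) p = c γ := by
    rw [hp, MvPolynomial.coeff_sum]
    simp only [MvPolynomial.coeff_monomial, EmbeddingLike.apply_eq_iff_eq]
    rw [Finset.sum_ite_eq' , if_pos hγ]
  rw [← h3, hp0, MvPolynomial.coeff_zero]

theorem exists_norm_le_mul_of_ker_eq_bot {E G : Type*} [NormedAddCommGroup E] [NormedSpace ℝ E]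
    [FiniteDimensional ℝ E] [NormedAddCommGroup G] [NormedSpace ℝ G] (T : E →ₗ[ℝ] G)
    (hT : LinearMap.ker T = ⊥) : ∃ K : ℝ, 0 ≤ K ∧ ∀ c, ‖c‖ ≤ K * ‖T c‖ := by
  obtain ⟨K, -, hK⟩ := T.exists_antilipschitzWith hT
  refine ⟨K, K.2, fun c => ?_⟩
  have h1 := hK.le_mul_dist c 0
  rwa [map_zero, dist_zero_right, dist_zero_right] at h1

/-- The coefficients of a homogeneous polynomial are controlled by its size on the unit ball, as all
norms on a finite-dimensional space are equivalent. -/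
theorem exists_coeff_bound (n N : ℕ) : ∃ M : ℝ, 0 ≤ M ∧ ∀ (c : (Fin n → ℕ) → ℝ) (t : ℝ), 0 ≤ t →
    (∀ ξ : Eucl n, ‖ξ‖ ≤ 1 → |∑ γ ∈ multiIndices n N, c γ * ∏ i, ξ i ^ γ i| ≤ t) →
    ∀ γ ∈ multiIndices n N, |c γ| ≤ M * t := by
  generalize hS : multiIndices n N = S
  obtain ⟨T, hT⟩ : ∃ T : (S → ℝ) →ₗ[ℝ] C(Metric.closedBall (0 : Eucl n) 1, ℝ),
      ∀ (c : (Fin n → ℕ) → ℝ) (ξ : Metric.closedBall (0 : Eucl n) 1),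
      T (fun γ => c γ) ξ = ∑ γ ∈ S, c γ * ∏ i, (ξ : Eucl n) i ^ γ i := by
    refine ⟨Fintype.linearCombination ℝ fun γ : S =>
      (⟨fun ξ => ∏ i, (ξ : Eucl n) i ^ (γ : Fin n → ℕ) i,
      (continuous_monomial (γ : Fin n → ℕ)).comp continuous_subtype_val⟩ :
        C(Metric.closedBall (0 : Eucl n) 1, ℝ)), fun c ξ => ?_⟩
    rw [← Finset.sum_coe_sort]
    simp [Fintype.linearCombination_apply]
  have hker : LinearMap.ker T = ⊥ := by
    rw [LinearMap.ker_eq_bot']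
    intro d hd
    classical
    let c : (Fin n → ℕ) → ℝ := fun γ => if h : γ ∈ S then d ⟨γ, h⟩ else 0
    have hc : (fun γ : S => c γ) = d := by
      funext γ; simp [c]
    funext γ
    rw [← hc]
    refine coeff_eq_zero_of_forall_unitBall (N := N) c (fun ξ hξ => ?_) (hS ▸ γ.2)
    rw [hS, ← hT c ⟨ξ, by simpa using hξ⟩, hc, hd]; rfl
  obtain ⟨K, hK0, hK⟩ := exists_norm_le_mul_of_ker_eq_bot T hker
  refine ⟨K, hK0, fun c t ht h γ hγ => ?_⟩
  have h1 := hK (fun γ => c γ)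
  have h2 : ‖T (fun γ => c γ)‖ ≤ t :=
    (ContinuousMap.norm_le _ ht).2 fun ξ => by
      rw [hT, Real.norm_eq_abs]; exact h ξ (mem_closedBall_zero_iff.1 ξ.2)
  calc |c γ| = ‖(fun γ : S => c γ) ⟨γ, hγ⟩‖ := rfl
    _ ≤ ‖fun γ : S => c γ‖ := norm_le_pi_norm (fun γ : S => c γ) ⟨γ, hγ⟩
    _ ≤ K * t := h1.trans (mul_le_mul_of_nonneg_left h2 hK0)

/-- Averaging `f` over the fibres of `s` does not change its sum against functions of `s`. -/
theorem sum_fiber_average {ι κ : Type*} [DecidableEq κ] (P : Finset ι) (s : ι → κ) (f : ι → ℝ)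
    (G : κ → ℝ) :
    ∑ p ∈ P, (∑ q ∈ P with s q = s p, f q) / (({q ∈ P | s q = s p}.card : ℕ) : ℝ) * G (s p) =
      ∑ p ∈ P, f p * G (s p) := by
  have h1 : ∀ p ∈ P, (∑ q ∈ P with s q = s p, f q) / (({q ∈ P | s q = s p}.card : ℕ) : ℝ) * G (s p) =
      ∑ q ∈ P, if s q = s p then f q * G (s q) / (({r ∈ P | s r = s q}.card : ℕ) : ℝ) else 0 := by
    intro p _
    rw [← Finset.sum_filter, Finset.sum_div, Finset.sum_mul]
    refine Finset.sum_congr rfl fun q hq => ?_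
    rw [(Finset.mem_filter.1 hq).2]; ring
  rw [Finset.sum_congr rfl h1, Finset.sum_comm]
  refine Finset.sum_congr rfl fun q hq => ?_
  have h2 : ∀ p, (s q = s p) ↔ (s p = s q) := fun p => eq_comm
  simp only [h2]
  rw [← Finset.sum_filter, Finset.sum_const, nsmul_eq_mul]
  have h3 : (({r ∈ P | s r = s q}.card : ℕ) : ℝ) ≠ 0 := by
    have : q ∈ {r ∈ P | s r = s q} := Finset.mem_filter.2 ⟨hq, rfl⟩
    exact_mod_cast (Finset.card_pos.2 ⟨q, this⟩).ne'
  field_simp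

theorem symbol_eq_sum_product (ℓ : ℕ) (a : Coeffs n m) (j k : Fin m) (ξ : Eucl n) :
    symbol ℓ a j k ξ = ∑ p ∈ multiIndices n ℓ ×ˢ multiIndices n ℓ,
      a p.1 p.2 j k * ∏ i, ξ i ^ (p.1 + p.2) i := by
  rw [Finset.sum_product]
  simp only [symbol, Pi.add_apply, pow_add, Finset.prod_mul_distrib, mul_assoc]

/-- The entries of the symbol are bounded by polarisation of the quadratic form. -/
theorem IsSymmElliptic.abs_symbol_le {ℓ : ℕ} {μ : ℝ} (hμ : 0 < μ) {a : Coeffs n m}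
    (ha : IsSymmElliptic ℓ μ a) (j k : Fin m) {ξ : Eucl n} (hξ : ‖ξ‖ ≤ 1) :
    |symbol ℓ a j k ξ| ≤ 1 / μ := by
  set q : Eucl m → ℝ := fun η => ∑ j, ∑ k, symbol ℓ a j k ξ * η j * η k with hq
  have hlow : ∀ η, 0 ≤ q η := fun η => le_trans (by positivity) (ha.lower ξ η)
  have hup : ∀ η, ‖η‖ ^ 2 ≤ 4 → q η ≤ 4 * (1 / μ) := by
    intro η hη
    refine (ha.upper ξ η).trans ?_
    have h1 : ‖ξ‖ ^ (2 * ℓ) ≤ 1 := pow_le_one₀ (norm_nonneg _) hξ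
    have h0 : 0 < 1 / μ := by positivity
    calc 1 / μ * ‖ξ‖ ^ (2 * ℓ) * ‖η‖ ^ 2 ≤ 1 / μ * 1 * 4 := by gcongr
      _ = 4 * (1 / μ) := by ring
  set e : Fin m → Eucl m := fun i => EuclideanSpace.single i 1 with he
  have hsum : ∀ b : Fin m → Fin m → ℝ, ∀ i₁ i₂, ∑ j, ∑ k, b j k * e i₁ j * e i₂ k = b i₁ i₂ := by
    intro b i₁ i₂
    simp [he, Finset.sum_ite_eq']
  have hpol : q (e j + e k) - q (e j - e k) = 4 * symbol ℓ a j k ξ := by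
    have h1 : q (e j + e k) - q (e j - e k) =
        2 * (∑ p, ∑ r, symbol ℓ a p r ξ * e j p * e k r) +
        2 * (∑ p, ∑ r, symbol ℓ a p r ξ * e k p * e j r) := by
      simp only [hq, Finset.mul_sum, ← Finset.sum_sub_distrib, ← Finset.sum_add_distrib]
      refine Finset.sum_congr rfl fun p _ => Finset.sum_congr rfl fun r _ => ?_
      simp only [PiLp.add_apply, PiLp.sub_apply]; ring
    rw [h1, hsum, hsum, ha.symm k j]; ring
  have he1 : ∀ i, ‖e i‖ = 1 := fun i => by simp [he]
  have hn1 : ‖e j + e k‖ ^ 2 ≤ 4 := by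
    have := norm_add_le (e j) (e k)
    rw [he1, he1] at this
    nlinarith [norm_nonneg (e j + e k)]
  have hn2 : ‖e j - e k‖ ^ 2 ≤ 4 := by
    have := norm_sub_le (e j) (e k)
    rw [he1, he1] at this
    nlinarith [norm_nonneg (e j - e k)]
  rw [abs_le]
  constructor <;> nlinarith [hlow (e j + e k), hlow (e j - e k), hup _ hn1, hup _ hn2]

/-- The coefficients averaged over all pairs `(α', β')` with the same sum `α + β`. They define the
same symbol and the same operator. -/
def averagedCoeffs (ℓ : ℕ) (a : Coeffs n m) : Coeffs n m := fun α β j k =>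
  (∑ q ∈ multiIndices n ℓ ×ˢ multiIndices n ℓ with q.1 + q.2 = α + β, a q.1 q.2 j k) /
    (({q ∈ multiIndices n ℓ ×ˢ multiIndices n ℓ | q.1 + q.2 = α + β}.card : ℕ) : ℝ)

theorem sum_averagedCoeffs (ℓ : ℕ) (a : Coeffs n m) (j k : Fin m) (G : (Fin n → ℕ) → ℝ) :
    ∑ α ∈ multiIndices n ℓ, ∑ β ∈ multiIndices n ℓ, averagedCoeffs ℓ a α β j k * G (α + β) =
      ∑ α ∈ multiIndices n ℓ, ∑ β ∈ multiIndices n ℓ, a α β j k * G (α + β) := by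
  have := sum_fiber_average (multiIndices n ℓ ×ˢ multiIndices n ℓ) (fun p => p.1 + p.2)
    (fun p => a p.1 p.2 j k) G
  rwa [Finset.sum_product, Finset.sum_product] at this

theorem symbol_averagedCoeffs (ℓ : ℕ) (a : Coeffs n m) (j k : Fin m) (ξ : Eucl n) :
    symbol ℓ (averagedCoeffs ℓ a) j k ξ = symbol ℓ a j k ξ := by
  have := sum_averagedCoeffs ℓ a j k fun γ => ∏ i, ξ i ^ γ i
  simpa only [symbol, Pi.add_apply, pow_add, Finset.prod_mul_distrib, mul_assoc] using this

theorem IsSymmElliptic.averagedCoeffs {ℓ : ℕ} {μ : ℝ} {a : Coeffs n m}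
    (ha : IsSymmElliptic ℓ μ a) : IsSymmElliptic ℓ μ (averagedCoeffs ℓ a) where
  symm j k ξ := by simp only [symbol_averagedCoeffs, ha.symm j k ξ]
  lower ξ η := by simpa only [symbol_averagedCoeffs] using ha.lower ξ η
  upper ξ η := by simpa only [symbol_averagedCoeffs] using ha.upper ξ η

theorem systemOp_averagedCoeffs {ℓ : ℕ} (a : Coeffs n m) {U : Set (Eucl n)} (hU : IsOpen U)
    {u : Eucl n → Eucl m} (hu : ContDiffOn ℝ ((2 * ℓ : ℕ) : ℕ∞ω) u U) (j : Fin m) {x : Eucl n}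
    (hx : x ∈ U) : systemOp ℓ (averagedCoeffs ℓ a) u j x = systemOp ℓ a u j x := by
  unfold systemOp
  refine Finset.sum_congr rfl fun k _ => ?_
  have huk : ContDiffOn ℝ ((2 * ℓ : ℕ) : ℕ∞ω) (fun y => u y k) U := by
    exact (EuclideanSpace.proj (𝕜 := ℝ) k : Eucl m →L[ℝ] ℝ).contDiff.comp_contDiffOn hu
  have h1 : ∀ b : Coeffs n m, ∑ α ∈ multiIndices n ℓ, ∑ β ∈ multiIndices n ℓ,
      b α β j k * multiD α (multiD β fun y => u y k) x =
      ∑ α ∈ multiIndices n ℓ, ∑ β ∈ multiIndices n ℓ, b α β j k * multiD (α + β) (fun y => u y k) x := by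
    intro b
    refine Finset.sum_congr rfl fun α hα => Finset.sum_congr rfl fun β hβ => ?_
    rw [multiD_multiD hU huk α β (by
      rw [mem_multiIndices.1 hα, mem_multiIndices.1 hβ]; omega) hx]
  rw [h1, h1, sum_averagedCoeffs ℓ a j k fun γ => multiD γ (fun y => u y k) x]

/-- The symbol only determines the sums of the coefficients over pairs with the same `α + β`, so the
coefficients themselves need not be bounded in terms of `μ`. Their averages are: they are the
coefficients of the symbol as a polynomial, up to combinatorial factors. -/
theorem exists_averagedCoeffs_bound (n m ℓ : ℕ) {μ : ℝ} (hμ : 0 < μ) :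
    ∃ M : ℝ, 0 ≤ M ∧ ∀ a : Coeffs n m, IsSymmElliptic ℓ μ a → ∀ α ∈ multiIndices n ℓ,
      ∀ β ∈ multiIndices n ℓ, ∀ j k, |averagedCoeffs ℓ a α β j k| ≤ M := by
  obtain ⟨M, hM0, hM⟩ := exists_coeff_bound n (2 * ℓ)
  refine ⟨M * (1 / μ), by positivity, fun a ha α hα β hβ j k => ?_⟩
  set P := multiIndices n ℓ ×ˢ multiIndices n ℓ with hP
  have h1 : |∑ q ∈ P with q.1 + q.2 = α + β, a q.1 q.2 j k| ≤ M * (1 / μ) := by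
    refine hM (fun γ => ∑ q ∈ P with q.1 + q.2 = γ, a q.1 q.2 j k) (1 / μ) (by positivity)
      (fun ξ hξ => ?_) (α + β) ?_
    · have := ha.abs_symbol_le hμ j k hξ
      rw [symbol_eq_sum_product] at this
      convert this using 2
      rw [← Finset.sum_fiberwise_of_maps_to (s := P) (t := multiIndices n (2 * ℓ))
        (g := fun p => p.1 + p.2)]
      · refine Finset.sum_congr rfl fun γ _ => ?_
        rw [Finset.sum_mul]
        refine Finset.sum_congr rfl fun q hq => ?_
        rw [(Finset.mem_filter.1 hq).2]
      · intro p hp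
        have := Finset.mem_product.1 hp
        rw [mem_multiIndices]
        simp only [Pi.add_apply, Finset.sum_add_distrib, mem_multiIndices.1 this.1,
          mem_multiIndices.1 this.2]; omega
    · rw [mem_multiIndices]
      simp only [Pi.add_apply, Finset.sum_add_distrib, mem_multiIndices.1 hα,
          mem_multiIndices.1 hβ]; omega
  rw [averagedCoeffs, abs_div, Nat.abs_cast]
  have h2 : (1 : ℝ) ≤ (({q ∈ P | q.1 + q.2 = α + β}.card : ℕ) : ℝ) := by
    have : (α, β) ∈ {q ∈ P | q.1 + q.2 = α + β} :=
      Finset.mem_filter.2 ⟨Finset.mem_product.2 ⟨hα, hβ⟩, rfl⟩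
    exact_mod_cast Finset.card_pos.2 ⟨_, this⟩
  exact (div_le_self (abs_nonneg _) h2).trans h1

end Coefficients

/-! ### Gårding's inequality -/

section Garding

open SchwartzMap LineDeriv
open scoped FourierTransform

variable {n m : ℕ}

/-- The iterated partial derivative of a Schwartz function along a list of coordinates. -/
def schwartzListD (I : List (Fin n)) (φ : 𝓢(Eucl n, ℂ)) : 𝓢(Eucl n, ℂ) :=
  I.foldr (fun i ψ => ∂_{(EuclideanSpace.single i 1 : Eucl n)} ψ) φ

theorem coe_schwartzListD (I : List (Fin n)) (φ : 𝓢(Eucl n, ℂ)) :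
    ⇑(schwartzListD I φ) = listD I ⇑φ := by
  induction I with
  | nil => rfl
  | cons i I ih =>
    funext x
    rw [listD_cons, ← ih]
    exact SchwartzMap.lineDerivOp_apply_eq_fderiv _ _ _

/-- In the normalisation of the Fourier transform used here, `∂ᵢ` becomes multiplication by
`2πi ξᵢ`. -/
theorem fourier_schwartzListD (I : List (Fin n)) (φ : 𝓢(Eucl n, ℂ)) (ξ : Eucl n) :
    𝓕 (schwartzListD I φ) ξ = (I.map fun i => 2 * Real.pi * Complex.I * (ξ i : ℂ)).prod * 𝓕 φ ξ := by
  induction I with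
  | nil => simp [schwartzListD]
  | cons i I ih =>
    have h1 : 𝓕 (schwartzListD (i :: I) φ) = (2 * Real.pi * Complex.I) • smulLeftCLM ℂ
        (inner ℝ · (EuclideanSpace.single i 1 : Eucl n)) (𝓕 (schwartzListD I φ)) :=
      fourier_lineDerivOp_eq _ _
    have h2 : (fun x : Eucl n => inner ℝ x (EuclideanSpace.single i 1 : Eucl n)).HasTemperateGrowth :=
      by fun_prop
    rw [h1, smul_apply, smulLeftCLM_apply_apply h2, ih]
    simp [EuclideanSpace.inner_single_right]
    ring

theorem prod_map_coordList {M : Type*} [CommMonoid M] (α : Fin n → ℕ) (c : Fin n → M) :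
    ((coordList α).map c).prod = ∏ i, c i ^ α i := by
  rw [Finset.prod_list_map_count]
  simp only [count_coordList]
  refine Finset.prod_subset (Finset.subset_univ _) fun i _ hi => ?_
  have : α i = 0 := by
    rw [← count_coordList α i, List.count_eq_zero]; simpa using hi
  rw [this, pow_zero]

/-- A real function as a complex Schwartz function. -/
def realSchwartz (f : Eucl n → ℝ) (hf : ContDiff ℝ ∞ f) (hc : HasCompactSupport f) :
    𝓢(Eucl n, ℂ) :=
  HasCompactSupport.toSchwartzMap (f := fun x => (f x : ℂ))
    (hc.comp_left (g := fun t : ℝ => (t : ℂ)) (by simp)) (Complex.ofRealCLM.contDiff.comp hf)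

theorem schwartzListD_realSchwartz (f : Eucl n → ℝ) (hf : ContDiff ℝ ∞ f)
    (hc : HasCompactSupport f) (α : Fin n → ℕ) (x : Eucl n) :
    schwartzListD (coordList α) (realSchwartz f hf hc) x = ((multiD α f x : ℝ) : ℂ) := by
  rw [coe_schwartzListD, ← multiD_eq_listD]
  exact multiD_clm_comp isOpen_univ (N := ∑ i, α i)
    (hf.of_le (by exact_mod_cast le_top)).contDiffOn Complex.ofRealCLM α le_rfl (mem_univ x)

/-- Plancherel's theorem for derivatives of equal order: with `|α| = |β|` the two powers of `i`
cancel. -/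
theorem integral_multiD_mul_multiD {ℓ : ℕ} {α β : Fin n → ℕ} (hα : ∑ i, α i = ℓ)
    (hβ : ∑ i, β i = ℓ) {f g : Eucl n → ℝ} (hf : ContDiff ℝ ∞ f) (hfc : HasCompactSupport f)
    (hg : ContDiff ℝ ∞ g) (hgc : HasCompactSupport g) :
    Integrable (fun ξ : Eucl n => (2 * Real.pi) ^ (2 * ℓ) * ((∏ i, ξ i ^ α i) * ∏ i, ξ i ^ β i) *
        (starRingEnd ℂ (𝓕 (realSchwartz f hf hfc) ξ) * 𝓕 (realSchwartz g hg hgc) ξ).re) ∧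
      ∫ x, multiD α f x * multiD β g x =
        ∫ ξ : Eucl n, (2 * Real.pi) ^ (2 * ℓ) * ((∏ i, ξ i ^ α i) * ∏ i, ξ i ^ β i) *
        (starRingEnd ℂ (𝓕 (realSchwartz f hf hfc) ξ) * 𝓕 (realSchwartz g hg hgc) ξ).re := by
  set φ := schwartzListD (coordList α) (realSchwartz f hf hfc)
  set ψ := schwartzListD (coordList β) (realSchwartz g hg hgc)
  have hφ : ∀ x, φ x = ((multiD α f x : ℝ) : ℂ) := schwartzListD_realSchwartz f hf hfc α
  have hψ : ∀ x, ψ x = ((multiD β g x : ℝ) : ℂ) := schwartzListD_realSchwartz g hg hgc β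
  have h1 := integral_inner_fourier_fourier φ ψ
  have hint : Integrable (fun ξ => inner ℂ (𝓕 φ ξ) (𝓕 ψ ξ)) := by
    have h := L2.integrable_inner (𝕜 := ℂ) ((𝓕 φ).toLp 2 (volume : Measure (Eucl n)))
      ((𝓕 ψ).toLp 2 (volume : Measure (Eucl n)))
    refine h.congr ?_
    filter_upwards [(𝓕 φ).coeFn_toLp 2, (𝓕 ψ).coeFn_toLp 2] with ξ h1 h2
    rw [h1, h2]
  have hmon : ∀ (γ : Fin n → ℕ) (ξ : Eucl n), (∑ i, γ i = ℓ) →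
      ∏ i, (2 * Real.pi * Complex.I * (ξ i : ℂ)) ^ γ i =
        Complex.I ^ ℓ * (((2 * Real.pi) ^ ℓ * ∏ i, ξ i ^ γ i : ℝ) : ℂ) := by
    intro γ ξ hγ
    simp only [mul_pow, Finset.prod_mul_distrib, Finset.prod_pow_eq_pow_sum, hγ]
    push_cast
    ring
  have h2 : ∀ ξ : Eucl n, (inner ℂ (𝓕 φ ξ) (𝓕 ψ ξ)).re =
      (2 * Real.pi) ^ (2 * ℓ) * ((∏ i, ξ i ^ α i) * ∏ i, ξ i ^ β i) *
        (starRingEnd ℂ (𝓕 (realSchwartz f hf hfc) ξ) * 𝓕 (realSchwartz g hg hgc) ξ).re := by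
    intro ξ
    rw [fourier_schwartzListD, fourier_schwartzListD, prod_map_coordList, prod_map_coordList,
      hmon α ξ hα, hmon β ξ hβ, RCLike.inner_apply']
    simp only [map_mul, map_pow, Complex.conj_I, Complex.conj_ofReal]
    have h3 : (-Complex.I) ^ ℓ * Complex.I ^ ℓ = 1 := by
      rw [← mul_pow, neg_mul, Complex.I_mul_I, neg_neg, one_pow]
    rw [← Complex.re_ofReal_mul]
    congr 1
    push_cast
    linear_combination (((2 * Real.pi) ^ ℓ * ∏ i, (ξ i : ℂ) ^ α i) * ((2 * Real.pi) ^ ℓ *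
      ∏ i, (ξ i : ℂ) ^ β i) * (starRingEnd ℂ (𝓕 (realSchwartz f hf hfc) ξ)) *
      𝓕 (realSchwartz g hg hgc) ξ) * h3
  refine ⟨by simpa only [RCLike.re_to_complex, h2] using hint.re, ?_⟩
  have h4 : ∫ x, multiD α f x * multiD β g x = (∫ x, inner ℂ (φ x) (ψ x)).re := by
    have h5 : ∀ x, inner ℂ (φ x) (ψ x) = ((multiD α f x * multiD β g x : ℝ) : ℂ) := by
      intro x
      rw [hφ, hψ, RCLike.inner_apply', Complex.conj_ofReal]; push_cast; rfl
    simp only [h5]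
    rw [integral_complex_ofReal, Complex.ofReal_re]
  rw [h4, ← h1]
  simp only [← h2]
  exact (integral_re hint).symm

theorem ContDiff.multiD {F : Type*} [NormedAddCommGroup F] [NormedSpace ℝ F] {v : Eucl n → F}
    (hv : ContDiff ℝ ∞ v) (α : Fin n → ℕ) : ContDiff ℝ ∞ (multiD α v) := by
  rw [contDiff_infty]
  intro k
  have := ContDiffOn.multiD isOpen_univ (N := k + ∑ i, α i)
    (hv.of_le (by exact_mod_cast le_top)).contDiffOn α (k := k) le_rfl
  exact contDiffOn_univ.1 this

theorem tsupport_partialD_subset {F : Type*} [NormedAddCommGroup F] [NormedSpace ℝ F]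
    (i : Fin n) (v : Eucl n → F) : tsupport (partialD i v) ⊆ tsupport v :=
  tsupport_fderiv_apply_subset ℝ _

theorem tsupport_multiD_subset {F : Type*} [NormedAddCommGroup F] [NormedSpace ℝ F]
    (α : Fin n → ℕ) (v : Eucl n → F) : tsupport (multiD α v) ⊆ tsupport v := by
  rw [multiD_eq_listD]
  induction coordList α with
  | nil => exact subset_rfl
  | cons i I ih => exact (tsupport_partialD_subset i _).trans ih

theorem HasCompactSupport.multiD {F : Type*} [NormedAddCommGroup F] [NormedSpace ℝ F]
    {v : Eucl n → F} (hv : HasCompactSupport v) (α : Fin n → ℕ) :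
    HasCompactSupport (multiD α v) :=
  hv.of_isClosed_subset (isClosed_tsupport _) (tsupport_multiD_subset α v)

theorem ContDiff.component {v : Eucl n → Eucl m} (hv : ContDiff ℝ ∞ v) (j : Fin m) :
    ContDiff ℝ ∞ fun x => v x j :=
  (EuclideanSpace.proj (𝕜 := ℝ) j : Eucl m →L[ℝ] ℝ).contDiff.comp hv

theorem HasCompactSupport.component {v : Eucl n → Eucl m} (hv : HasCompactSupport v) (j : Fin m) :
    HasCompactSupport fun x => v x j :=
  hv.comp_left (g := fun y : Eucl m => y j) (by simp)

theorem multiD_component {U : Set (Eucl n)} (hU : IsOpen U) {N : ℕ} {v : Eucl n → Eucl m}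
    (hv : ContDiffOn ℝ (N : ℕ∞ω) v U) (α : Fin n → ℕ) (hα : ∑ i, α i ≤ N) (j : Fin m) {x : Eucl n}
    (hx : x ∈ U) : multiD α (fun y => v y j) x = multiD α v x j :=
  multiD_clm_comp hU hv (EuclideanSpace.proj (𝕜 := ℝ) j : Eucl m →L[ℝ] ℝ) α hα hx

theorem ContDiff.multiD_component {v : Eucl n → Eucl m} (hv : ContDiff ℝ ∞ v) (α : Fin n → ℕ)
    (j : Fin m) (x : Eucl n) : _root_.multiD α (fun y => v y j) x = _root_.multiD α v x j :=
  _root_.multiD_component isOpen_univ (N := ∑ i, α i)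
    (hv.of_le (by exact_mod_cast le_top)).contDiffOn α le_rfl j (mem_univ x)

/-- The integrand of the bilinear form of the system,
`∑_{j,k} ∑_{|α| = |β| = ℓ} a^{jk}_{αβ} D^α v^j D^β w^k`. -/
def coeffForm (ℓ : ℕ) (a : Coeffs n m) (v w : Eucl n → Eucl m) (x : Eucl n) : ℝ :=
  ∑ j, ∑ k, ∑ α ∈ multiIndices n ℓ, ∑ β ∈ multiIndices n ℓ,
    a α β j k * (multiD α v x j * multiD β w x k)

theorem prod_pow_sq_le (α : Fin n → ℕ) {ℓ : ℕ} (hα : ∑ i, α i = ℓ) (ξ : Eucl n) :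
    (∏ i, ξ i ^ α i) * ∏ i, ξ i ^ α i ≤ ‖ξ‖ ^ (2 * ℓ) := by
  have h1 : |∏ i, ξ i ^ α i| ≤ ‖ξ‖ ^ ℓ := by
    rw [Finset.abs_prod, ← hα, ← Finset.prod_pow_eq_pow_sum]
    refine Finset.prod_le_prod (fun _ _ => abs_nonneg _) fun i _ => ?_
    rw [abs_pow]
    exact pow_le_pow_left₀ (abs_nonneg _) (PiLp.norm_apply_le ξ i) _
  rw [← abs_mul_abs_self, two_mul, pow_add]
  exact mul_le_mul h1 h1 (abs_nonneg _) (by positivity)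

/-- Gårding's inequality without lower-order terms: for constant coefficients, Plancherel's theorem
turns the Legendre–Hadamard condition at each frequency into coercivity of the form. -/
theorem IsSymmElliptic.garding {ℓ : ℕ} {μ : ℝ} (hμ : 0 < μ) {a : Coeffs n m}
    (ha : IsSymmElliptic ℓ μ a) {v : Eucl n → Eucl m} (hv : ContDiff ℝ ∞ v)
    (hc : HasCompactSupport v) {α : Fin n → ℕ} (hα : α ∈ multiIndices n ℓ) :
    μ * ∫ x, ‖multiD α v x‖ ^ 2 ≤ ∫ x, coeffForm ℓ a v v x := by
  set F : Fin m → Eucl n → ℂ := fun j ξ =>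
    𝓕 (realSchwartz (fun x => v x j) (hv.component j) (hc.component j)) ξ
  have key := fun (α β : Fin n → ℕ) (hα : ∑ i, α i = ℓ) (hβ : ∑ i, β i = ℓ) (j k : Fin m) =>
    integral_multiD_mul_multiD hα hβ (hv.component j) (hc.component j) (hv.component k)
      (hc.component k)
  simp only [hv.multiD_component] at key
  change ∀ (α β : Fin n → ℕ) (_ : ∑ i, α i = ℓ) (_ : ∑ i, β i = ℓ) (j k : Fin m),
    Integrable (fun ξ : Eucl n => (2 * Real.pi) ^ (2 * ℓ) * ((∏ i, ξ i ^ α i) * ∏ i, ξ i ^ β i) *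
      (starRingEnd ℂ (F j ξ) * F k ξ).re) ∧
    ∫ x, multiD α v x j * multiD β v x k = ∫ ξ : Eucl n, (2 * Real.pi) ^ (2 * ℓ) *
      ((∏ i, ξ i ^ α i) * ∏ i, ξ i ^ β i) * (starRingEnd ℂ (F j ξ) * F k ξ).re at key
  have hcont : ∀ α j, Continuous fun x => multiD α v x j := fun α j =>
    ((hv.multiD α).component j).continuous
  have hint : ∀ α β j k, Integrable fun x => multiD α v x j * multiD β v x k := fun α β j k =>
    ((hcont α j).mul (hcont β k)).integrable_of_hasCompactSupport
      (((hc.multiD α).component j).mul_right)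
  have hα' := mem_multiIndices.1 hα
  -- both sides as integrals over frequencies
  have hL : ∫ x, ‖multiD α v x‖ ^ 2 = ∫ ξ : Eucl n, ∑ j, (2 * Real.pi) ^ (2 * ℓ) *
      ((∏ i, ξ i ^ α i) * ∏ i, ξ i ^ α i) * (starRingEnd ℂ (F j ξ) * F j ξ).re := by
    rw [integral_finsetSum _ fun j _ => (key α α hα' hα' j j).1]
    simp only [← (key α α hα' hα' _ _).2]
    rw [← integral_finsetSum _ fun j _ => hint α α j j]
    refine integral_congr_ae (ae_of_all _ fun x => ?_)
    simp only [EuclideanSpace.norm_sq_eq, Real.norm_eq_abs, sq_abs]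
    exact Finset.sum_congr rfl fun j _ => sq _
  have hR : ∫ x, coeffForm ℓ a v v x = ∫ ξ : Eucl n, ∑ j, ∑ k, ∑ α ∈ multiIndices n ℓ,
      ∑ β ∈ multiIndices n ℓ, a α β j k * ((2 * Real.pi) ^ (2 * ℓ) *
      ((∏ i, ξ i ^ α i) * ∏ i, ξ i ^ β i) * (starRingEnd ℂ (F j ξ) * F k ξ).re) := by
    unfold coeffForm
    rw [integral_finsetSum _ fun j _ => integrable_finsetSum _ fun k _ => integrable_finsetSum _
      fun α _ => integrable_finsetSum _ fun β _ => (hint α β j k).const_mul _]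
    rw [integral_finsetSum _ fun j _ => integrable_finsetSum _ fun k _ => integrable_finsetSum _
      fun α h1 => integrable_finsetSum _ fun β h2 => (key α β (mem_multiIndices.1 h1)
        (mem_multiIndices.1 h2) j k).1.const_mul _]
    refine Finset.sum_congr rfl fun j _ => ?_
    rw [integral_finsetSum _ fun k _ => integrable_finsetSum _
      fun α _ => integrable_finsetSum _ fun β _ => (hint α β j k).const_mul _]
    rw [integral_finsetSum _ fun k _ => integrable_finsetSum _
      fun α h1 => integrable_finsetSum _ fun β h2 => (key α β (mem_multiIndices.1 h1)
        (mem_multiIndices.1 h2) j k).1.const_mul _]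
    refine Finset.sum_congr rfl fun k _ => ?_
    rw [integral_finsetSum _
      fun α _ => integrable_finsetSum _ fun β _ => (hint α β j k).const_mul _]
    rw [integral_finsetSum _
      fun α h1 => integrable_finsetSum _ fun β h2 => (key α β (mem_multiIndices.1 h1)
        (mem_multiIndices.1 h2) j k).1.const_mul _]
    refine Finset.sum_congr rfl fun α h1 => ?_
    rw [integral_finsetSum _ fun β _ => (hint α β j k).const_mul _]
    rw [integral_finsetSum _ fun β h2 => (key α β (mem_multiIndices.1 h1)
        (mem_multiIndices.1 h2) j k).1.const_mul _]
    refine Finset.sum_congr rfl fun β h2 => ?_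
    rw [integral_const_mul, integral_const_mul, (key α β (mem_multiIndices.1 h1)
        (mem_multiIndices.1 h2) j k).2]
  rw [hL, hR, ← integral_const_mul]
  refine integral_mono ((integrable_finsetSum _ fun j _ => (key α α hα' hα' j j).1).const_mul _)
    (integrable_finsetSum _ fun j _ => integrable_finsetSum _ fun k _ => integrable_finsetSum _
      fun α h1 => integrable_finsetSum _ fun β h2 => (key α β (mem_multiIndices.1 h1)
        (mem_multiIndices.1 h2) j k).1.const_mul _) fun ξ => ?_
  -- the pointwise inequality at the frequency `ξ`
  set p : Eucl m := WithLp.toLp 2 fun j => (F j ξ).re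
  set q : Eucl m := WithLp.toLp 2 fun j => (F j ξ).im
  have hre : ∀ j k, (starRingEnd ℂ (F j ξ) * F k ξ).re = p j * p k + q j * q k := by
    intro j k; simp [p, q]
  have h1 : ∑ j, ∑ k, ∑ α ∈ multiIndices n ℓ,
      ∑ β ∈ multiIndices n ℓ, a α β j k * ((2 * Real.pi) ^ (2 * ℓ) *
      ((∏ i, ξ i ^ α i) * ∏ i, ξ i ^ β i) * (starRingEnd ℂ (F j ξ) * F k ξ).re) =
      (2 * Real.pi) ^ (2 * ℓ) * (∑ j, ∑ k, symbol ℓ a j k ξ * p j * p k +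
        ∑ j, ∑ k, symbol ℓ a j k ξ * q j * q k) := by
    rw [← Finset.sum_add_distrib, Finset.mul_sum]
    refine Finset.sum_congr rfl fun j _ => ?_
    rw [← Finset.sum_add_distrib, Finset.mul_sum]
    refine Finset.sum_congr rfl fun k _ => ?_
    simp only [hre, symbol, Finset.sum_mul, Finset.mul_sum, ← Finset.sum_add_distrib]
    refine Finset.sum_congr rfl fun α _ => Finset.sum_congr rfl fun β _ => ?_
    ring
  have h2 : ∑ j, (2 * Real.pi) ^ (2 * ℓ) * ((∏ i, ξ i ^ α i) * ∏ i, ξ i ^ α i) *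
      (starRingEnd ℂ (F j ξ) * F j ξ).re = (2 * Real.pi) ^ (2 * ℓ) *
        ((∏ i, ξ i ^ α i) * ∏ i, ξ i ^ α i) * (‖p‖ ^ 2 + ‖q‖ ^ 2) := by
    rw [EuclideanSpace.norm_sq_eq, EuclideanSpace.norm_sq_eq, ← Finset.sum_add_distrib,
      Finset.mul_sum]
    refine Finset.sum_congr rfl fun j _ => ?_
    rw [hre, Real.norm_eq_abs, Real.norm_eq_abs, sq_abs, sq_abs]; ring
  simp only
  rw [h1, h2]
  have h3 := prod_pow_sq_le α hα' ξ
  have h4 : (0 : ℝ) < (2 * Real.pi) ^ (2 * ℓ) := by positivity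
  calc μ * ((2 * Real.pi) ^ (2 * ℓ) * ((∏ i, ξ i ^ α i) * ∏ i, ξ i ^ α i) * (‖p‖ ^ 2 + ‖q‖ ^ 2))
      ≤ μ * ((2 * Real.pi) ^ (2 * ℓ) * ‖ξ‖ ^ (2 * ℓ) * (‖p‖ ^ 2 + ‖q‖ ^ 2)) := by gcongr
    _ = (2 * Real.pi) ^ (2 * ℓ) * (μ * ‖ξ‖ ^ (2 * ℓ) * ‖p‖ ^ 2 + μ * ‖ξ‖ ^ (2 * ℓ) * ‖q‖ ^ 2) := by
        ring
    _ ≤ _ := mul_le_mul_of_nonneg_left (add_le_add (ha.lower ξ p) (ha.lower ξ q)) h4.le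

end Garding

/-! ### Integration by parts and interpolation -/

section Parts

variable {n m : ℕ}

theorem integral_partialD_eq_zero {f : Eucl n → ℝ} (hf : ContDiff ℝ 1 f) (hc : HasCompactSupport f)
    (i : Fin n) : ∫ x, partialD i f x = 0 := by
  have hcont : Continuous (partialD i f) := (hf.continuous_fderiv (by simp)).clm_apply continuous_const
  have hint : Integrable (partialD i f) :=
    hcont.integrable_of_hasCompactSupport (hc.fderiv_apply ℝ _)
  have h := integral_mul_fderiv_eq_neg_fderiv_mul_of_integrable (μ := volume) (𝕜 := ℝ)
    (f := fun _ : Eucl n => (1 : ℝ)) (g := f) (v := EuclideanSpace.single i 1)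
    (by simp) (by simp only [one_mul]; exact hint) (by simpa using hf.continuous.integrable_of_hasCompactSupport hc)
    (by fun_prop) fun x _ => hf.differentiable (by simp) x
  simpa [partialD] using h

theorem contDiff_of_tsupport_subset {F : Type*} [NormedAddCommGroup F] [NormedSpace ℝ F]
    {U : Set (Eucl n)} (hU : IsOpen U) {N : ℕ∞ω} {f : Eucl n → F} (hf : ContDiffOn ℝ N f U)
    (hs : tsupport f ⊆ U) : ContDiff ℝ N f := by
  rw [contDiff_iff_contDiffAt]
  intro x
  by_cases hx : x ∈ U
  · exact hf.contDiffAt (hU.mem_nhds hx)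
  · exact (contDiffAt_const (c := (0 : F))).congr_of_eventuallyEq
      (notMem_tsupport_iff_eventuallyEq.1 fun h => hx (hs h))

theorem contDiff_mul_of_tsupport_subset {U : Set (Eucl n)} (hU : IsOpen U) {N : ℕ} {w G : Eucl n → ℝ}
    (hw : ContDiff ℝ ∞ w) (hwU : tsupport w ⊆ U) (hG : ContDiffOn ℝ (N : ℕ∞ω) G U) :
    ContDiff ℝ (N : ℕ∞ω) fun x => w x * G x := by
  exact contDiff_of_tsupport_subset hU
    ((hw.of_le (by exact_mod_cast le_top)).contDiffOn.mul hG) (tsupport_mul_subset_left.trans hwU)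

theorem partialD_mul {f g : Eucl n → ℝ} {x : Eucl n} (i : Fin n) (hf : DifferentiableAt ℝ f x)
    (hg : DifferentiableAt ℝ g x) :
    partialD i (fun y => f y * g y) x = f x * partialD i g x + g x * partialD i f x := by
  simp only [partialD]
  rw [fderiv_fun_mul hf hg]
  simp

/-- Integration by parts, where only the compactly supported factor is defined on the whole space. -/
theorem integral_partialD_mul {U : Set (Eucl n)} (hU : IsOpen U) {w G : Eucl n → ℝ}
    (hw : ContDiff ℝ ∞ w) (hc : HasCompactSupport w) (hwU : tsupport w ⊆ U)
    (hG : ContDiffOn ℝ ((1 : ℕ) : ℕ∞ω) G U) (i : Fin n) :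
    ∫ x, partialD i w x * G x = - ∫ x, w x * partialD i G x := by
  have hw' : ContDiff ℝ ∞ (partialD i w) := by
    have := ContDiff.multiD hw (Pi.single i 1)
    have h2 := partialD_multiD isOpen_univ (N := 1) (f := w)
      (hw.of_le (by exact_mod_cast le_top)).contDiffOn 0 i (by simp)
    rw [multiD_zero, zero_add] at h2
    rwa [show partialD i w = _root_.multiD (Pi.single i 1) w from funext fun x => h2 (mem_univ x)]
  have h1 := contDiff_mul_of_tsupport_subset hU hw hwU hG
  have h2 : Continuous fun x => partialD i w x * G x :=
    (contDiff_mul_of_tsupport_subset hU hw' ((tsupport_partialD_subset i w).trans hwU) (N := 0)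
      (hG.of_le (by simp))).continuous
  have h3 : Continuous fun x => w x * partialD i G x :=
    (contDiff_mul_of_tsupport_subset hU hw hwU (hG.partialD hU i (k := 0))).continuous
  have hpt : ∀ x, partialD i (fun y => w y * G y) x = partialD i w x * G x + w x * partialD i G x := by
    intro x
    by_cases hx : x ∈ U
    · rw [partialD_mul i (hw.differentiable (by simp) x)
        ((hG.contDiffAt (hU.mem_nhds hx)).differentiableAt (by simp))]
      ring
    · have hx' : x ∉ tsupport w := fun h => hx (hwU h)
      rw [image_eq_zero_of_notMem_tsupport hx',
        image_eq_zero_of_notMem_tsupport fun h => hx' (tsupport_partialD_subset i w h),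
        image_eq_zero_of_notMem_tsupport fun h => hx' (tsupport_mul_subset_left
          (tsupport_partialD_subset i (fun y => w y * G y) h))]
      ring
  have h4 := integral_partialD_eq_zero (h1.of_le (by simp)) hc.mul_right i
  simp only [hpt] at h4
  rw [integral_add (h2.integrable_of_hasCompactSupport (HasCompactSupport.mul_right
    (hc.of_isClosed_subset (isClosed_tsupport _) (tsupport_partialD_subset i w))))
    (h3.integrable_of_hasCompactSupport hc.mul_right)] at h4
  linarith

theorem ContDiff.listD {F : Type*} [NormedAddCommGroup F] [NormedSpace ℝ F] {v : Eucl n → F}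
    (hv : ContDiff ℝ ∞ v) (I : List (Fin n)) : ContDiff ℝ ∞ (listD I v) := by
  rw [contDiff_infty]
  intro k
  exact contDiffOn_univ.1 (ContDiffOn.listD isOpen_univ (N := k + I.length)
    (hv.of_le (by exact_mod_cast le_top)).contDiffOn I (k := k) le_rfl)

theorem tsupport_listD_subset {F : Type*} [NormedAddCommGroup F] [NormedSpace ℝ F]
    (I : List (Fin n)) (v : Eucl n → F) : tsupport (listD I v) ⊆ tsupport v := by
  induction I with
  | nil => exact subset_rfl
  | cons i I ih => exact (tsupport_partialD_subset i _).trans ih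

theorem integral_listD_mul {U : Set (Eucl n)} (hU : IsOpen U) {w : Eucl n → ℝ}
    (hw : ContDiff ℝ ∞ w) (hc : HasCompactSupport w) (hwU : tsupport w ⊆ U) (I : List (Fin n)) :
    ∀ {G : Eucl n → ℝ}, ContDiffOn ℝ (I.length : ℕ∞ω) G U →
    ∫ x, listD I w x * G x = (-1) ^ I.length * ∫ x, w x * listD I.reverse G x := by
  induction I with
  | nil => intro G _; simp
  | cons i I ih =>
    intro G hG
    have h1 := integral_partialD_mul hU (hw.listD I)
      (hc.of_isClosed_subset (isClosed_tsupport _) (tsupport_listD_subset I w))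
      ((tsupport_listD_subset I w).trans hwU) (hG.of_le (by simp)) i
    rw [listD_cons, h1, ih (hG.partialD hU i), List.reverse_cons, listD_append, List.length_cons]
    simp only [listD_cons, listD_nil]
    ring

theorem integral_multiD_mul {U : Set (Eucl n)} (hU : IsOpen U) {w : Eucl n → ℝ}
    (hw : ContDiff ℝ ∞ w) (hc : HasCompactSupport w) (hwU : tsupport w ⊆ U) (α : Fin n → ℕ) {ℓ : ℕ}
    (hα : ∑ i, α i = ℓ) {G : Eucl n → ℝ} (hG : ContDiffOn ℝ (ℓ : ℕ∞ω) G U) :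
    ∫ x, multiD α w x * G x = (-1) ^ ℓ * ∫ x, w x * multiD α G x := by
  have hl : (coordList α).length = ℓ := by rw [length_coordList, hα]
  have h := integral_listD_mul hU hw hc hwU (coordList α) (by rw [hl]; exact hG)
  rw [← multiD_eq_listD, hl] at h
  rw [h]
  congr 2
  funext x
  by_cases hx : x ∈ U
  · rw [multiD_eq_listD, listD_perm hU hG (List.reverse_perm _) (by simp [hl]) hx]
  · rw [image_eq_zero_of_notMem_tsupport fun h => hx (hwU h), zero_mul, zero_mul]

/-- The weak form of the system: the bilinear form of a solution with any test function vanishes. -/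
theorem IsSolution.integral_coeffForm_eq_zero {ℓ : ℕ} {a : Coeffs n m} {U : Set (Eucl n)}
    (hU : IsOpen U) {u : Eucl n → Eucl m} (hu : IsSolution ℓ a U u) {w : Eucl n → Eucl m}
    (hw : ContDiff ℝ ∞ w) (hc : HasCompactSupport w) (hwU : tsupport w ⊆ U) :
    ∫ x, coeffForm ℓ a w u x = 0 := by
  have huk : ∀ k, ContDiffOn ℝ ((2 * ℓ : ℕ) : ℕ∞ω) (fun y => u y k) U := fun k =>
    (EuclideanSpace.proj (𝕜 := ℝ) k : Eucl m →L[ℝ] ℝ).contDiff.comp_contDiffOn hu.contDiffOn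
  have hts : ∀ j, tsupport (fun x => w x j) ⊆ U := fun j =>
    (closure_mono fun x hx => by
      rw [Function.mem_support] at hx ⊢
      intro h; exact hx (by rw [h]; rfl)).trans hwU
  -- replace derivatives of the components of `w` and `u` by components of derivatives
  have hcomp : ∀ x, coeffForm ℓ a w u x = ∑ j, ∑ k, ∑ α ∈ multiIndices n ℓ,
      ∑ β ∈ multiIndices n ℓ, a α β j k *
        (multiD α (fun y => w y j) x * multiD β (fun y => u y k) x) := by
    intro x
    unfold coeffForm
    refine Finset.sum_congr rfl fun j _ => Finset.sum_congr rfl fun k _ =>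
      Finset.sum_congr rfl fun α _ => Finset.sum_congr rfl fun β hβ => ?_
    rw [hw.multiD_component]
    by_cases hx : x ∈ U
    · rw [multiD_component hU hu.contDiffOn β (by rw [mem_multiIndices.1 hβ]; omega) k hx]
    · have hx' : x ∉ tsupport (multiD α w) := fun h => hx (hwU (tsupport_multiD_subset α w h))
      rw [image_eq_zero_of_notMem_tsupport hx']; simp
  have hG : ∀ β ∈ multiIndices n ℓ, ∀ k,
      ContDiffOn ℝ (ℓ : ℕ∞ω) (multiD β fun y => u y k) U := fun β hβ k =>
    (huk k).multiD hU β (by rw [mem_multiIndices.1 hβ]; omega)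
  have hint1 : ∀ α, ∀ β ∈ multiIndices n ℓ, ∀ j k, Integrable fun x =>
      multiD α (fun y => w y j) x * multiD β (fun y => u y k) x := fun α β hβ j k =>
    (contDiff_mul_of_tsupport_subset hU ((hw.component j).multiD α)
      ((tsupport_multiD_subset _ _).trans (hts j)) (hG β hβ k)).continuous.integrable_of_hasCompactSupport
      ((hc.component j).multiD α).mul_right
  have hint2 : ∀ α ∈ multiIndices n ℓ, ∀ β ∈ multiIndices n ℓ, ∀ j k, Integrable fun x =>
      w x j * multiD α (multiD β (fun y => u y k)) x := fun α hα β hβ j k =>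
    (contDiff_mul_of_tsupport_subset hU (hw.component j) (hts j) (N := 0)
      ((hG β hβ k).multiD hU α (by rw [mem_multiIndices.1 hα]; omega))).continuous.integrable_of_hasCompactSupport
      (hc.component j).mul_right
  simp only [hcomp]
  rw [integral_finsetSum _ fun j _ => integrable_finsetSum _ fun k _ => integrable_finsetSum _
      fun α _ => integrable_finsetSum _ fun β hβ => (hint1 α β hβ j k).const_mul _]
  refine Finset.sum_eq_zero fun j _ => ?_
  have h2 : ∫ x, w x j * systemOp ℓ a u j x = 0 := by
    rw [← integral_zero (Eucl n) ℝ]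
    congr 1
    funext x
    by_cases hx : x ∈ U
    · rw [hu.eq_zero x hx j, mul_zero]
    · rw [image_eq_zero_of_notMem_tsupport fun h => hx (hts j h), zero_mul]
  have h3 : ∫ x, w x j * systemOp ℓ a u j x = ∑ k, ∑ α ∈ multiIndices n ℓ, ∑ β ∈ multiIndices n ℓ,
      a α β j k * ∫ x, w x j * multiD α (multiD β (fun y => u y k)) x := by
    have h4 : ∀ x, w x j * systemOp ℓ a u j x = ∑ k, ∑ α ∈ multiIndices n ℓ,
        ∑ β ∈ multiIndices n ℓ, a α β j k * (w x j * multiD α (multiD β (fun y => u y k)) x) := by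
      intro x
      simp only [systemOp, Finset.mul_sum]
      refine Finset.sum_congr rfl fun k _ => Finset.sum_congr rfl fun α _ =>
        Finset.sum_congr rfl fun β _ => by ring
    simp only [h4]
    rw [integral_finsetSum _ fun k _ => integrable_finsetSum _
      fun α hα => integrable_finsetSum _ fun β hβ => (hint2 α hα β hβ j k).const_mul _]
    refine Finset.sum_congr rfl fun k _ => ?_
    rw [integral_finsetSum _
      fun α hα => integrable_finsetSum _ fun β hβ => (hint2 α hα β hβ j k).const_mul _]
    refine Finset.sum_congr rfl fun α hα => ?_
    rw [integral_finsetSum _ fun β hβ => (hint2 α hα β hβ j k).const_mul _]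
    exact Finset.sum_congr rfl fun β hβ => integral_const_mul _ _
  rw [integral_finsetSum _ fun k _ => integrable_finsetSum _
      fun α _ => integrable_finsetSum _ fun β hβ => (hint1 α β hβ j k).const_mul _]
  have h5 : ∀ k, ∫ x, ∑ α ∈ multiIndices n ℓ, ∑ β ∈ multiIndices n ℓ, a α β j k *
        (multiD α (fun y => w y j) x * multiD β (fun y => u y k) x) =
      (-1) ^ ℓ * ∑ α ∈ multiIndices n ℓ, ∑ β ∈ multiIndices n ℓ,
      a α β j k * ∫ x, w x j * multiD α (multiD β (fun y => u y k)) x := by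
    intro k
    rw [integral_finsetSum _
      fun α _ => integrable_finsetSum _ fun β hβ => (hint1 α β hβ j k).const_mul _, Finset.mul_sum]
    refine Finset.sum_congr rfl fun α hα => ?_
    rw [integral_finsetSum _ fun β hβ => (hint1 α β hβ j k).const_mul _, Finset.mul_sum]
    refine Finset.sum_congr rfl fun β hβ => ?_
    rw [integral_const_mul, integral_multiD_mul hU (hw.component j) (hc.component j) (hts j) α
      (mem_multiIndices.1 hα) (hG β hβ k)]
    ring
  simp only [h5]
  rw [← Finset.mul_sum, ← h3, h2, mul_zero]

theorem exists_add_single {k : ℕ} {α : Fin n → ℕ} (hα : ∑ i, α i = k + 1) :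
    ∃ (γ : Fin n → ℕ) (i : Fin n), ∑ j, γ j = k ∧ α = γ + Pi.single i 1 := by
  obtain ⟨i, hi⟩ : ∃ i, α i ≠ 0 := by
    by_contra h
    push Not at h
    simp [h] at hα
  refine ⟨α - Pi.single i 1, i, ?_, ?_⟩
  · have h1 : α - (Pi.single i 1 : Fin n → ℕ) + Pi.single i 1 = α := by
      funext j
      by_cases hj : j = i
      · subst hj; simp; omega
      · simp [hj]
    have h2 : ∑ j, (α - (Pi.single i 1 : Fin n → ℕ) + (Pi.single i 1 : Fin n → ℕ)) j = k + 1 := by rw [h1, hα]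
    simp only [Pi.add_apply, Finset.sum_add_distrib, Finset.sum_pi_single', Finset.mem_univ,
      if_true] at h2
    omega
  · funext j
    by_cases hj : j = i
    · subst hj; simp; omega
    · simp [hj]

/-- Interpolation with weights: the `L²` norm of a derivative of order `k + 1` is controlled by
those of orders `k` and `k + 2`, with matching powers of the cutoff function, by integrating
`∂ᵢ (Φ ^ (2k + 4) ⟪g, ∂ᵢ g⟫)`. -/
theorem exists_interpolation {Φ : Eucl n → ℝ} (hΦ : ContDiff ℝ ∞ Φ) (hc : HasCompactSupport Φ)
    (h0 : ∀ x, 0 ≤ Φ x) (k : ℕ) {ε : ℝ} (hε : 0 < ε) :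
    ∃ C : ℝ, 0 ≤ C ∧ ∀ v : Eucl n → Eucl m, ContDiff ℝ ∞ v →
      ∫ x, (Φ x ^ (k + 2) * derivSum (k + 1) v x) ^ 2 ≤
        ε * (∫ x, (Φ x ^ (k + 3) * derivSum (k + 2) v x) ^ 2) +
          C * ∫ x, (Φ x ^ (k + 1) * derivSum k v x) ^ 2 := by
  obtain ⟨B, hB⟩ : ∃ B : ℝ, ∀ x, ‖fderiv ℝ Φ x‖ ≤ B :=
    (hc.fderiv ℝ).exists_bound_of_continuous (hΦ.continuous_fderiv (by simp))
  have hBi : ∀ i x, |partialD i Φ x| ≤ B := fun i x => by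
    refine ((fderiv ℝ Φ x).le_opNorm _).trans ?_
    simpa using hB x
  set Nn : ℝ := ((multiIndices n (k + 1)).card : ℝ) with hN
  have hB0 : 0 ≤ B := (norm_nonneg _).trans (hB 0)
  -- the constant `η` is what remains of `ε` after summing over all multi-indices
  set η : ℝ := ε / (2 * Nn ^ 2 + 1) with hη
  have hη0 : 0 < η := by positivity
  set D : ℝ := 1 / (4 * η) + 2 * (k + 2) ^ 2 * B ^ 2 with hD
  have hD0 : 0 ≤ D := by positivity
  refine ⟨2 * Nn ^ 2 * D, by positivity, fun v hv => ?_⟩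
  have hcontD : ∀ j, Continuous (derivSum j v) := fun j =>
    continuous_finsetSum _ fun β _ => (hv.multiD β).continuous.norm
  have hcontT : ∀ p j : ℕ, Continuous fun x => (Φ x ^ (p + 1) * derivSum j v x) ^ 2 := fun p j =>
    ((hΦ.continuous.pow _).mul (hcontD j)).pow 2
  have hintT : ∀ p j : ℕ, Integrable fun x => (Φ x ^ (p + 1) * derivSum j v x) ^ 2 := fun p j =>
    (hcontT p j).integrable_of_hasCompactSupport (by
      refine hc.mono fun x hx => ?_
      rw [Function.mem_support] at hx ⊢
      intro h
      exact hx (by rw [h]; simp))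
  have hsingle : ∀ α ∈ multiIndices n (k + 1), ∫ x, (Φ x ^ (k + 2) * ‖multiD α v x‖) ^ 2 ≤
      2 * (η * (∫ x, (Φ x ^ (k + 3) * derivSum (k + 2) v x) ^ 2) +
          D * ∫ x, (Φ x ^ (k + 1) * derivSum k v x) ^ 2) := by
    intro α hα
    obtain ⟨γ, i, hγ, rfl⟩ := exists_add_single (mem_multiIndices.1 hα)
    have hvN : ∀ N : ℕ, ContDiffOn ℝ (N : ℕ∞ω) v univ := fun N =>
      (hv.of_le (by exact_mod_cast le_top)).contDiffOn
    have hg : ∀ x, partialD i (multiD γ v) x = multiD (γ + Pi.single i 1) v x := fun x =>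
      partialD_multiD isOpen_univ (hvN (k + 1)) γ i (by omega) (mem_univ x)
    have hh : ∀ x, partialD i (multiD (γ + Pi.single i 1) v) x =
        multiD (γ + Pi.single i 1 + Pi.single i 1) v x := fun x =>
      partialD_multiD isOpen_univ (hvN (k + 2)) _ i
        (by rw [mem_multiIndices.1 hα]) (mem_univ x)
    have hα2 : ∑ j, (γ + (Pi.single i 1 : Fin n → ℕ) + (Pi.single i 1 : Fin n → ℕ)) j = k + 2 := by
      have := mem_multiIndices.1 hα
      simp only [Pi.add_apply, Finset.sum_add_distrib, Finset.sum_pi_single', Finset.mem_univ,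
        if_true] at this ⊢
      omega
    set g := multiD γ v
    set h := multiD (γ + Pi.single i 1) v
    have hgs : ContDiff ℝ ∞ g := hv.multiD _
    have hhs : ContDiff ℝ ∞ h := hv.multiD _
    set ψ : Eucl n → ℝ := fun x => Φ x ^ (2 * k + 4) * ⟪g x, h x⟫
    have hψs : ContDiff ℝ ∞ ψ := (hΦ.pow _).mul (hgs.inner ℝ hhs)
    have hψc : HasCompactSupport ψ := by
      refine hc.mono fun x hx => ?_
      rw [Function.mem_support] at hx ⊢
      intro h
      exact hx (by simp only [ψ]; rw [h]; simp)
    have hψd : ∀ x, partialD i ψ x = Φ x ^ (2 * k + 4) * (‖h x‖ ^ 2 +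
        ⟪g x, multiD (γ + Pi.single i 1 + Pi.single i 1) v x⟫) +
        (2 * k + 4) * Φ x ^ (2 * k + 3) * partialD i Φ x * ⟪g x, h x⟫ := by
      intro x
      have hgd := hgs.differentiable (by simp) x
      have hhd := hhs.differentiable (by simp) x
      have hΦd := hΦ.differentiable (by simp) x
      have h3 := partialD_mul (f := fun y => Φ y ^ (2 * k + 4)) (g := fun y => ⟪g y, h y⟫) i
        (hΦd.pow _) (hgd.inner ℝ hhd)
      have h1 : partialD i (fun y => ⟪g y, h y⟫) x = ⟪g x, partialD i h x⟫ + ⟪partialD i g x, h x⟫ := by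
        simp only [partialD]
        exact fderiv_inner_apply ℝ hgd hhd _
      have h2 : partialD i (fun y => Φ y ^ (2 * k + 4)) x =
          (2 * k + 4) * Φ x ^ (2 * k + 3) * partialD i Φ x := by
        simp only [partialD]
        rw [fderiv_fun_pow _ hΦd]
        simp
      rw [h1, h2, hg, hh, real_inner_self_eq_norm_sq] at h3
      rw [h3]
      ring
    have hψ0 := integral_partialD_eq_zero (hψs.of_le (by simp)) hψc i
    have hintψ : Integrable (partialD i ψ) :=
      ((hψs.continuous_fderiv (by simp)).clm_apply continuous_const).integrable_of_hasCompactSupport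
        (hψc.fderiv_apply ℝ _)
    have hpt : ∀ x, (Φ x ^ (k + 2) * ‖h x‖) ^ 2 ≤ 2 * (partialD i ψ x +
        (η * (Φ x ^ (k + 3) * derivSum (k + 2) v x) ^ 2 +
          D * (Φ x ^ (k + 1) * derivSum k v x) ^ 2)) := by
      intro x
      rw [hψd]
      set s := Φ x
      set X := s ^ (k + 1) * ‖g x‖
      set Y := s ^ (k + 2) * ‖h x‖
      set q := multiD (γ + Pi.single i 1 + Pi.single i 1) v x
      set Z := s ^ (k + 3) * ‖q‖
      have hs : 0 ≤ s := h0 x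
      have hX : X ≤ s ^ (k + 1) * derivSum k v x :=
        mul_le_mul_of_nonneg_left (norm_multiD_le_derivSum hγ v x) (by positivity)
      have hZ : Z ≤ s ^ (k + 3) * derivSum (k + 2) v x :=
        mul_le_mul_of_nonneg_left (norm_multiD_le_derivSum hα2 v x) (by positivity)
      have hX0 : 0 ≤ X := by positivity
      have hY0 : 0 ≤ Y := by positivity
      have hZ0 : 0 ≤ Z := by positivity
      have e1 : -(X * Z) ≤ s ^ (2 * k + 4) * ⟪g x, q⟫ := by
        have := mul_le_mul_of_nonneg_left (neg_le_of_abs_le (abs_real_inner_le_norm (g x) q))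
          (show 0 ≤ s ^ (2 * k + 4) by positivity)
        calc -(X * Z) = s ^ (2 * k + 4) * -(‖g x‖ * ‖q‖) := by simp only [X, Z]; ring
          _ ≤ _ := this
      have e2 : -((2 * k + 4) * B * (X * Y)) ≤
          (2 * k + 4) * s ^ (2 * k + 3) * partialD i Φ x * ⟪g x, h x⟫ := by
        have h1 : |partialD i Φ x * ⟪g x, h x⟫| ≤ B * (‖g x‖ * ‖h x‖) := by
          rw [abs_mul]
          exact mul_le_mul (hBi i x) (abs_real_inner_le_norm _ _) (abs_nonneg _) hB0
        have := mul_le_mul_of_nonneg_left (neg_le_of_abs_le h1)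
          (show 0 ≤ (2 * (k : ℝ) + 4) * s ^ (2 * k + 3) by positivity)
        calc -((2 * k + 4) * B * (X * Y))
            = (2 * k + 4) * s ^ (2 * k + 3) * -(B * (‖g x‖ * ‖h x‖)) := by simp only [X, Y]; ring
          _ ≤ _ := by rw [mul_assoc _ (partialD i Φ x)]; exact this
      have e3 : X * Z ≤ η * Z ^ 2 + 1 / (4 * η) * X ^ 2 := by
        have : 0 ≤ η * (Z - 1 / (2 * η) * X) ^ 2 := by positivity
        have h2 : η * (Z - 1 / (2 * η) * X) ^ 2 = η * Z ^ 2 + 1 / (4 * η) * X ^ 2 - X * Z := by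
          field_simp; ring
        linarith
      have e4 : (2 * k + 4) * B * (X * Y) ≤ 1 / 2 * Y ^ 2 + 2 * (k + 2) ^ 2 * B ^ 2 * X ^ 2 := by
        nlinarith [sq_nonneg (Y - 2 * (k + 2) * B * X)]
      have e5 : X ^ 2 ≤ (s ^ (k + 1) * derivSum k v x) ^ 2 := pow_le_pow_left₀ hX0 hX 2
      have e6 : Z ^ 2 ≤ (s ^ (k + 3) * derivSum (k + 2) v x) ^ 2 := pow_le_pow_left₀ hZ0 hZ 2
      have e7 := mul_le_mul_of_nonneg_left e5 hD0
      have e8 := mul_le_mul_of_nonneg_left e6 hη0.le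
      have e9 : s ^ (2 * k + 4) * ‖h x‖ ^ 2 = Y ^ 2 := by simp only [Y]; ring
      have e10 : D * X ^ 2 = 1 / (4 * η) * X ^ 2 + 2 * (k + 2) ^ 2 * B ^ 2 * X ^ 2 := by
        rw [hD]; ring
      linarith [mul_add (s ^ (2 * k + 4)) (‖h x‖ ^ 2) ⟪g x, q⟫]
    have hintR : Integrable fun x => η * (Φ x ^ (k + 3) * derivSum (k + 2) v x) ^ 2 +
        D * (Φ x ^ (k + 1) * derivSum k v x) ^ 2 :=
      ((hintT (k + 2) (k + 2)).const_mul _).add ((hintT k k).const_mul _)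
    calc ∫ x, (Φ x ^ (k + 2) * ‖h x‖) ^ 2
        ≤ ∫ x, 2 * (partialD i ψ x + (η * (Φ x ^ (k + 3) * derivSum (k + 2) v x) ^ 2 +
          D * (Φ x ^ (k + 1) * derivSum k v x) ^ 2)) :=
          integral_mono_of_nonneg (ae_of_all _ fun x => by positivity)
            ((hintψ.add hintR).const_mul 2) (ae_of_all _ hpt)
      _ = _ := by
          rw [integral_const_mul, integral_add hintψ hintR, hψ0, zero_add,
            integral_add ((hintT (k + 2) (k + 2)).const_mul _) ((hintT k k).const_mul _),
            integral_const_mul, integral_const_mul]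
  have hintS : ∀ α, Integrable fun x => (Φ x ^ (k + 2) * ‖multiD α v x‖) ^ 2 := fun α =>
    Continuous.integrable_of_hasCompactSupport
      (((hΦ.continuous.pow _).mul (hv.multiD α).continuous.norm).pow 2) (by
        refine hc.mono fun x hx => ?_
        rw [Function.mem_support] at hx ⊢
        intro h
        exact hx (by simp [h]))
  have hsq : ∀ x, (Φ x ^ (k + 2) * derivSum (k + 1) v x) ^ 2 ≤
      Nn * ∑ α ∈ multiIndices n (k + 1), (Φ x ^ (k + 2) * ‖multiD α v x‖) ^ 2 := by
    intro x
    rw [derivSum, Finset.mul_sum]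
    exact sq_sum_le_card_mul_sum_sq
  set I2 := ∫ x, (Φ x ^ (k + 3) * derivSum (k + 2) v x) ^ 2
  set I0 := ∫ x, (Φ x ^ (k + 1) * derivSum k v x) ^ 2
  have hI2 : 0 ≤ I2 := integral_nonneg fun x => by positivity
  calc ∫ x, (Φ x ^ (k + 2) * derivSum (k + 1) v x) ^ 2
      ≤ ∫ x, Nn * ∑ α ∈ multiIndices n (k + 1), (Φ x ^ (k + 2) * ‖multiD α v x‖) ^ 2 :=
        integral_mono (hintT (k + 1) (k + 1)) ((integrable_finsetSum _ fun α _ => hintS α).const_mul _)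
          hsq
    _ = Nn * ∑ α ∈ multiIndices n (k + 1), ∫ x, (Φ x ^ (k + 2) * ‖multiD α v x‖) ^ 2 := by
        rw [integral_const_mul, integral_finsetSum _ fun α _ => hintS α]
    _ ≤ Nn * ∑ _α ∈ multiIndices n (k + 1), 2 * (η * I2 + D * I0) := by
        gcongr with α hα
        exact hsingle α hα
    _ = 2 * Nn ^ 2 * η * I2 + 2 * Nn ^ 2 * D * I0 := by
        rw [Finset.sum_const, nsmul_eq_mul, ← hN]; ring
    _ ≤ ε * I2 + 2 * Nn ^ 2 * D * I0 := by
        have : 2 * Nn ^ 2 * η ≤ ε := by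
          rw [hη, mul_div_assoc', div_le_iff₀ (by positivity)]
          nlinarith [sq_nonneg Nn]
        gcongr

end Parts

/-! ### The weighted energy estimate -/

section Caccioppoli

variable {n m : ℕ}

/-- An interpolation inequality between consecutive terms of a finite sequence, together with a
bound of the last term by the others, bounds all terms by the first one. -/
theorem exists_absorption (ℓ : ℕ) (C : ℕ → ℝ → ℝ) (hC : ∀ k ε, 0 ≤ C k ε) {K : ℝ} (hK : 0 ≤ K) :
    ∃ K' : ℝ, 0 ≤ K' ∧ ∀ (S : ℕ → ℝ) (E : ℝ), (∀ j, 0 ≤ S j) → 0 ≤ E →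
      (∀ k, k + 2 ≤ ℓ → ∀ ε, 0 < ε → S (k + 1) ≤ ε * S (k + 2) + C k ε * S k) →
      S ℓ ≤ K * (∑ j ∈ Finset.range ℓ, S j + E) → ∀ j ≤ ℓ, S j ≤ K' * (S 0 + E) := by
  -- each term is controlled by a small multiple of the next one and by the first one
  have h1 : ∀ k, ∀ ε : ℝ, 0 < ε → ∃ D : ℝ, 0 ≤ D ∧ ∀ S : ℕ → ℝ, (∀ j, 0 ≤ S j) →
      (∀ k, k + 2 ≤ ℓ → ∀ ε, 0 < ε → S (k + 1) ≤ ε * S (k + 2) + C k ε * S k) →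
      k + 1 ≤ ℓ → S k ≤ ε * S (k + 1) + D * S 0 := by
    intro k
    induction k with
    | zero =>
      intro ε hε
      exact ⟨1, zero_le_one, fun S hS _ _ => by nlinarith [mul_nonneg hε.le (hS 1)]⟩
    | succ k ih =>
      intro ε hε
      have hc := hC k (ε / 2)
      obtain ⟨D, hD, h⟩ := ih (1 / (2 * (C k (ε / 2) + 1))) (by positivity)
      refine ⟨2 * (C k (ε / 2) * D), by positivity, fun S hS hS' hk => ?_⟩
      have e1 := hS' k hk (ε / 2) (by positivity)
      have e2 := h S hS hS' (by omega)
      have e3 : C k (ε / 2) * S k ≤ 1 / 2 * S (k + 1) + C k (ε / 2) * D * S 0 := by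
        have h3 : C k (ε / 2) * (1 / (2 * (C k (ε / 2) + 1))) ≤ 1 / 2 := by
          rw [mul_one_div, div_le_iff₀ (by positivity)]; linarith
        calc C k (ε / 2) * S k
            ≤ C k (ε / 2) * (1 / (2 * (C k (ε / 2) + 1)) * S (k + 1) + D * S 0) := by gcongr
          _ = C k (ε / 2) * (1 / (2 * (C k (ε / 2) + 1))) * S (k + 1) + C k (ε / 2) * D * S 0 := by
              ring
          _ ≤ _ := by
              have := mul_le_mul_of_nonneg_right h3 (hS (k + 1)); linarith
      linarith
  -- hence by a small multiple of the last term
  have h2 : ∀ i, ∀ ε : ℝ, 0 < ε → ∃ D : ℝ, 0 ≤ D ∧ ∀ S : ℕ → ℝ, (∀ j, 0 ≤ S j) →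
      (∀ k, k + 2 ≤ ℓ → ∀ ε, 0 < ε → S (k + 1) ≤ ε * S (k + 2) + C k ε * S k) →
      i + 1 ≤ ℓ → S (ℓ - (i + 1)) ≤ ε * S ℓ + D * S 0 := by
    intro i
    induction i with
    | zero =>
      intro ε hε
      obtain ⟨D, hD, h⟩ := h1 (ℓ - 1) ε hε
      refine ⟨D, hD, fun S hS hS' hi => ?_⟩
      have := h S hS hS' (by omega)
      rwa [show ℓ - 1 + 1 = ℓ by omega] at this
    | succ i ih =>
      intro ε hε
      obtain ⟨D, hD, h⟩ := ih ε hε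
      obtain ⟨D', hD', h'⟩ := h1 (ℓ - (i + 1 + 1)) 1 one_pos
      refine ⟨D + D', by positivity, fun S hS hS' hi => ?_⟩
      have e1 := h S hS hS' (by omega)
      have e2 := h' S hS hS' (by omega)
      rw [show ℓ - (i + 1 + 1) + 1 = ℓ - (i + 1) by omega] at e2
      linarith
  set ε : ℝ := 1 / (2 * (K * ℓ + 1)) with hε
  have hε0 : 0 < ε := by positivity
  choose D hD0 hD using fun i => h2 i ε hε0
  set D' := ∑ i ∈ Finset.range ℓ, D i with hD'
  have hD'0 : 0 ≤ D' := Finset.sum_nonneg fun i _ => hD0 i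
  set B : ℝ := 2 * (K * ℓ * D' + K) with hB
  have hB0 : 0 ≤ B := by positivity
  refine ⟨ε * B + D' + B, by positivity, fun S E hS hE hS' hlast => ?_⟩
  have hlow : ∀ j < ℓ, S j ≤ ε * S ℓ + D' * S 0 := by
    intro j hj
    have e1 := hD (ℓ - (j + 1)) S hS hS' (by omega)
    rw [show ℓ - (ℓ - (j + 1) + 1) = j by omega] at e1
    have e2 : D (ℓ - (j + 1)) ≤ D' := Finset.single_le_sum (f := D) (fun i _ => hD0 i)
      (Finset.mem_range.2 (by omega))
    have := mul_le_mul_of_nonneg_right e2 (hS 0)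
    linarith
  have hsum : ∑ j ∈ Finset.range ℓ, S j ≤ ℓ * (ε * S ℓ + D' * S 0) := by
    have := Finset.sum_le_card_nsmul (Finset.range ℓ) S _ fun j hj => hlow j (Finset.mem_range.1 hj)
    rwa [Finset.card_range, nsmul_eq_mul] at this
  have hKε : K * ℓ * ε ≤ 1 / 2 := by
    rw [hε, mul_one_div, div_le_iff₀ (by positivity)]; linarith
  have htop : S ℓ ≤ B * (S 0 + E) := by
    have e1 := mul_le_mul_of_nonneg_left hsum hK
    have e2 := mul_le_mul_of_nonneg_right hKε (hS ℓ)
    have e3 : 0 ≤ K * ℓ * D' * E := by positivity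
    have e4 : 0 ≤ K * S 0 := mul_nonneg hK (hS 0)
    rw [hB]
    nlinarith
  intro j hj
  have e3 : 0 ≤ S 0 + E := add_nonneg (hS 0) hE
  rcases hj.lt_or_eq with hj | rfl
  · have e1 := hlow j hj
    have e2 := mul_le_mul_of_nonneg_left htop hε0.le
    have e4 : 0 ≤ D' * E := by positivity
    have e5 : 0 ≤ B * (S 0 + E) := by positivity
    nlinarith
  · have e5 : 0 ≤ (ε * B + D') * (S 0 + E) := by positivity
    nlinarith

theorem mul_mul_le_young {δ : ℝ} (hδ : 0 < δ) (c x y : ℝ) :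
    c * x * y ≤ δ * x ^ 2 + c ^ 2 / (4 * δ) * y ^ 2 := by
  have h1 : 0 ≤ δ * (x - c / (2 * δ) * y) ^ 2 := by positivity
  have h2 : δ * (x - c / (2 * δ) * y) ^ 2 = δ * x ^ 2 + c ^ 2 / (4 * δ) * y ^ 2 - c * x * y := by
    field_simp; ring
  linarith

theorem abs_coeffForm_sub_le {ℓ : ℕ} {a : Coeffs n m} {M : ℝ}
    (ha : ∀ α ∈ multiIndices n ℓ, ∀ β ∈ multiIndices n ℓ, ∀ j k, |a α β j k| ≤ M)
    {v w v' w' : Eucl n → Eucl m} {x : Eucl n} {B : ℝ}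
    (h : ∀ α ∈ multiIndices n ℓ, ∀ β ∈ multiIndices n ℓ, ∀ j k,
      |multiD α v x j * multiD β w x k - multiD α v' x j * multiD β w' x k| ≤ B) :
    |coeffForm ℓ a v w x - coeffForm ℓ a v' w' x| ≤
      m * (m * ((multiIndices n ℓ).card * ((multiIndices n ℓ).card * (M * B)))) := by
  unfold coeffForm
  simp only [← Finset.sum_sub_distrib, ← mul_sub]
  have hb : ∀ {ι : Type} (s : Finset ι) (f : ι → ℝ) (c : ℝ), (∀ i ∈ s, |f i| ≤ c) →
      |∑ i ∈ s, f i| ≤ s.card * c := fun s f c hf =>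
    (Finset.abs_sum_le_sum_abs _ _).trans (by simpa using Finset.sum_le_card_nsmul s _ c hf)
  have e : ∀ c : ℝ, (m : ℝ) * c = ((Finset.univ : Finset (Fin m)).card : ℝ) * c := by simp
  rw [e, e]
  refine hb _ _ _ fun j _ => hb _ _ _ fun k _ => hb _ _ _ fun α hα => hb _ _ _ fun β hβ => ?_
  rw [abs_mul]
  exact mul_le_mul (ha α hα β hβ j k) (h α hα β hβ j k) (abs_nonneg _)
    ((abs_nonneg _).trans (ha α hα β hβ j k))

theorem continuous_coeffForm {ℓ : ℕ} {a : Coeffs n m} {v w : Eucl n → Eucl m}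
    (hv : ContDiff ℝ ∞ v) (hw : ContDiff ℝ ∞ w) : Continuous (coeffForm ℓ a v w) :=
  continuous_finsetSum _ fun j _ => continuous_finsetSum _ fun k _ =>
    continuous_finsetSum _ fun α _ => continuous_finsetSum _ fun β _ =>
      continuous_const.mul (((hv.multiD α).component j).continuous.mul
        ((hw.multiD β).component k).continuous)

theorem tsupport_coeffForm_subset (ℓ : ℕ) (a : Coeffs n m) (v w : Eucl n → Eucl m) :
    tsupport (coeffForm ℓ a v w) ⊆ tsupport v := by
  refine closure_minimal (fun x hx => ?_) (isClosed_tsupport v)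
  by_contra hx'
  refine hx (Finset.sum_eq_zero fun j _ => Finset.sum_eq_zero fun k _ => Finset.sum_eq_zero
    fun α _ => Finset.sum_eq_zero fun β _ => ?_)
  rw [image_eq_zero_of_notMem_tsupport fun h => hx' (tsupport_multiD_subset α v h)]
  simp

theorem IsSolution.integrable_coeffForm {ℓ : ℕ} {a : Coeffs n m} {U : Set (Eucl n)}
    (hU : IsOpen U) {u : Eucl n → Eucl m} (hu : IsSolution ℓ a U u) {w : Eucl n → Eucl m}
    (hw : ContDiff ℝ ∞ w) (hc : HasCompactSupport w) (hwU : tsupport w ⊆ U) :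
    Integrable (coeffForm ℓ a w u) := by
  have h1 : ContDiffOn ℝ 0 (coeffForm ℓ a w u) U := by
    rw [contDiffOn_zero]
    refine continuousOn_finsetSum _ fun j _ => continuousOn_finsetSum _ fun k _ =>
      continuousOn_finsetSum _ fun α _ => continuousOn_finsetSum _ fun β hβ =>
        continuousOn_const.mul (((hw.multiD α).component j).continuous.continuousOn.mul ?_)
    have := hu.contDiffOn.multiD hU β (k := 0) (by rw [mem_multiIndices.1 hβ]; omega)
    exact (EuclideanSpace.proj (𝕜 := ℝ) k : Eucl m →L[ℝ] ℝ).continuous.comp_continuousOn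
      this.continuousOn
  have h2 := tsupport_coeffForm_subset ℓ a w u
  exact (contDiff_of_tsupport_subset hU h1 (h2.trans hwU)).continuous.integrable_of_hasCompactSupport
    (hc.of_isClosed_subset (isClosed_tsupport _) h2)

set_option maxHeartbeats 800000 in
/-- The top-order weighted energy of an approximation `v` of a solution `u` is controlled by
lower-order ones and by the error of the approximation: insert `Φ ^ (ℓ + 1) • v` in Gårding's
inequality and commute the cutoff to test the system with `Φ ^ (2ℓ + 2) • v`. -/
theorem exists_energy_bound {Φ : Eucl n → ℝ} (hΦ : ContDiff ℝ ∞ Φ) (hc : HasCompactSupport Φ)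
    (h0 : ∀ x, 0 ≤ Φ x) (h1 : ∀ x, Φ x ≤ 1) (ℓ : ℕ) {μ M : ℝ} (hμ : 0 < μ) (hM : 0 ≤ M) :
    ∃ K : ℝ, 0 ≤ K ∧ ∀ a : Coeffs n m, IsSymmElliptic ℓ μ a →
      (∀ α ∈ multiIndices n ℓ, ∀ β ∈ multiIndices n ℓ, ∀ j k, |a α β j k| ≤ M) →
      ∀ U : Set (Eucl n), IsOpen U → ∀ u : Eucl n → Eucl m, IsSolution ℓ a U u →
      ∀ v : Eucl n → Eucl m, ContDiff ℝ ∞ v → HasCompactSupport v → tsupport v ⊆ U →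
      IntegrableOn (fun x => (∑ α ∈ multiIndices n ℓ, ‖multiD α v x - multiD α u x‖) ^ 2)
        (U ∩ Function.support Φ) →
      ∫ x, (Φ x ^ (ℓ + 1) * derivSum ℓ v x) ^ 2 ≤
        K * (∑ j ∈ Finset.range ℓ, (∫ x, (Φ x ^ (j + 1) * derivSum j v x) ^ 2) +
          ∫ x in U ∩ Function.support Φ,
            (∑ α ∈ multiIndices n ℓ, ‖multiD α v x - multiD α u x‖) ^ 2) := by
  obtain ⟨C₁, hC₁0, hC₁⟩ := exists_norm_multiD_pow_smul_sub_le (F := Eucl m) hΦ hc h0 h1 (ℓ + 1) ℓ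
  obtain ⟨C₂, hC₂0, hC₂⟩ :=
    exists_norm_multiD_pow_smul_sub_le (F := Eucl m) hΦ hc h0 h1 (2 * ℓ + 2) ℓ
  set Nn : ℝ := ((multiIndices n ℓ).card : ℝ) with hN
  have hN0 : 0 ≤ Nn := Nat.cast_nonneg _
  set L : ℝ := m * (m * (Nn * (Nn * M))) with hL
  have hL0 : 0 ≤ L := by positivity
  set C₃ : ℝ := L * (2 * C₁ + C₂) with hC₃
  have hC₃0 : 0 ≤ C₃ := by positivity
  set C₄ : ℝ := L * (Nn * (1 + C₂)) with hC₄
  have hC₄0 : 0 ≤ C₄ := by positivity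
  set A : ℝ := 2 * Nn ^ 2 / μ with hA
  have hA0 : 0 ≤ A := by positivity
  set δ : ℝ := 1 / (4 * (A + 1)) with hδ
  have hδ0 : 0 < δ := by positivity
  -- coefficients of the lower-order terms and of the error
  set B₁ : ℝ := A * (C₃ ^ 2 / (4 * δ) + L * C₁ ^ 2 + 1) + 2 * Nn ^ 2 * C₁ ^ 2 with hB₁
  set B₂ : ℝ := A * (C₄ ^ 2 / (2 * δ) + C₄ ^ 2) with hB₂
  have hB₁0 : 0 ≤ B₁ := by positivity
  have hB₂0 : 0 ≤ B₂ := by positivity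
  clear_value B₁ B₂ δ A C₄ C₃ L Nn
  refine ⟨2 * (B₁ * ℓ + B₂), mul_nonneg zero_le_two (add_nonneg (mul_nonneg hB₁0
    (Nat.cast_nonneg _)) hB₂0), fun a ha haM U hU u hu v hv hvc hvU hint => ?_⟩
  set e : Eucl n → ℝ := fun x => ∑ α ∈ multiIndices n ℓ, ‖multiD α v x - multiD α u x‖ with he
  set W := U ∩ Function.support Φ with hW
  have hWm : MeasurableSet W := (hU.inter (hΦ.continuous.isOpen_support)).measurableSet
  set T : ℕ → Eucl n → ℝ := fun j x => Φ x ^ (j + 1) * derivSum j v x with hT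
  have hT0 : ∀ j x, 0 ≤ T j x := fun j x => mul_nonneg (pow_nonneg (h0 x) _) (derivSum_nonneg _ _ _)
  set P : Eucl n → ℝ := fun x => ∑ j ∈ Finset.range ℓ, T j x with hP
  have hP0 : ∀ x, 0 ≤ P x := fun x => Finset.sum_nonneg fun j _ => hT0 j x
  have hTcont : ∀ j, Continuous (T j) := fun j => (hΦ.continuous.pow _).mul
    (continuous_finsetSum _ fun β _ => (hv.multiD β).continuous.norm)
  have hPcont : Continuous P := continuous_finsetSum _ fun j _ => hTcont j
  have hcs : ∀ f : Eucl n → ℝ, (∀ x, Φ x = 0 → f x = 0) → HasCompactSupport f := fun f hf =>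
    hc.mono fun x hx h => hx (hf x h)
  have hTint : ∀ j, Integrable fun x => T j x ^ 2 := fun j =>
    ((hTcont j).pow 2).integrable_of_hasCompactSupport (hcs _ fun x hx => by simp [hT, hx])
  have hPint : Integrable fun x => P x ^ 2 :=
    (hPcont.pow 2).integrable_of_hasCompactSupport (hcs _ fun x hx => by simp [hP, hT, hx])
  set z : Eucl n → Eucl m := fun x => Φ x ^ (ℓ + 1) • v x with hz
  set w : Eucl n → Eucl m := fun x => Φ x ^ (2 * ℓ + 2) • v x with hw
  have hzs : ContDiff ℝ ∞ z := (hΦ.pow _).smul hv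
  have hws : ContDiff ℝ ∞ w := (hΦ.pow _).smul hv
  have hzc : HasCompactSupport z := hvc.mono fun x hx h => hx (by simp only [hz, h, smul_zero])
  have hwc : HasCompactSupport w := hvc.mono fun x hx h => hx (by simp only [hw, h, smul_zero])
  have hwU : tsupport w ⊆ U :=
    (tsupport_smul_subset_right (fun x => Φ x ^ (2 * ℓ + 2)) v).trans hvU
  -- the commutators
  have hz1 : ∀ α ∈ multiIndices n ℓ, ∀ x,
      ‖multiD α z x - Φ x ^ (ℓ + 1) • multiD α v x‖ ≤ C₁ * P x := by
    intro α hα x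
    refine (hC₁ v hv α (mem_multiIndices.1 hα) x).trans (le_of_eq ?_)
    congr 1
    refine Finset.sum_congr rfl fun j hj => ?_
    have := Finset.mem_range.1 hj
    rw [show ℓ + 1 - (ℓ - j) = j + 1 by omega]
  have hw1 : ∀ α ∈ multiIndices n ℓ, ∀ x,
      ‖multiD α w x - Φ x ^ (2 * ℓ + 2) • multiD α v x‖ ≤ C₂ * (Φ x ^ (ℓ + 1) * P x) := by
    intro α hα x
    refine (hC₂ v hv α (mem_multiIndices.1 hα) x).trans (le_of_eq ?_)
    congr 1
    rw [hP, Finset.mul_sum]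
    refine Finset.sum_congr rfl fun j hj => ?_
    have := Finset.mem_range.1 hj
    rw [show 2 * ℓ + 2 - (ℓ - j) = ℓ + 1 + (j + 1) by omega, pow_add, hT, mul_assoc]
  have hvT : ∀ α ∈ multiIndices n ℓ, ∀ x, Φ x ^ (ℓ + 1) * ‖multiD α v x‖ ≤ T ℓ x := fun α hα x =>
    mul_le_mul_of_nonneg_left (norm_multiD_le_derivSum (mem_multiIndices.1 hα) v x)
      (pow_nonneg (h0 x) _)
  have happ : ∀ (y : Eucl m) (j : Fin m), |y j| ≤ ‖y‖ := fun y j => PiLp.norm_apply_le y j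
  -- the form of `z` and the form of `w` and `v` differ by commutators
  have hform1 : ∀ x, coeffForm ℓ a z z x ≤
      coeffForm ℓ a w v x + (δ * T ℓ x ^ 2 + (C₃ ^ 2 / (4 * δ) + L * C₁ ^ 2) * P x ^ 2) := by
    intro x
    have hb := abs_coeffForm_sub_le haM (v := z) (w := z) (v' := w) (w' := v) (x := x)
      (B := (2 * C₁ + C₂) * (T ℓ x * P x) + C₁ ^ 2 * P x ^ 2) (by
      intro α hα β hβ j k
      set s := Φ x ^ (ℓ + 1)
      have hs : 0 ≤ s := pow_nonneg (h0 x) _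
      have hs2 : Φ x ^ (2 * ℓ + 2) = s * s := by simp only [s]; ring
      set X := multiD α v x j
      set Y := multiD β v x k
      have hX : |s * X| ≤ T ℓ x := by
        rw [abs_mul, abs_of_nonneg hs]
        exact (mul_le_mul_of_nonneg_left (happ _ _) hs).trans (hvT α hα x)
      have hY : |s * Y| ≤ T ℓ x := by
        rw [abs_mul, abs_of_nonneg hs]
        exact (mul_le_mul_of_nonneg_left (happ _ _) hs).trans (hvT β hβ x)
      set ε₁ := multiD α z x j - s * X
      set ε₂ := multiD β z x k - s * Y
      set ε₃ := multiD α w x j - s * s * X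
      have hε₁ : |ε₁| ≤ C₁ * P x := by
        have := (happ _ j).trans (hz1 α hα x); simpa using this
      have hε₂ : |ε₂| ≤ C₁ * P x := by
        have := (happ _ k).trans (hz1 β hβ x); simpa using this
      have hε₃ : |ε₃| ≤ C₂ * (s * P x) := by
        have := (happ _ j).trans (hw1 α hα x); rw [hs2] at this; simpa using this
      have e3 : |ε₃ * Y| ≤ C₂ * (T ℓ x * P x) := by
        calc |ε₃ * Y| = |ε₃| * |Y| := abs_mul _ _
          _ ≤ C₂ * (s * P x) * |Y| := mul_le_mul_of_nonneg_right hε₃ (abs_nonneg _)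
          _ = C₂ * (|s * Y| * P x) := by rw [abs_mul, abs_of_nonneg hs]; ring
          _ ≤ C₂ * (T ℓ x * P x) := by gcongr; exact hP0 x
      have e1 : |s * X * ε₂| ≤ T ℓ x * (C₁ * P x) := by
        rw [abs_mul]; exact mul_le_mul hX hε₂ (abs_nonneg _) (hT0 _ x)
      have e2 : |s * Y * ε₁| ≤ T ℓ x * (C₁ * P x) := by
        rw [abs_mul]; exact mul_le_mul hY hε₁ (abs_nonneg _) (hT0 _ x)
      have e4 : |ε₁ * ε₂| ≤ C₁ * P x * (C₁ * P x) := by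
        rw [abs_mul]; exact mul_le_mul hε₁ hε₂ (abs_nonneg _) (mul_nonneg hC₁0 (hP0 x))
      have e5 : multiD α z x j * multiD β z x k - multiD α w x j * Y =
          s * X * ε₂ + s * Y * ε₁ + ε₁ * ε₂ - ε₃ * Y := by
        simp only [ε₁, ε₂, ε₃]; ring
      have e6 : (2 * C₁ + C₂) * (T ℓ x * P x) + C₁ ^ 2 * P x ^ 2 =
          T ℓ x * (C₁ * P x) + T ℓ x * (C₁ * P x) + C₁ * P x * (C₁ * P x) +
            C₂ * (T ℓ x * P x) := by ring
      rw [e5, e6]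
      exact (abs_sub _ _).trans (add_le_add ((abs_add_le _ _).trans
        (add_le_add ((abs_add_le _ _).trans (add_le_add e1 e2)) e4)) e3))
    rw [← hN] at hb
    have h2 := (abs_le.1 hb).2
    have h3 : C₃ * T ℓ x * P x ≤ δ * T ℓ x ^ 2 + C₃ ^ 2 / (4 * δ) * P x ^ 2 :=
      (mul_mul_le_young hδ0 C₃ (T ℓ x) (P x))
    have h5 : m * (m * (Nn * (Nn * (M * ((2 * C₁ + C₂) * (T ℓ x * P x) + C₁ ^ 2 * P x ^ 2))))) =
        C₃ * T ℓ x * P x + L * C₁ ^ 2 * P x ^ 2 := by rw [hC₃, hL]; ring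
    have h6 := h2.trans h5.le
    linarith
  -- the form of `w` and `v` is almost that of `w` and the solution
  have hform2 : ∀ x, coeffForm ℓ a w v x - coeffForm ℓ a w u x ≤
      δ * T ℓ x ^ 2 + P x ^ 2 + W.indicator (fun x => (C₄ ^ 2 / (2 * δ) + C₄ ^ 2) * e x ^ 2) x := by
    intro x
    have he0 : 0 ≤ e x := Finset.sum_nonneg fun _ _ => norm_nonneg _
    have hwb : derivSum ℓ w x ≤ Nn * ((1 + C₂) * (T ℓ x + P x)) := by
      have := Finset.sum_le_card_nsmul (multiIndices n ℓ) (fun α => ‖multiD α w x‖)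
        ((1 + C₂) * (T ℓ x + P x)) (fun α hα => by
        have e1 := hw1 α hα x
        have e2 : ‖Φ x ^ (2 * ℓ + 2) • multiD α v x‖ ≤ T ℓ x := by
          rw [norm_smul, Real.norm_of_nonneg (pow_nonneg (h0 x) _)]
          refine le_trans ?_ (hvT α hα x)
          exact mul_le_mul_of_nonneg_right (pow_le_pow_of_le_one (h0 x) (h1 x) (by omega))
            (norm_nonneg _)
        have e3 : Φ x ^ (ℓ + 1) * P x ≤ P x :=
          mul_le_of_le_one_left (hP0 x) (pow_le_one₀ (h0 x) (h1 x))
        have e4 : ‖multiD α w x‖ ≤ ‖multiD α w x - Φ x ^ (2 * ℓ + 2) • multiD α v x‖ +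
            ‖Φ x ^ (2 * ℓ + 2) • multiD α v x‖ := norm_le_norm_sub_add _ _
        have e5 := mul_le_mul_of_nonneg_left e3 hC₂0
        have e6 := mul_nonneg hC₂0 (hT0 ℓ x)
        have e7 : (1 + C₂) * (T ℓ x + P x) = T ℓ x + P x + (C₂ * T ℓ x + C₂ * P x) := by ring
        rw [e7]
        linarith [hP0 x])
      simpa [derivSum, hN] using this
    have hb := abs_coeffForm_sub_le haM (v := w) (w := v) (v' := w) (w' := u) (x := x)
      (B := derivSum ℓ w x * e x) (by
      intro α hα β hβ j k
      rw [← mul_sub, abs_mul]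
      refine mul_le_mul ((happ _ j).trans (norm_multiD_le_derivSum (mem_multiIndices.1 hα) w x)) ?_
        (abs_nonneg _) (derivSum_nonneg _ _ _)
      refine (happ (multiD β v x - multiD β u x) k).trans ?_
      exact Finset.single_le_sum (f := fun α => ‖multiD α v x - multiD α u x‖)
        (fun _ _ => norm_nonneg _) hβ)
    rw [← hN] at hb
    have h2 := (abs_le.1 hb).2
    have h3 : m * (m * (Nn * (Nn * (M * (derivSum ℓ w x * e x))))) ≤
        C₄ * ((T ℓ x + P x) * e x) := by
      calc m * (m * (Nn * (Nn * (M * (derivSum ℓ w x * e x))))) = L * (derivSum ℓ w x * e x) := by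
            rw [hL]; ring
        _ ≤ L * (Nn * ((1 + C₂) * (T ℓ x + P x)) * e x) := by gcongr
        _ = _ := by rw [hC₄]; ring
    by_cases hx : x ∈ W
    · rw [Set.indicator_of_mem hx]
      have e1 : C₄ * T ℓ x * e x ≤ δ * T ℓ x ^ 2 + C₄ ^ 2 / (2 * δ) * e x ^ 2 := by
        have h4 := mul_mul_le_young (half_pos hδ0) C₄ (T ℓ x) (e x)
        have h5 : C₄ ^ 2 / (4 * (δ / 2)) = C₄ ^ 2 / (2 * δ) := by congr 1; ring
        have : 0 ≤ δ / 2 * T ℓ x ^ 2 := mul_nonneg (half_pos hδ0).le (sq_nonneg _)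
        rw [h5] at h4
        linarith
      have e2 : C₄ * P x * e x ≤ P x ^ 2 + C₄ ^ 2 * e x ^ 2 := by
        have h4 := mul_mul_le_young one_pos C₄ (P x) (e x)
        have : 0 ≤ C₄ ^ 2 * e x ^ 2 := mul_nonneg (sq_nonneg _) (sq_nonneg _)
        linarith
      have e3 : C₄ * ((T ℓ x + P x) * e x) = C₄ * T ℓ x * e x + C₄ * P x * e x := by ring
      have e4 : (C₄ ^ 2 / (2 * δ) + C₄ ^ 2) * e x ^ 2 =
        C₄ ^ 2 / (2 * δ) * e x ^ 2 + C₄ ^ 2 * e x ^ 2 := by ring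
      rw [e4]
      linarith [h2.trans h3]
    · have hzero : ∀ j, T j x = 0 := by
        intro j
        by_cases hxU : x ∈ U
        · have : Φ x = 0 := by
            by_contra h; exact hx ⟨hxU, h⟩
          simp [hT, this]
        · have : derivSum j v x = 0 := Finset.sum_eq_zero fun α _ => by
            rw [image_eq_zero_of_notMem_tsupport fun h =>
              hxU (hvU (tsupport_multiD_subset α v h)), norm_zero]
          simp [hT, this]
      have hPz : P x = 0 := Finset.sum_eq_zero fun j _ => hzero j
      rw [Set.indicator_of_notMem hx, hzero, hPz]
      rw [hzero, hPz] at h3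
      simp only [add_zero, zero_mul, mul_zero] at h3 ⊢
      linarith
  have hTz : ∀ x, T ℓ x ^ 2 ≤ 2 * Nn * (∑ α ∈ multiIndices n ℓ, ‖multiD α z x‖ ^ 2) +
      2 * Nn ^ 2 * C₁ ^ 2 * P x ^ 2 := by
    intro x
    have e1 : T ℓ x ^ 2 ≤ Nn * ∑ α ∈ multiIndices n ℓ, (Φ x ^ (ℓ + 1) * ‖multiD α v x‖) ^ 2 := by
      have := sq_sum_le_card_mul_sum_sq (s := multiIndices n ℓ)
        (f := fun α => Φ x ^ (ℓ + 1) * ‖multiD α v x‖)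
      rw [← Finset.mul_sum, ← hN] at this
      exact this
    have e2 : ∀ α ∈ multiIndices n ℓ, (Φ x ^ (ℓ + 1) * ‖multiD α v x‖) ^ 2 ≤
        2 * ‖multiD α z x‖ ^ 2 + 2 * C₁ ^ 2 * P x ^ 2 := by
      intro α hα
      have e3 : Φ x ^ (ℓ + 1) * ‖multiD α v x‖ ≤ ‖multiD α z x‖ + C₁ * P x := by
        have e4 : ‖Φ x ^ (ℓ + 1) • multiD α v x‖ ≤ ‖multiD α z x‖ +
          ‖multiD α z x - Φ x ^ (ℓ + 1) • multiD α v x‖ := by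
          rw [norm_sub_rev]; exact norm_le_norm_add_norm_sub' _ _
        rw [norm_smul, Real.norm_of_nonneg (pow_nonneg (h0 x) _)] at e4
        linarith [hz1 α hα x]
      have e5 : 0 ≤ Φ x ^ (ℓ + 1) * ‖multiD α v x‖ :=
        mul_nonneg (pow_nonneg (h0 x) _) (norm_nonneg _)
      calc (Φ x ^ (ℓ + 1) * ‖multiD α v x‖) ^ 2 ≤ (‖multiD α z x‖ + C₁ * P x) ^ 2 :=
            pow_le_pow_left₀ e5 e3 2
        _ ≤ _ := add_sq_le.trans (le_of_eq (by ring))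
    calc T ℓ x ^ 2 ≤ Nn * ∑ α ∈ multiIndices n ℓ, (2 * ‖multiD α z x‖ ^ 2 + 2 * C₁ ^ 2 * P x ^ 2) :=
          e1.trans (mul_le_mul_of_nonneg_left (Finset.sum_le_sum e2) hN0)
      _ = _ := by
          rw [Finset.sum_add_distrib, ← Finset.mul_sum, Finset.sum_const, nsmul_eq_mul, ← hN]; ring
  have hzint : ∀ α, Integrable fun x => ‖multiD α z x‖ ^ 2 := fun α =>
    ((hzs.multiD α).continuous.norm.pow 2).integrable_of_hasCompactSupport
      ((hzc.multiD α).mono fun x hx h => hx (by simp [h]))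
  have hformint : ∀ {f g : Eucl n → Eucl m}, ContDiff ℝ ∞ f → ContDiff ℝ ∞ g →
      HasCompactSupport f → Integrable (coeffForm ℓ a f g) := fun hf hg hfc =>
    (continuous_coeffForm hf hg).integrable_of_hasCompactSupport
      (hfc.of_isClosed_subset (isClosed_tsupport _) (tsupport_coeffForm_subset ℓ a _ _))
  have hind : Integrable (W.indicator fun x => (C₄ ^ 2 / (2 * δ) + C₄ ^ 2) * e x ^ 2) :=
    (integrable_indicator_iff hWm).2 (hint.const_mul _)
  set IT := ∫ x, T ℓ x ^ 2 with hIT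
  set IP := ∫ x, P x ^ 2 with hIP
  set Ie := ∫ x in W, e x ^ 2 with hIe
  set Iz := ∫ x, coeffForm ℓ a z z x with hIz
  set Iw := ∫ x, coeffForm ℓ a w v x with hIw
  have hI1 : Iz ≤ Iw + (δ * IT + (C₃ ^ 2 / (4 * δ) + L * C₁ ^ 2) * IP) := by
    have := integral_mono (hformint hzs hzs hzc) ((hformint hws hv hwc).add
      (((hTint ℓ).const_mul δ).add (hPint.const_mul _))) hform1
    rwa [integral_add' (hformint hws hv hwc) (((hTint ℓ).const_mul δ).add (hPint.const_mul _)),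
      integral_add' ((hTint ℓ).const_mul δ) (hPint.const_mul _), integral_const_mul,
      integral_const_mul] at this
  have hI2 : Iw ≤ δ * IT + IP + (C₄ ^ 2 / (2 * δ) + C₄ ^ 2) * Ie := by
    have huint := hu.integrable_coeffForm hU hws hwc hwU
    have h2 := integral_mono ((hformint hws hv hwc).sub huint)
      ((((hTint ℓ).const_mul δ).add hPint).add hind) hform2
    rw [integral_sub' (hformint hws hv hwc) huint,
      hu.integral_coeffForm_eq_zero hU hws hwc hwU, sub_zero,
      integral_add' (((hTint ℓ).const_mul δ).add hPint) hind,
      integral_add' ((hTint ℓ).const_mul δ) hPint, integral_const_mul, integral_indicator hWm,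
      integral_const_mul] at h2
    exact h2
  have hI3 : IT ≤ A * Iz + 2 * Nn ^ 2 * C₁ ^ 2 * IP := by
    have h2 := integral_mono (hTint ℓ) (((integrable_finsetSum (multiIndices n ℓ)
      fun α _ => hzint α).const_mul (2 * Nn)).add (hPint.const_mul (2 * Nn ^ 2 * C₁ ^ 2))) hTz
    rw [integral_add' ((integrable_finsetSum (multiIndices n ℓ)
      fun α _ => hzint α).const_mul (2 * Nn)) (hPint.const_mul (2 * Nn ^ 2 * C₁ ^ 2)),
      integral_const_mul, integral_const_mul, integral_finsetSum _ fun α _ => hzint α] at h2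
    have h3 : ∑ α ∈ multiIndices n ℓ, ∫ x, ‖multiD α z x‖ ^ 2 ≤ Nn * (Iz / μ) := by
      have := Finset.sum_le_card_nsmul (multiIndices n ℓ) (fun α => ∫ x, ‖multiD α z x‖ ^ 2)
        (Iz / μ) fun α hα => by
          rw [le_div_iff₀ hμ, mul_comm]
          exact ha.garding hμ hzs hzc hα
      simpa [hN] using this
    have h4 : A * Iz = 2 * Nn * (Nn * (Iz / μ)) := by rw [hA]; field_simp
    rw [h4]
    have := mul_le_mul_of_nonneg_left h3 (show 0 ≤ 2 * Nn by positivity)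
    linarith
  have hIT0 : 0 ≤ IT := integral_nonneg fun x => sq_nonneg _
  have hIe0 : 0 ≤ Ie := integral_nonneg fun x => sq_nonneg _
  have hAδ : A * (2 * δ) ≤ 1 / 2 := by
    rw [hδ, mul_one_div, mul_div_assoc', div_le_iff₀ (by positivity)]; linarith
  have hI4 : IT ≤ 2 * (B₁ * IP + B₂ * Ie) := by
    have e1 := mul_le_mul_of_nonneg_left (hI1.trans (add_le_add_left hI2 _)) hA0
    have e2 := mul_le_mul_of_nonneg_right hAδ hIT0
    rw [hB₁, hB₂]
    linarith
  have hIP' : IP ≤ ℓ * ∑ j ∈ Finset.range ℓ, ∫ x, T j x ^ 2 := by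
    rw [← integral_finsetSum _ fun j _ => hTint j, ← integral_const_mul]
    refine integral_mono hPint ((integrable_finsetSum _ fun j _ => hTint j).const_mul _) fun x => ?_
    have := sq_sum_le_card_mul_sum_sq (s := Finset.range ℓ) (f := fun j => T j x)
    simpa using this
  set S := ∑ j ∈ Finset.range ℓ, ∫ x, T j x ^ 2
  have hS0 : 0 ≤ S := Finset.sum_nonneg fun j _ => integral_nonneg fun x => sq_nonneg _
  have e1 := mul_le_mul_of_nonneg_left hIP' hB₁0
  have e2 : 0 ≤ B₂ * S := mul_nonneg hB₂0 hS0
  have e3 : 0 ≤ B₁ * ℓ * Ie := mul_nonneg (mul_nonneg hB₁0 (Nat.cast_nonneg _)) hIe0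
  linarith

end Caccioppoli

/-! ### The Caccioppoli inequality -/

section CaccioppoliLimit

variable {n m : ℕ}

/-- On `V`, the function `u` is a limit in the Sobolev norm of order `ℓ` of smooth functions with
compact support in `Ω`. For a smooth function on `Ω` this encodes that `u` and its derivatives of
order less than `ℓ` vanish on `V ∩ ∂Ω`. -/
def SobolevApprox (ℓ : ℕ) (Ω V : Set (Eucl n)) (u : Eucl n → Eucl m) : Prop :=
  ∀ δ : ℝ≥0∞, 0 < δ → ∃ v : Eucl n → Eucl m, ContDiff ℝ ∞ v ∧ HasCompactSupport v ∧
    tsupport v ⊆ Ω ∧ ∀ α : Fin n → ℕ, ∑ i, α i ≤ ℓ →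
      ∫⁻ x in V ∩ Ω, ‖multiD α v x - multiD α u x‖ₑ ^ 2 ≤ δ

theorem enorm_sq_eq_ofReal {F : Type*} [NormedAddCommGroup F] (y : F) :
    ‖y‖ₑ ^ 2 = ENNReal.ofReal (‖y‖ ^ 2) := by
  rw [ENNReal.ofReal_pow (norm_nonneg _), ofReal_norm]

theorem enorm_sq_le_two_mul {F : Type*} [NormedAddCommGroup F] (y z : F) :
    ‖y‖ₑ ^ 2 ≤ 2 * ‖z‖ₑ ^ 2 + 2 * ‖z - y‖ₑ ^ 2 := by
  simp only [enorm_sq_eq_ofReal]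
  rw [show (2 : ℝ≥0∞) = ENNReal.ofReal 2 by simp, ← ENNReal.ofReal_mul zero_le_two,
    ← ENNReal.ofReal_mul zero_le_two, ← ENNReal.ofReal_add (by positivity) (by positivity)]
  refine ENNReal.ofReal_le_ofReal ?_
  have h : ‖y‖ ≤ ‖z‖ + ‖z - y‖ := by
    have := norm_sub_le z (z - y); simpa using this
  nlinarith [sq_nonneg (‖z‖ - ‖z - y‖), norm_nonneg y]

theorem setLIntegral_enorm_sq_le {F : Type*} [NormedAddCommGroup F] {A : Set (Eucl n)}
    {f g : Eucl n → F} (hg : AEStronglyMeasurable g (volume.restrict A)) :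
    ∫⁻ x in A, ‖f x‖ₑ ^ 2 ≤
      2 * (∫⁻ x in A, ‖g x‖ₑ ^ 2) + 2 * ∫⁻ x in A, ‖g x - f x‖ₑ ^ 2 := by
  calc ∫⁻ x in A, ‖f x‖ₑ ^ 2 ≤ ∫⁻ x in A, (2 * ‖g x‖ₑ ^ 2 + 2 * ‖g x - f x‖ₑ ^ 2) :=
        lintegral_mono fun x => enorm_sq_le_two_mul _ _
    _ = _ := by
        rw [lintegral_add_left' ((hg.enorm.pow_const 2).const_mul 2),
          lintegral_const_mul' _ _ (by simp), lintegral_const_mul' _ _ (by simp)]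

theorem ofReal_integral_sq {μ : Measure (Eucl n)} {f : Eucl n → ℝ}
    (hf : Integrable (fun x => f x ^ 2) μ) :
    ENNReal.ofReal (∫ x, f x ^ 2 ∂μ) = ∫⁻ x, ‖f x‖ₑ ^ 2 ∂μ := by
  rw [ofReal_integral_eq_lintegral_ofReal hf (ae_of_all _ fun x => sq_nonneg _)]
  refine lintegral_congr fun x => ?_
  rw [enorm_sq_eq_ofReal, Real.norm_eq_abs, sq_abs]

theorem derivSum_zero (v : Eucl n → Eucl m) (x : Eucl n) : derivSum 0 v x = ‖v x‖ := by
  have : multiIndices n 0 = {0} := by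
    ext α
    rw [mem_multiIndices, Finset.mem_singleton, Finset.sum_eq_zero_iff]
    simp [funext_iff]
  rw [derivSum, this, Finset.sum_singleton, multiD_zero]

/-- The Caccioppoli inequality at unit scale. The estimates are carried out for a test function `v`
close to `u`: interpolation and the energy bound control all weighted energies of `v` by the one of
order zero and by the error of the approximation, which then tends to zero. -/
theorem exists_caccioppoli_unit (n m : ℕ) {ℓ : ℕ} {μ : ℝ} (hμ : 0 < μ) :
    ∃ K : ℝ≥0, ∀ a : Coeffs n m, IsSymmElliptic ℓ μ a → ∀ U : Set (Eucl n), IsOpen U →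
      ∀ u : Eucl n → Eucl m, IsSolution ℓ a U u → SobolevApprox ℓ U (Metric.ball 0 2) u →
      ∀ α : Fin n → ℕ, ∑ i, α i ≤ ℓ →
      ∫⁻ x in Metric.ball 0 1 ∩ U, ‖multiD α u x‖ₑ ^ 2 ≤
        K * ∫⁻ x in Metric.ball 0 2 ∩ U, ‖u x‖ₑ ^ 2 := by
  let Φ : ContDiffBump (0 : Eucl n) := ⟨1, 2, one_pos, one_lt_two⟩
  have hΦs : ContDiff ℝ ∞ Φ := Φ.contDiff
  have hΦc : HasCompactSupport Φ := Φ.hasCompactSupport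
  have hΦ0 : ∀ x, 0 ≤ Φ x := fun x => Φ.nonneg
  have hΦ1 : ∀ x, Φ x ≤ 1 := fun x => Φ.le_one
  have hsupp : Function.support Φ = Metric.ball 0 2 := Φ.support_eq
  have hone : ∀ x ∈ Metric.ball (0 : Eucl n) 1, Φ x = 1 := fun x hx =>
    Φ.one_of_mem_closedBall (Metric.ball_subset_closedBall hx)
  obtain ⟨M, hM0, hM⟩ := exists_averagedCoeffs_bound n m ℓ hμ
  obtain ⟨K, hK0, hK⟩ := exists_energy_bound (m := m) hΦs hΦc hΦ0 hΦ1 ℓ hμ hM0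
  have hint : ∀ k : ℕ, ∀ ε : ℝ, ∃ C : ℝ, 0 ≤ C ∧ (0 < ε → ∀ v : Eucl n → Eucl m, ContDiff ℝ ∞ v →
      ∫ x, (Φ x ^ (k + 2) * derivSum (k + 1) v x) ^ 2 ≤
        ε * (∫ x, (Φ x ^ (k + 3) * derivSum (k + 2) v x) ^ 2) +
          C * ∫ x, (Φ x ^ (k + 1) * derivSum k v x) ^ 2) := by
    intro k ε
    by_cases hε : 0 < ε
    · obtain ⟨C, hC, h⟩ := exists_interpolation (m := m) hΦs hΦc hΦ0 k hε
      exact ⟨C, hC, fun _ => h⟩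
    · exact ⟨0, le_rfl, fun h => absurd h hε⟩
  choose C hC0 hC using hint
  obtain ⟨K', hK'0, hK'⟩ := exists_absorption ℓ C hC0 hK0
  set Nn : ℕ := (multiIndices n ℓ).card with hN
  set κ : ℝ≥0 := K'.toNNReal with hκ
  have hκ' : ENNReal.ofReal K' = (κ : ℝ≥0∞) := rfl
  refine ⟨4 * κ, fun a ha U hU u hu happ α hα => ?_⟩
  -- `u` also solves the system with averaged coefficients, which are bounded in terms of `μ`
  set a' := averagedCoeffs ℓ a with ha'
  have hu' : IsSolution ℓ a' U u :=
    ⟨hu.contDiffOn, fun x hx j => by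
      rw [ha', systemOp_averagedCoeffs a hU hu.contDiffOn j hx, hu.eq_zero x hx j]⟩
  have hucont : ∀ β : Fin n → ℕ, ∑ i, β i ≤ ℓ → ContinuousOn (multiD β u) U := fun β hβ =>
    (hu.contDiffOn.multiD hU β (k := 0) (by omega)).continuousOn
  set B1 := Metric.ball (0 : Eucl n) 1
  set B2 := Metric.ball (0 : Eucl n) 2
  have hB : B1 ⊆ B2 := Metric.ball_subset_ball one_le_two
  refine ENNReal.le_of_forall_pos_le_add fun ε hε _ => ?_
  set c : ℝ≥0 := 4 * κ + 2 * κ * Nn ^ 2 + 2 with hc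
  have hc0 : c ≠ 0 := by positivity
  obtain ⟨v, hv, hvc, hvU, happr⟩ := happ (ε / c : ℝ≥0) (by
    rw [ENNReal.coe_pos]; exact div_pos hε (pos_iff_ne_zero.2 hc0))
  set δ : ℝ≥0∞ := ((ε / c : ℝ≥0) : ℝ≥0∞) with hδ
  -- the error of the approximation
  set e : Eucl n → ℝ := fun x => ∑ α ∈ multiIndices n ℓ, ‖multiD α v x - multiD α u x‖ with he
  have hW : U ∩ Function.support Φ = B2 ∩ U := by rw [hsupp, inter_comm]
  have hWm : MeasurableSet (B2 ∩ U) := Metric.isOpen_ball.measurableSet.inter hU.measurableSet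
  have hdcont : ∀ β : Fin n → ℕ, ∑ i, β i ≤ ℓ →
      ContinuousOn (fun x => multiD β v x - multiD β u x) (B2 ∩ U) := fun β hβ =>
    (hv.multiD β).continuous.continuousOn.sub ((hucont β hβ).mono inter_subset_right)
  have hecont : ContinuousOn e (B2 ∩ U) := continuousOn_finsetSum _ fun β hβ =>
    (hdcont β (mem_multiIndices.1 hβ).le).norm
  have hele : ∫⁻ x in B2 ∩ U, ‖e x‖ₑ ^ 2 ≤ Nn ^ 2 * δ := by
    have h1 : ∀ x, ‖e x‖ₑ ^ 2 ≤ Nn * ∑ β ∈ multiIndices n ℓ, ‖multiD β v x - multiD β u x‖ₑ ^ 2 := by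
      intro x
      simp only [enorm_sq_eq_ofReal]
      rw [← ENNReal.ofReal_sum_of_nonneg fun _ _ => sq_nonneg _, ← ENNReal.ofReal_natCast,
        ← ENNReal.ofReal_mul (Nat.cast_nonneg _), Real.norm_eq_abs, sq_abs]
      exact ENNReal.ofReal_le_ofReal sq_sum_le_card_mul_sum_sq
    calc ∫⁻ x in B2 ∩ U, ‖e x‖ₑ ^ 2
        ≤ ∫⁻ x in B2 ∩ U, Nn * ∑ β ∈ multiIndices n ℓ, ‖multiD β v x - multiD β u x‖ₑ ^ 2 :=
          lintegral_mono h1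
      _ = Nn * ∑ β ∈ multiIndices n ℓ, ∫⁻ x in B2 ∩ U, ‖multiD β v x - multiD β u x‖ₑ ^ 2 := by
          rw [lintegral_const_mul' _ _ (by simp), lintegral_finsetSum' _ fun β hβ =>
            ((hdcont β (mem_multiIndices.1 hβ).le).aestronglyMeasurable hWm).enorm.pow_const 2]
      _ ≤ Nn * ∑ _β ∈ multiIndices n ℓ, δ := by
          gcongr with β hβ
          exact happr β (mem_multiIndices.1 hβ).le
      _ = Nn ^ 2 * δ := by rw [Finset.sum_const, nsmul_eq_mul, ← hN]; ring
  have heint : IntegrableOn (fun x => e x ^ 2) (B2 ∩ U) := by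
    refine ⟨(hecont.pow 2).aestronglyMeasurable hWm, ?_⟩
    rw [hasFiniteIntegral_iff_enorm]
    simp only [enorm_pow]
    exact hele.trans_lt (ENNReal.mul_lt_top (by simp) ENNReal.coe_lt_top)
  have henergy := hK a' ha.averagedCoeffs (hM a ha) U hU u hu' v hv hvc hvU (by rw [hW]; exact heint)
  rw [hW] at henergy
  have hfin := hK' (fun j => ∫ x, (Φ x ^ (j + 1) * derivSum j v x) ^ 2) (∫ x in B2 ∩ U, e x ^ 2)
    (fun j => integral_nonneg fun x => sq_nonneg _) (integral_nonneg fun x => sq_nonneg _)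
    (fun k _ ε hε => hC k ε hε v hv) henergy (∑ i, α i) hα
  have hTint : ∀ j : ℕ, Integrable fun x => (Φ x ^ (j + 1) * derivSum j v x) ^ 2 := fun j =>
    Continuous.integrable_of_hasCompactSupport (((hΦs.continuous.pow _).mul
      (continuous_finsetSum _ fun β _ => (hv.multiD β).continuous.norm)).pow 2)
      (hΦc.mono fun x hx h => hx (by simp [h]))
  have hfin' := ENNReal.ofReal_le_ofReal hfin
  rw [ENNReal.ofReal_mul hK'0, ENNReal.ofReal_add (integral_nonneg fun x => sq_nonneg _)
    (integral_nonneg fun x => sq_nonneg _), ofReal_integral_sq (hTint _),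
    ofReal_integral_sq (hTint _), ofReal_integral_sq heint, hκ'] at hfin'
  have hleft : ∫⁻ x in B1 ∩ U, ‖multiD α v x‖ₑ ^ 2 ≤
      ∫⁻ x, ‖Φ x ^ (∑ i, α i + 1) * derivSum (∑ i, α i) v x‖ₑ ^ 2 := by
    refine le_trans ?_ (setLIntegral_le_lintegral (B1 ∩ U) _)
    refine setLIntegral_mono' (Metric.isOpen_ball.measurableSet.inter hU.measurableSet) fun x hx => ?_
    rw [hone x hx.1, one_pow, one_mul, enorm_sq_eq_ofReal, enorm_sq_eq_ofReal,
      Real.norm_of_nonneg (derivSum_nonneg _ _ _)]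
    exact ENNReal.ofReal_le_ofReal
      (pow_le_pow_left₀ (norm_nonneg _) (norm_multiD_le_derivSum rfl v x) 2)
  have hright : ∫⁻ x, ‖Φ x ^ (0 + 1) * derivSum 0 v x‖ₑ ^ 2 ≤ ∫⁻ x in B2 ∩ U, ‖v x‖ₑ ^ 2 := by
    rw [← lintegral_indicator hWm]
    refine lintegral_mono fun x => ?_
    rw [derivSum_zero]
    by_cases hx : x ∈ B2 ∩ U
    · rw [Set.indicator_of_mem hx, enorm_sq_eq_ofReal, enorm_sq_eq_ofReal]
      refine ENNReal.ofReal_le_ofReal (pow_le_pow_left₀ (norm_nonneg _) ?_ 2)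
      rw [norm_mul, norm_norm, zero_add, pow_one, Real.norm_of_nonneg (hΦ0 x)]
      exact mul_le_of_le_one_left (norm_nonneg _) (hΦ1 x)
    · have : Φ x * ‖v x‖ = 0 := by
        by_cases hxU : x ∈ U
        · have : x ∉ Function.support Φ := by rw [hsupp]; exact fun h => hx ⟨h, hxU⟩
          rw [Function.notMem_support.1 this, zero_mul]
        · rw [image_eq_zero_of_notMem_tsupport fun h => hxU (hvU h), norm_zero, mul_zero]
      rw [zero_add, pow_one, this]; simp
  have hvu : ∫⁻ x in B2 ∩ U, ‖v x‖ₑ ^ 2 ≤ 2 * (∫⁻ x in B2 ∩ U, ‖u x‖ₑ ^ 2) + 2 * δ := by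
    refine (setLIntegral_enorm_sq_le (g := u) ?_).trans ?_
    · have := hucont 0 (by simp)
      rw [multiD_zero] at this
      exact (this.mono inter_subset_right).aestronglyMeasurable hWm
    · have := happr 0 (by simp)
      simp only [multiD_zero] at this
      gcongr
      refine le_trans (le_of_eq ?_) this
      exact lintegral_congr fun x => by rw [← enorm_neg, neg_sub]
  have huv : ∫⁻ x in B1 ∩ U, ‖multiD α u x‖ₑ ^ 2 ≤
      2 * (∫⁻ x in B1 ∩ U, ‖multiD α v x‖ₑ ^ 2) + 2 * δ := by
    refine (setLIntegral_enorm_sq_le (hv.multiD α).continuous.aestronglyMeasurable).trans ?_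
    gcongr
    exact (lintegral_mono_set (inter_subset_inter_left _ hB)).trans (happr α hα)
  have hcδ : (c : ℝ≥0∞) * δ = ε := by
    rw [hδ, ← ENNReal.coe_mul, mul_div_cancel₀ _ hc0]
  set X := ∫⁻ x in B2 ∩ U, ‖u x‖ₑ ^ 2
  calc ∫⁻ x in B1 ∩ U, ‖multiD α u x‖ₑ ^ 2
      ≤ 2 * (κ * ((2 * X + 2 * δ) + Nn ^ 2 * δ)) + 2 * δ := by
        refine huv.trans ?_
        gcongr
        refine hleft.trans (hfin'.trans ?_)
        gcongr
        exact hright.trans hvu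
    _ = ((4 * κ : ℝ≥0) : ℝ≥0∞) * X + c * δ := by
        rw [hc]; push_cast; ring
    _ = _ := by rw [hcδ]

theorem lintegral_comp_affine (Q : Eucl n) {r : ℝ} (hr : 0 < r) (A : Set (Eucl n))
    (f : Eucl n → ℝ≥0∞) : ∫⁻ y in (fun y => Q + r • y) ⁻¹' A, f (Q + r • y) =
      ENNReal.ofReal (r ^ n)⁻¹ * ∫⁻ x in A, f x := by
  have hemb : MeasurableEmbedding fun y : Eucl n => Q + r • y :=
    (measurableEmbedding_addLeft Q).comp (measurableEmbedding_const_smul₀ hr.ne')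
  have hmap : (volume : Measure (Eucl n)).map (fun y => Q + r • y) =
      ENNReal.ofReal (r ^ n)⁻¹ • volume := by
    have h1 : (fun y : Eucl n => Q + r • y) = (fun y => Q + y) ∘ fun y => r • y := rfl
    rw [h1, ← Measure.map_map (measurable_const_add Q) (measurable_const_smul r),
      Measure.map_addHaar_smul _ hr.ne', Measure.map_smul, map_add_left_eq_self]
    simp [abs_of_pos hr]
  rw [← hemb.lintegral_map, ← hemb.restrict_map, hmap, Measure.restrict_smul,
    lintegral_smul_measure, smul_eq_mul]

theorem multiD_const_smul {F : Type*} [NormedAddCommGroup F] [NormedSpace ℝ F] (α : Fin n → ℕ)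
    (c : ℝ) (f : Eucl n → F) : multiD α (fun y => c • f y) = fun x => c • multiD α f x := by
  simp only [multiD_eq_listD]
  induction coordList α with
  | nil => rfl
  | cons i I ih => rw [listD_cons, ih, partialD_const_smul]; rfl

theorem IsSolution.comp_affine {ℓ : ℕ} {a : Coeffs n m} {U : Set (Eucl n)} {u : Eucl n → Eucl m}
    (hu : IsSolution ℓ a U u) (Q : Eucl n) (r : ℝ) :
    IsSolution ℓ a ((fun y => Q + r • y) ⁻¹' U) fun y => u (Q + r • y) where
  contDiffOn := hu.contDiffOn.comp
    (contDiff_const.add (contDiff_const_smul r)).contDiffOn (mapsTo_preimage _ _)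
  eq_zero y hy j := by
    have h : systemOp ℓ a (fun y => u (Q + r • y)) j y = r ^ (2 * ℓ) * systemOp ℓ a u j (Q + r • y) := by
      simp only [systemOp, Finset.mul_sum]
      refine Finset.sum_congr rfl fun k _ => Finset.sum_congr rfl fun α hα =>
        Finset.sum_congr rfl fun β hβ => ?_
      rw [multiD_comp_affine β (f := fun z => u z k) Q r, multiD_const_smul,
        multiD_comp_affine α (f := multiD β fun z => u z k) Q r, mem_multiIndices.1 hα,
        mem_multiIndices.1 hβ]
      simp only [smul_eq_mul]
      ring
    rw [h, hu.eq_zero _ hy j, mul_zero]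

/-- The Caccioppoli inequality up to the boundary, with `|u|²` alone on the right-hand side. -/
theorem exists_caccioppoli (n m : ℕ) {ℓ : ℕ} {μ : ℝ} (hμ : 0 < μ) :
    ∃ K : ℝ≥0, ∀ a : Coeffs n m, IsSymmElliptic ℓ μ a → ∀ Ω : Set (Eucl n), IsOpen Ω →
      ∀ u : Eucl n → Eucl m, IsSolution ℓ a Ω u → ∀ (Q : Eucl n) (r : ℝ), 0 < r →
      SobolevApprox ℓ Ω (Metric.ball Q (2 * r)) u →
      ∀ α : Fin n → ℕ, ∑ i, α i ≤ ℓ →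
      ENNReal.ofReal (r ^ (2 * ∑ i, α i)) * ∫⁻ x in tent Ω Q r, ‖multiD α u x‖ₑ ^ 2 ≤
        K * ∫⁻ x in tent Ω Q (2 * r), ‖u x‖ₑ ^ 2 := by
  obtain ⟨K, hK⟩ := exists_caccioppoli_unit n m (ℓ := ℓ) hμ
  refine ⟨K, fun a ha Ω hΩ u hu Q r hr happ α hα => ?_⟩
  set φ : Eucl n → Eucl n := fun y => Q + r • y with hφ
  have hφc : Continuous φ := by fun_prop
  have hball : ∀ s : ℝ, φ ⁻¹' (Metric.ball Q (s * r)) = Metric.ball 0 s := by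
    intro s
    ext y
    simp only [hφ, mem_preimage, Metric.mem_ball, dist_eq_norm, add_sub_cancel_left, norm_smul,
      Real.norm_of_nonneg hr.le, sub_zero]
    rw [mul_comm, mul_lt_mul_iff_left₀ hr]
  have hrn : (0 : ℝ) < (r ^ n)⁻¹ := by positivity
  have hD : ∀ (f : Eucl n → Eucl m) (β : Fin n → ℕ) (y : Eucl n),
      multiD β (fun y => f (φ y)) y = r ^ (∑ i, β i) • multiD β f (φ y) := fun f β y => by
    rw [hφ, multiD_comp_affine]
  have hscale : ∀ (k : ℕ) (y : Eucl m), ‖r ^ k • y‖ₑ ^ 2 = ENNReal.ofReal (r ^ (2 * k)) * ‖y‖ₑ ^ 2 := by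
    intro k y
    rw [enorm_sq_eq_ofReal, enorm_sq_eq_ofReal, ← ENNReal.ofReal_mul (by positivity), norm_smul,
      Real.norm_of_nonneg (by positivity)]
    congr 1; ring
  have happ' : SobolevApprox ℓ (φ ⁻¹' Ω) (Metric.ball 0 2) fun y => u (φ y) := by
    intro δ hδ
    set c : ℝ := (r ^ n)⁻¹ * (1 + r ^ 2) ^ ℓ with hc
    have hc0 : 0 < c := by positivity
    obtain ⟨v, hv, hvc, hvΩ, hvu⟩ := happ (δ / ENNReal.ofReal c)
      (ENNReal.div_pos hδ.ne' ENNReal.ofReal_ne_top)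
    have hhom : ∃ h : Eucl n ≃ₜ Eucl n, ⇑h = φ :=
      ⟨(Homeomorph.smulOfNeZero r hr.ne').trans (Homeomorph.addLeft Q), rfl⟩
    obtain ⟨h, hh⟩ := hhom
    refine ⟨fun y => v (φ y), hv.comp (contDiff_const.add (contDiff_const_smul r)),
      by rw [← hh]; exact hvc.comp_homeomorph h, ?_, fun β hβ => ?_⟩
    · exact (tsupport_comp_subset_preimage v hφc).trans (preimage_mono hvΩ)
    · have h1 : ∀ y, ‖multiD β (fun y => v (φ y)) y - multiD β (fun y => u (φ y)) y‖ₑ ^ 2 =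
          ENNReal.ofReal (r ^ (2 * ∑ i, β i)) * ‖multiD β v (φ y) - multiD β u (φ y)‖ₑ ^ 2 := by
        intro y
        rw [hD, hD, ← smul_sub, hscale]
      rw [← hball 2, ← preimage_inter]
      simp only [h1]
      rw [lintegral_comp_affine Q hr (Metric.ball Q (2 * r) ∩ Ω)
        (fun x => ENNReal.ofReal (r ^ (2 * ∑ i, β i)) * ‖multiD β v x - multiD β u x‖ₑ ^ 2),
        lintegral_const_mul' _ _ ENNReal.ofReal_ne_top, ← mul_assoc, ← ENNReal.ofReal_mul hrn.le]
      have h2 : (r ^ n)⁻¹ * r ^ (2 * ∑ i, β i) ≤ c := by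
        rw [hc]
        refine mul_le_mul_of_nonneg_left ?_ hrn.le
        rw [pow_mul]
        calc (r ^ 2) ^ (∑ i, β i) ≤ (1 + r ^ 2) ^ (∑ i, β i) := by gcongr; linarith
          _ ≤ (1 + r ^ 2) ^ ℓ := pow_le_pow_right₀ (by nlinarith) hβ
      calc _ ≤ ENNReal.ofReal c * (δ / ENNReal.ofReal c) :=
            mul_le_mul' (ENNReal.ofReal_le_ofReal h2) (hvu β hβ)
        _ ≤ δ := ENNReal.mul_div_le
  have h := hK a ha (φ ⁻¹' Ω) (hΩ.preimage hφc) _ (hu.comp_affine Q r) happ' α hα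
  have h1 : ∀ y, ‖multiD α (fun y => u (φ y)) y‖ₑ ^ 2 =
      ENNReal.ofReal (r ^ (2 * ∑ i, α i)) * ‖multiD α u (φ y)‖ₑ ^ 2 := fun y => by rw [hD, hscale]
  have hb1 := hball 1
  rw [one_mul] at hb1
  rw [← hb1, ← hball 2, ← preimage_inter, ← preimage_inter] at h
  change ∫⁻ y in φ ⁻¹' (Metric.ball Q r ∩ Ω), ‖multiD α (fun y => u (φ y)) y‖ₑ ^ 2 ≤
    K * ∫⁻ y in φ ⁻¹' (Metric.ball Q (2 * r) ∩ Ω), ‖u (φ y)‖ₑ ^ 2 at h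
  simp only [h1] at h
  rw [lintegral_comp_affine Q hr (Metric.ball Q r ∩ Ω)
      (fun x => ENNReal.ofReal (r ^ (2 * ∑ i, α i)) * ‖multiD α u x‖ₑ ^ 2),
    lintegral_comp_affine Q hr (Metric.ball Q (2 * r) ∩ Ω) (fun x => ‖u x‖ₑ ^ 2),
    lintegral_const_mul' _ _ ENNReal.ofReal_ne_top, mul_left_comm (K : ℝ≥0∞)] at h
  exact (ENNReal.mul_le_mul_iff_right (ENNReal.ofReal_pos.2 hrn).ne' ENNReal.ofReal_ne_top).1 h

end CaccioppoliLimit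

/-! ### Graph charts -/

section Charts

variable {n : ℕ}

/-- In the ball `B(Q, ρ)` around a boundary point `Q`, the domain `Ω` is `{0 < h}`, where
`h x = ⟪e, x⟫ - ψ x'` is the signed height of `x` above the graph of a Lipschitz function `ψ`. The
graph is encoded through `h` only: `h` is `Λ`-Lipschitz and grows at unit speed along `e`. -/
structure IsGraphChart (Ω : Set (Eucl n)) (Q : Eucl n) (ρ Λ : ℝ) (e : Eucl n) (h : Eucl n → ℝ) :
    Prop where
  isOpen : IsOpen Ω
  mem_frontier : Q ∈ frontier Ω
  pos : 0 < ρ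
  one_le : 1 ≤ Λ
  norm_eq : ‖e‖ = 1
  lipschitz : ∀ x y, |h x - h y| ≤ Λ * dist x y
  add_smul : ∀ x (t : ℝ), h (x + t • e) = h x + t
  mem_iff : ∀ x ∈ Metric.ball Q ρ, x ∈ Ω ↔ 0 < h x

/-- The point at which the vertical line through `x`, that is the line in the direction `e`, meets
the graph `{h = 0}`. -/
def foot (e : Eucl n) (h : Eucl n → ℝ) (x : Eucl n) : Eucl n := x - h x • e

namespace IsGraphChart

variable {Ω : Set (Eucl n)} {Q e : Eucl n} {ρ Λ : ℝ} {h : Eucl n → ℝ}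

theorem continuous (H : IsGraphChart Ω Q ρ Λ e h) : Continuous h := by
  have : LipschitzWith Λ.toNNReal h := LipschitzWith.of_dist_le_mul fun x y => by
    rw [Real.coe_toNNReal _ (zero_le_one.trans H.one_le), Real.dist_eq]
    exact H.lipschitz x y
  exact this.continuous

theorem continuous_foot (H : IsGraphChart Ω Q ρ Λ e h) : Continuous (foot e h) :=
  continuous_id.sub (H.continuous.smul continuous_const)

theorem mem_frontier_iff (H : IsGraphChart Ω Q ρ Λ e h) {x : Eucl n} (hx : x ∈ Metric.ball Q ρ) :
    x ∈ frontier Ω ↔ h x = 0 := by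
  rw [H.isOpen.frontier_eq]
  constructor
  · rintro ⟨hc, hn⟩
    refine le_antisymm (not_lt.1 fun h0 => hn ((H.mem_iff x hx).2 h0)) ?_
    have h1 : x ∈ closure (Ω ∩ Metric.ball Q ρ) := by
      rw [mem_closure_iff_nhds] at hc ⊢
      intro t ht
      obtain ⟨y, ⟨hy1, hy2⟩, hy3⟩ := hc _ (inter_mem ht (Metric.isOpen_ball.mem_nhds hx))
      exact ⟨y, hy1, hy3, hy2⟩
    exact closure_minimal (t := {y | 0 ≤ h y}) (fun y hy => ((H.mem_iff y hy.2).1 hy.1).le)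
      (isClosed_le continuous_const H.continuous) h1
  · intro h0
    refine ⟨?_, fun hΩ => ((H.mem_iff x hx).1 hΩ).ne' h0⟩
    have hcont : Tendsto (fun t : ℝ => x + t • e) (𝓝[>] 0) (𝓝 x) := by
      have : Continuous fun t : ℝ => x + t • e := by fun_prop
      simpa using (this.tendsto 0).mono_left nhdsWithin_le_nhds
    refine mem_closure_of_tendsto hcont ?_
    filter_upwards [hcont (Metric.isOpen_ball.mem_nhds hx), self_mem_nhdsWithin] with t ht ht0
    rw [H.mem_iff _ ht, H.add_smul, h0, zero_add]
    exact ht0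

theorem height_center (H : IsGraphChart Ω Q ρ Λ e h) : h Q = 0 :=
  (H.mem_frontier_iff (Metric.mem_ball_self H.pos)).1 H.mem_frontier

theorem abs_height_le (H : IsGraphChart Ω Q ρ Λ e h) (x : Eucl n) : |h x| ≤ Λ * dist x Q := by
  simpa [H.height_center] using H.lipschitz x Q

theorem height_foot_add (H : IsGraphChart Ω Q ρ Λ e h) (x : Eucl n) (t : ℝ) :
    h (foot e h x + t • e) = t := by
  have : foot e h x + t • e = x + (t - h x) • e := by rw [foot]; module
  rw [this, H.add_smul]; ring

theorem height_foot (H : IsGraphChart Ω Q ρ Λ e h) (x : Eucl n) : h (foot e h x) = 0 := by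
  simpa using H.height_foot_add x 0

theorem foot_add_smul (H : IsGraphChart Ω Q ρ Λ e h) (x : Eucl n) (t : ℝ) :
    foot e h (x + t • e) = foot e h x := by
  rw [foot, foot, H.add_smul]; module

theorem dist_foot (H : IsGraphChart Ω Q ρ Λ e h) (x : Eucl n) : dist x (foot e h x) = |h x| := by
  rw [foot, dist_eq_norm, sub_sub_cancel, norm_smul, H.norm_eq, mul_one, Real.norm_eq_abs]

theorem dist_foot_center_le (H : IsGraphChart Ω Q ρ Λ e h) (x : Eucl n) :
    dist (foot e h x) Q ≤ (1 + Λ) * dist x Q := by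
  have h1 := dist_triangle (foot e h x) x Q
  rw [dist_comm (foot e h x) x, H.dist_foot] at h1
  linarith [H.abs_height_le x]

theorem dist_foot_foot_le (H : IsGraphChart Ω Q ρ Λ e h) (x y : Eucl n) :
    dist (foot e h x) (foot e h y) ≤ (1 + Λ) * dist x y := by
  have h1 : foot e h x - foot e h y = (x - y) - (h x - h y) • e := by rw [foot, foot]; module
  rw [dist_eq_norm, h1]
  refine (norm_sub_le _ _).trans ?_
  rw [norm_smul, H.norm_eq, mul_one, Real.norm_eq_abs, ← dist_eq_norm]
  linarith [H.lipschitz x y]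

/-- In half the ball of the chart, the height is at most `Λ` times the distance to the boundary:
boundary points outside of the ball are further away than `Q`. -/
theorem height_le (H : IsGraphChart Ω Q ρ Λ e h) {x : Eucl n} (hx : x ∈ Metric.ball Q (ρ / 2))
    {P : Eucl n} (hP : P ∈ frontier Ω) : h x ≤ Λ * dist x P := by
  have hΛ := H.one_le
  rw [Metric.mem_ball] at hx
  by_cases hPx : dist x P < dist x Q
  · have h1 : P ∈ Metric.ball Q ρ := by
      have := dist_triangle P x Q
      rw [dist_comm P x] at this
      rw [Metric.mem_ball]; linarith
    have h2 := H.lipschitz x P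
    rw [(H.mem_frontier_iff h1).1 hP, sub_zero] at h2
    exact (le_abs_self _).trans h2
  · refine (le_abs_self _).trans ((H.abs_height_le x).trans ?_)
    exact mul_le_mul_of_nonneg_left (not_lt.1 hPx) (by linarith)

theorem height_le_infDist (H : IsGraphChart Ω Q ρ Λ e h) {x : Eucl n}
    (hx : x ∈ Metric.ball Q (ρ / 2)) : h x / Λ ≤ Metric.infDist x (frontier Ω) := by
  have hΛ : 0 < Λ := zero_lt_one.trans_le H.one_le
  refine (Metric.le_infDist ⟨Q, H.mem_frontier⟩).2 fun P hP => ?_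
  rw [div_le_iff₀ hΛ, mul_comm]
  exact H.height_le hx hP

/-- Every interior point near the boundary lies in the approach regions of all boundary points in
a ball of comparable radius; seen from the height of `x`, these points are the feet of a ball. -/
theorem exists_ball_subset (H : IsGraphChart Ω Q ρ Λ e h) {x : Eucl n}
    (hx : x ∈ Metric.ball Q (ρ / 2)) (hfoot : foot e h x ∈ Metric.ball Q ρ) (h0 : 0 < h x) :
    ∃ y, dist y (foot e h x) ≤ 2 * h x ∧ y ∈ frontier Ω ∧
      ∀ z, dist z y < h x / (Λ * (1 + Λ)) → foot e h z ∈ frontier Ω →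
        x ∈ approachRegion Ω (foot e h z) := by
  have hΛ : 0 < Λ := zero_lt_one.trans_le H.one_le
  have hxΩ : x ∈ Ω := (H.mem_iff x (Metric.ball_subset_ball (by linarith [H.pos]) hx)).2 h0
  have hfr : foot e h x ∈ frontier Ω := (H.mem_frontier_iff hfoot).2 (H.height_foot x)
  obtain ⟨y, hy, hyd⟩ := isClosed_frontier.exists_infDist_eq_dist (s := frontier Ω) ⟨Q, H.mem_frontier⟩ x
  have hd1 : Metric.infDist x (frontier Ω) ≤ h x := by
    have := Metric.infDist_le_dist_of_mem (x := x) hfr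
    rwa [H.dist_foot, abs_of_pos h0] at this
  have hd2 := H.height_le_infDist hx
  have hyB : y ∈ Metric.ball Q ρ := by
    have h1 := dist_triangle y x Q
    have h2 := Metric.infDist_le_dist_of_mem (x := x) H.mem_frontier
    rw [hyd] at h2
    rw [Metric.mem_ball] at hx ⊢
    rw [dist_comm y x] at h1
    linarith
  have hhy := (H.mem_frontier_iff hyB).1 hy
  have hfy : foot e h y = y := by rw [foot, hhy, zero_smul, sub_zero]
  refine ⟨y, ?_, hy, fun z hz hzf => ⟨hxΩ, ?_⟩⟩
  · have h1 := dist_triangle y x (foot e h x)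
    rw [H.dist_foot, abs_of_pos h0, dist_comm y x, ← hyd] at h1
    linarith
  · have h1 := H.dist_foot_foot_le z y
    rw [hfy] at h1
    have h2 := dist_triangle x y (foot e h z)
    rw [← hyd, dist_comm y] at h2
    have h3 : (1 + Λ) * dist z y < h x / Λ := by
      rw [lt_div_iff₀ (by positivity)] at hz
      rw [lt_div_iff₀ hΛ]
      linarith
    linarith

end IsGraphChart

theorem IsBoundedLipschitzDomain.isCompact_frontier {Ω : Set (Eucl n)}
    (hΩ : IsBoundedLipschitzDomain Ω) : IsCompact (frontier Ω) :=
  Metric.isCompact_of_isClosed_isBounded isClosed_frontier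
    (hΩ.isBounded.closure.subset frontier_subset_closure)

/-- A local graph representation at `Q` serves as a chart of half the size for all boundary points
near `Q`. -/
theorem exists_isGraphChart_near {Ω : Set (Eucl n)} (hΩ : IsBoundedLipschitzDomain Ω) {Q : Eucl n}
    (hQ : Q ∈ frontier Ω) : ∃ ρ Λ : ℝ, 0 < ρ ∧ 1 ≤ Λ ∧ ∀ Q' ∈ frontier Ω, dist Q' Q < ρ →
      ∃ e h, IsGraphChart Ω Q' ρ Λ e h := by
  obtain ⟨e, ψ, K, ρ, he, hψ, hρ, hgraph⟩ := hΩ.locallyGraph Q hQ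
  set P := (ℝ ∙ e)ᗮ.orthogonalProjectionOnto with hP
  refine ⟨ρ / 2, 1 + K, by positivity, by simp, fun Q' hQ' hd =>
    ⟨e, fun x => ⟪e, x⟫ - ψ (P x), hΩ.isOpen, hQ', by positivity, by simp, he, ?_, ?_, ?_⟩⟩
  · intro x y
    have h1 : |⟪e, x⟫ - ⟪e, y⟫| ≤ dist x y := by
      rw [← inner_sub_right, dist_eq_norm]
      simpa [he] using abs_real_inner_le_norm e (x - y)
    have h2 : |ψ (P x) - ψ (P y)| ≤ K * dist x y := by
      have h3 := hψ.dist_le_mul (P x) (P y)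
      rw [Real.dist_eq] at h3
      refine h3.trans (mul_le_mul_of_nonneg_left ?_ K.2)
      rw [dist_eq_norm, dist_eq_norm, ← map_sub]
      exact (ℝ ∙ e)ᗮ.norm_orthogonalProjectionOnto_apply_le _
    calc _ = |(⟪e, x⟫ - ⟪e, y⟫) - (ψ (P x) - ψ (P y))| := by congr 1; ring
      _ ≤ _ := (abs_sub _ _).trans (by linarith)
  · intro x t
    have h1 : P (t • e) = 0 := by
      rw [hP, Submodule.orthogonalProjectionOnto_orthogonal_apply_eq_zero]
      exact Submodule.smul_mem _ _ (Submodule.mem_span_singleton_self e)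
    simp only [map_add, h1, add_zero, inner_add_right, inner_smul_right, real_inner_self_eq_norm_sq,
      he]
    ring
  · intro x hx
    have hx' : x ∈ Metric.ball Q ρ := by
      rw [Metric.mem_ball] at hx ⊢
      linarith [dist_triangle x Q' Q]
    have := Set.ext_iff.1 hgraph x
    simp only [mem_inter_iff, hx', and_true, mem_ofPred_eq] at this
    rw [this, sub_pos]

theorem IsGraphChart.mono {Ω : Set (Eucl n)} {Q e : Eucl n} {ρ ρ' Λ Λ' : ℝ} {h : Eucl n → ℝ}
    (H : IsGraphChart Ω Q ρ Λ e h) (hρ' : 0 < ρ') (hρ : ρ' ≤ ρ) (hΛ : Λ ≤ Λ') :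
    IsGraphChart Ω Q ρ' Λ' e h where
  isOpen := H.isOpen
  mem_frontier := H.mem_frontier
  pos := hρ'
  one_le := H.one_le.trans hΛ
  norm_eq := H.norm_eq
  lipschitz x y := (H.lipschitz x y).trans (mul_le_mul_of_nonneg_right hΛ dist_nonneg)
  add_smul := H.add_smul
  mem_iff x hx := H.mem_iff x (Metric.ball_subset_ball hρ hx)

/-- By compactness of the boundary, the size and the Lipschitz constant of the charts can be chosen
uniformly. -/
theorem IsBoundedLipschitzDomain.exists_uniform_chart {Ω : Set (Eucl n)}
    (hΩ : IsBoundedLipschitzDomain Ω) :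
    ∃ ρ Λ : ℝ, 0 < ρ ∧ 1 ≤ Λ ∧ ∀ Q ∈ frontier Ω, ∃ e h, IsGraphChart Ω Q ρ Λ e h := by
  have key : ∃ ρ Λ : ℝ, 0 < ρ ∧ 1 ≤ Λ ∧ ∀ Q ∈ frontier Ω, Q ∈ frontier Ω →
      ∃ e h, IsGraphChart Ω Q ρ Λ e h := by
    refine hΩ.isCompact_frontier.induction_on (p := fun s => ∃ ρ Λ : ℝ, 0 < ρ ∧ 1 ≤ Λ ∧
      ∀ Q ∈ s, Q ∈ frontier Ω → ∃ e h, IsGraphChart Ω Q ρ Λ e h) ?_ ?_ ?_ ?_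
    · exact ⟨1, 1, one_pos, le_rfl, by simp⟩
    · rintro s t hst ⟨ρ, Λ, hρ, hΛ, H⟩
      exact ⟨ρ, Λ, hρ, hΛ, fun Q hQ => H Q (hst hQ)⟩
    · rintro s t ⟨ρ, Λ, hρ, hΛ, H⟩ ⟨ρ', Λ', hρ', hΛ', H'⟩
      refine ⟨min ρ ρ', max Λ Λ', lt_min hρ hρ', hΛ.trans (le_max_left _ _), fun Q hQ hQf => ?_⟩
      rcases hQ with hQ | hQ
      · obtain ⟨e, h, hc⟩ := H Q hQ hQf
        exact ⟨e, h, hc.mono (lt_min hρ hρ') (min_le_left _ _) (le_max_left _ _)⟩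
      · obtain ⟨e, h, hc⟩ := H' Q hQ hQf
        exact ⟨e, h, hc.mono (lt_min hρ hρ') (min_le_right _ _) (le_max_right _ _)⟩
    · intro Q hQ
      obtain ⟨ρ, Λ, hρ, hΛ, H⟩ := exists_isGraphChart_near hΩ hQ
      exact ⟨Metric.ball Q ρ, mem_nhdsWithin_of_mem_nhds (Metric.ball_mem_nhds Q hρ), ρ, Λ, hρ, hΛ,
        fun Q' hQ' hQf => H Q' hQf hQ'⟩
  obtain ⟨ρ, Λ, hρ, hΛ, H⟩ := key
  exact ⟨ρ, Λ, hρ, hΛ, fun Q hQ => H Q hQ hQ⟩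

end Charts

/-! ### Surface measure and Lebesgue measure -/

section SurfaceMeasure

variable {n : ℕ}

/-- Orthogonal projection to `e^⊥` compares Lebesgue measure on a slab with the `(n - 1)`-dimensional
Hausdorff measure: the projected slab measure is translation invariant, hence a Haar measure. -/
theorem exists_volume_slab_le {e : Eucl n} (he : ‖e‖ = 1) (M : ℝ) : ∃ c : ℝ≥0, ∀ S : Set (Eucl n),
    volume ({x : Eucl n | |⟪e, x⟫| ≤ M} ∩ (ℝ ∙ e)ᗮ.orthogonalProjectionOnto ⁻¹'
      ((ℝ ∙ e)ᗮ.orthogonalProjectionOnto '' S)) ≤ c * surfaceMeasure n S := by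
  have he0 : e ≠ 0 := fun h => by simp [h] at he
  obtain ⟨k, rfl⟩ : ∃ k, n = k + 1 := by
    cases n with
    | zero => exact absurd (Subsingleton.elim e 0) he0
    | succ k => exact ⟨k, rfl⟩
  set V := (ℝ ∙ e)ᗮ with hV
  set P := V.orthogonalProjectionOnto with hP
  have : Fact (Module.finrank ℝ (Eucl (k + 1)) = k + 1) := ⟨by simp⟩
  have hrank : Module.finrank ℝ V = k := Submodule.finrank_orthogonal_span_singleton he0
  set slab : Set (Eucl (k + 1)) := {x | |⟪e, x⟫| ≤ M} with hslab
  set ν : Measure V := (volume.restrict slab).map P with hν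
  have hPm : Measurable P := P.continuous.measurable
  have hinv : ν.IsAddLeftInvariant := by
    refine ⟨fun v => ?_⟩
    have hve : ⟪e, (v : Eucl (k + 1))⟫ = 0 :=
      Submodule.mem_orthogonal_singleton_iff_inner_right.1 v.2
    have h1 : ((v : Eucl (k + 1)) + ·) ⁻¹' slab = slab := by
      ext x
      simp only [hslab, mem_preimage, mem_ofPred_eq, inner_add_right, hve, zero_add]
    have h2 : (volume.restrict slab).map ((v : Eucl (k + 1)) + ·) = volume.restrict slab := by
      conv_lhs => rw [← h1]
      rw [← (measurableEmbedding_addLeft (v : Eucl (k + 1))).restrict_map, map_add_left_eq_self]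
    rw [hν, Measure.map_map (measurable_const_add v) hPm]
    have h3 : (fun x => v + x) ∘ P = P ∘ ((v : Eucl (k + 1)) + ·) := by
      funext x
      simp only [Function.comp_apply, map_add]
      rw [hP, Submodule.orthogonalProjectionOnto_mem_subspace_eq_self]
    rw [h3, ← Measure.map_map hPm (measurable_const_add _), h2]
  have hfin : IsFiniteMeasureOnCompacts ν := by
    refine ⟨fun K hK => ?_⟩
    rw [hν, Measure.map_apply hPm hK.measurableSet, Measure.restrict_apply (hPm hK.measurableSet)]
    obtain ⟨r, hr⟩ := hK.isBounded.subset_closedBall (0 : V)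
    refine (measure_mono ?_).trans_lt
      (Metric.isBounded_closedBall (x := (0 : Eucl (k + 1))) (r := r + M)).measure_lt_top
    rintro x ⟨hx1, hx2⟩
    have h1 : ‖P x‖ ≤ r := by simpa using hr hx1
    have h2 : x = ⟪e, x⟫ • e + (P x : Eucl (k + 1)) := by
      have h3 := (ℝ ∙ e).starProjection_add_starProjection_orthogonal x
      rw [Submodule.starProjection_unit_singleton ℝ he] at h3
      exact h3.symm
    rw [mem_closedBall_zero_iff, h2]
    refine (norm_add_le _ _).trans ?_
    rw [norm_smul, he, mul_one, Real.norm_eq_abs]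
    have h3 : |⟪e, x⟫| ≤ M := hx2
    have h4 : ‖(P x : Eucl (k + 1))‖ ≤ r := h1
    linarith
  have hHaar : (μH[(k : ℝ)] : Measure V).IsAddHaarMeasure := by
    have h1 : (μH[(Module.finrank ℝ V : ℝ)] : Measure V).IsAddHaarMeasure := inferInstance
    rwa [hrank] at h1
  have hsm := Measure.isAddLeftInvariant_eq_smul ν μH[(k : ℝ)]
  refine ⟨Measure.addHaarScalarFactor ν μH[(k : ℝ)], fun S => ?_⟩
  calc volume (slab ∩ P ⁻¹' (P '' S)) ≤ ν (P '' S) := by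
        rw [inter_comm]
        exact (Measure.le_restrict_apply _ _).trans (Measure.le_map_apply hPm.aemeasurable _)
    _ = Measure.addHaarScalarFactor ν μH[(k : ℝ)] * μH[(k : ℝ)] (P '' S) := by
        conv_lhs => rw [hsm]
        rfl
    _ ≤ _ := by
        gcongr
        have h1 : LipschitzWith 1 P := V.lipschitzWith_orthogonalProjectionOnto
        have h2 := h1.hausdorffMeasure_image_le (Nat.cast_nonneg k) S
        rw [surfaceMeasure]
        simpa using h2

variable {Ω : Set (Eucl n)} {Q e : Eucl n} {ρ Λ : ℝ} {h : Eucl n → ℝ}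

/-- The image of Lebesgue measure under the vertical projection to the boundary is bounded by a
multiple of surface measure. This inequality is all that is needed of surface measure. -/
theorem IsGraphChart.exists_map_foot_le (H : IsGraphChart Ω Q ρ Λ e h) {R R₀ : ℝ}
    (hR : (1 + Λ) * R ≤ R₀) (hR₀ : R₀ ≤ ρ) : ∃ c : ℝ≥0,
    (volume.restrict (Metric.ball Q R)).map (foot e h) ≤
      c • (surfaceMeasure n).restrict (surfaceBall Ω Q R₀) := by
  obtain ⟨c, hc⟩ := exists_volume_slab_le H.norm_eq (‖Q‖ + R)
  have hΛ := H.one_le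
  refine ⟨c, Measure.le_iff.2 fun S hS => ?_⟩
  have hfm := H.continuous_foot.measurable
  rw [Measure.map_apply hfm hS, Measure.restrict_apply (hfm hS), Measure.smul_apply,
    Measure.restrict_apply hS]
  refine (measure_mono ?_).trans (hc (S ∩ surfaceBall Ω Q R₀))
  rintro x ⟨hxS, hx⟩
  rw [Metric.mem_ball] at hx
  constructor
  · change |⟪e, x⟫| ≤ _
    have h1 := abs_real_inner_le_norm e x
    rw [H.norm_eq, one_mul] at h1
    have h2 : ‖x‖ ≤ ‖Q‖ + dist x Q := by
      rw [dist_eq_norm]; simpa using norm_add_le Q (x - Q)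
    linarith
  · have hd : dist (foot e h x) Q < R₀ :=
      (H.dist_foot_center_le x).trans_lt (lt_of_lt_of_le (by gcongr) hR)
    refine ⟨foot e h x, ⟨hxS, hd, ?_⟩, ?_⟩
    · exact (H.mem_frontier_iff (Metric.mem_ball.2 (hd.trans_le hR₀))).2 (H.height_foot x)
    · rw [foot, map_sub, map_smul]
      rw [(ℝ ∙ e).orthogonalProjectionOnto_orthogonal_apply_eq_zero
        (Submodule.mem_span_singleton_self e), smul_zero, sub_zero]

/-- Lebesgue-almost every `z` near `Q` has a foot at which the boundary property `p` holds, if `p`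
holds at almost every boundary point near `Q`. -/
theorem IsGraphChart.ae_foot (H : IsGraphChart Ω Q ρ Λ e h) {R R₀ : ℝ}
    (hR : (1 + Λ) * R ≤ R₀) (hR₀ : R₀ ≤ ρ) {p : Eucl n → Prop}
    (hp : ∀ᵐ P ∂(surfaceMeasure n).restrict (surfaceBall Ω Q R₀), p P) :
    ∀ᵐ z ∂volume.restrict (Metric.ball Q R), p (foot e h z) := by
  obtain ⟨c, hc⟩ := H.exists_map_foot_le hR hR₀
  refine ae_of_ae_map H.continuous_foot.measurable.aemeasurable ?_
  exact (Measure.absolutelyContinuous_of_le hc).ae_le (Measure.smul_absolutelyContinuous.ae_le hp)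

theorem IsGraphChart.lintegral_foot_lt_top (H : IsGraphChart Ω Q ρ Λ e h) {R R₀ : ℝ}
    (hR : (1 + Λ) * R ≤ R₀) (hR₀ : R₀ ≤ ρ) {g : Eucl n → ℝ≥0∞} (hg : Measurable g)
    (hfin : ∫⁻ P in surfaceBall Ω Q R₀, g P ∂(surfaceMeasure n) < ⊤) :
    ∫⁻ z in Metric.ball Q R, g (foot e h z) < ⊤ := by
  obtain ⟨c, hc⟩ := H.exists_map_foot_le hR hR₀
  rw [← lintegral_map hg H.continuous_foot.measurable]
  refine (lintegral_mono' hc le_rfl).trans_lt ?_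
  rw [lintegral_smul_measure]
  exact ENNReal.mul_lt_top ENNReal.coe_lt_top hfin

end SurfaceMeasure

/-! ### Nontangential limits and maximal functions -/

section Nontangential

variable {n : ℕ}

/-- The nontangential maximal function of any function is lower semicontinuous. -/
theorem measurable_ntMax (Ω : Set (Eucl n)) (w : Eucl n → ℝ) : Measurable (ntMax Ω w) := by
  refine measurable_of_Ioi fun t => IsOpen.measurableSet ?_
  have : ntMax Ω w ⁻¹' Ioi t =
      ⋃ x ∈ {x | x ∈ Ω ∧ t < ‖w x‖ₑ}, {P | dist x P < 2 * Metric.infDist x (frontier Ω)} := by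
    ext P
    simp only [ntMax, mem_preimage, mem_Ioi, lt_iSup_iff, approachRegion, mem_iUnion,
      mem_ofPred_eq, exists_prop]
    exact exists_congr fun x => by tauto
  rw [this]
  exact isOpen_biUnion fun x _ => isOpen_lt (by fun_prop) continuous_const

theorem volume_ball_eq (x : Eucl n) {r : ℝ} (hr : 0 < r) :
    volume (Metric.ball x r) = ENNReal.ofReal (r ^ n) * volume (Metric.ball (0 : Eucl n) 1) := by
  rw [Measure.addHaar_ball_of_pos _ x hr, finrank_euclideanSpace_fin]

theorem volume_unit_ball_pos : 0 < volume (Metric.ball (0 : Eucl n) 1) :=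
  Metric.measure_ball_pos _ _ one_pos

theorem volume_unit_ball_lt_top : volume (Metric.ball (0 : Eucl n) 1) < ⊤ := measure_ball_lt_top

namespace IsGraphChart

variable {Ω : Set (Eucl n)} {Q e : Eucl n} {ρ Λ : ℝ} {h : Eucl n → ℝ}

/-- Near a density point of the set of points with foot in `F`, the points of a vertical line are
approached nontangentially from `F`. This compensates for the fixed aperture of the approach
regions, which need not contain the vertical line. -/
theorem eventually_exists_mem_approachRegion (H : IsGraphChart Ω Q ρ Λ e h) {F : Set (Eucl n)}
    (hF : F ⊆ frontier Ω) {z : Eucl n} (hz : foot e h z ∈ Metric.ball Q (ρ / 2))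
    (hdens : Tendsto (fun r => volume (foot e h ⁻¹' F ∩ Metric.closedBall z r) /
      volume (Metric.closedBall z r)) (𝓝[>] 0) (𝓝 1)) :
    ∀ᶠ s in 𝓝[>] (0 : ℝ), ∃ P ∈ F, foot e h z + s • e ∈ approachRegion Ω P ∧
      dist (foot e h z + s • e) P < 2 * s := by
  have hΛ : 0 < Λ := zero_lt_one.trans_le H.one_le
  have hρ := H.pos
  set L : ℝ := Λ * (1 + Λ) with hL
  have hL1 : 1 ≤ L := by nlinarith [H.one_le]
  -- the volume fraction of a ball of radius `s / L` in a ball of radius `3 s`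
  set θ : ℝ≥0∞ := ENNReal.ofReal ((3 * L)⁻¹ ^ n) with hθ
  have hθ0 : θ ≠ 0 := (ENNReal.ofReal_pos.2 (by positivity)).ne'
  have hcont : Tendsto (fun t : ℝ => foot e h z + t • e) (𝓝[>] 0) (𝓝 (foot e h z)) := by
    have : Continuous fun t : ℝ => foot e h z + t • e := by fun_prop
    simpa using (this.tendsto 0).mono_left nhdsWithin_le_nhds
  have h3 : Tendsto (fun s : ℝ => 3 * s) (𝓝[>] 0) (𝓝[>] 0) := by
    refine tendsto_nhdsWithin_iff.2 ⟨?_, ?_⟩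
    · have : Continuous fun s : ℝ => 3 * s := by fun_prop
      simpa using (this.tendsto 0).mono_left nhdsWithin_le_nhds
    · filter_upwards [self_mem_nhdsWithin] with s hs
      exact mul_pos three_pos (mem_Ioi.1 hs)
  have hev := (hdens.comp h3).eventually (lt_mem_nhds (ENNReal.sub_lt_self ENNReal.one_ne_top
    one_ne_zero hθ0))
  filter_upwards [hev, hcont (Metric.isOpen_ball.mem_nhds hz), self_mem_nhdsWithin]
    with s hs hsB hs0
  have hs0 : 0 < s := hs0
  set x := foot e h z + s • e with hx
  have hhx : h x = s := H.height_foot_add z s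
  have hfx : foot e h x = foot e h z := by
    rw [hx, H.foot_add_smul]
    rw [foot, H.height_foot, zero_smul, sub_zero]
  have hfz : foot e h z ∈ Metric.ball Q ρ := Metric.ball_subset_ball (by linarith) hz
  obtain ⟨y, hy1, hy2, hy3⟩ := H.exists_ball_subset hsB (by rwa [hfx]) (by rwa [hhx])
  rw [hhx, hfx] at hy1
  rw [hhx] at hy3
  set δ := s / L with hδ
  have hδ0 : 0 < δ := by positivity
  have hδs : δ ≤ s := div_le_self hs0.le hL1
  set B := Metric.ball (y + h z • e) δ with hB
  have hBsub : B ⊆ Metric.closedBall z (3 * s) := by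
    refine Metric.ball_subset_closedBall.trans (Metric.closedBall_subset_closedBall' ?_)
    have : dist (y + h z • e) z = dist y (foot e h z) := by
      rw [dist_eq_norm, dist_eq_norm, foot]; congr 1; abel
    rw [this]; linarith
  have hvB : volume B = θ * volume (Metric.closedBall z (3 * s)) := by
    rw [Measure.addHaar_closedBall _ _ (by positivity), finrank_euclideanSpace_fin, hB,
      volume_ball_eq _ hδ0, ← mul_assoc, hθ, ← ENNReal.ofReal_mul (by positivity),
      ← mul_pow]
    congr 3
    rw [hδ]; field_simp
  -- otherwise the points with foot in `F` would fill at most the fraction `1 - θ` of the large ball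
  have hne : (foot e h ⁻¹' F ∩ B).Nonempty := by
    by_contra hemp
    rw [not_nonempty_iff_eq_empty] at hemp
    have hc0 : volume (Metric.closedBall z (3 * s)) ≠ 0 :=
      (Metric.measure_closedBall_pos _ _ (by positivity)).ne'
    have hct : volume (Metric.closedBall z (3 * s)) ≠ ⊤ := measure_closedBall_lt_top.ne
    have h1 : volume (foot e h ⁻¹' F ∩ Metric.closedBall z (3 * s)) + volume B ≤
        volume (Metric.closedBall z (3 * s)) := by
      rw [← measure_union _ Metric.isOpen_ball.measurableSet]
      · exact measure_mono (union_subset inter_subset_right hBsub)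
      · refine Set.disjoint_left.2 fun w hw hwB => ?_
        exact (hemp.subset ⟨hw.1, hwB⟩).elim
    have h2 : volume (foot e h ⁻¹' F ∩ Metric.closedBall z (3 * s)) /
        volume (Metric.closedBall z (3 * s)) + θ ≤ 1 := by
      have h4 := ENNReal.div_le_div_right h1 (volume (Metric.closedBall z (3 * s)))
      rwa [ENNReal.add_div, ENNReal.div_self hc0 hct, hvB, ENNReal.mul_div_cancel_right hc0 hct] at h4
    have h5 := ENNReal.add_lt_add_right (ENNReal.ofReal_ne_top : θ ≠ ⊤) hs
    exact absurd ((le_tsub_add.trans_lt h5).trans_le h2) (lt_irrefl _)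
  obtain ⟨z', hz'F, hz'B⟩ := hne
  have hfoot : foot e h (z' + (-h z) • e) = foot e h z' := H.foot_add_smul z' _
  have hΓ : x ∈ approachRegion Ω (foot e h z') := by
    rw [← hfoot]
    refine hy3 _ ?_ (by rw [hfoot]; exact hF hz'F)
    have : dist (z' + (-h z) • e) y = dist z' (y + h z • e) := by
      rw [dist_eq_norm, dist_eq_norm]; congr 1; module
    rw [this]; exact hz'B
  refine ⟨_, hz'F, hΓ, hΓ.2.trans_le ?_⟩
  have h1 := Metric.infDist_le_dist_of_mem (x := x) ((H.mem_frontier_iff hfz).2 (H.height_foot z))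
  have h2 := H.dist_foot x
  rw [hfx, hhx, abs_of_pos hs0] at h2
  linarith

/-- Nontangential convergence to zero almost everywhere implies convergence to zero along almost
every vertical line. -/
theorem ae_tendsto_vertical (H : IsGraphChart Ω Q ρ Λ e h) {R R₀ : ℝ}
    (hR : (1 + Λ) * R ≤ R₀) (hR₀ : R₀ ≤ ρ / 2) {E : Type*} [NormedAddCommGroup E]
    {f : Eucl n → E} (hf : VanishesNT Ω (surfaceBall Ω Q R₀) f) :
    ∀ᵐ z ∂volume.restrict (Metric.ball Q R),
      Tendsto (fun s : ℝ => f (foot e h z + s • e)) (𝓝[>] 0) (𝓝 0) := by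
  have hρ := H.pos
  -- The sets of boundary points with a quantified rate of nontangential convergence. They need not
  -- be measurable, but almost every point of an arbitrary set is a density point for outer measure.
  set F : ℕ → ℕ → Set (Eucl n) := fun k j => {P | P ∈ frontier Ω ∧ ∀ x ∈ approachRegion Ω P,
    dist x P < 1 / ((j : ℝ) + 1) → ‖f x‖ ≤ 1 / ((k : ℝ) + 1)} with hF
  have hdens : ∀ᵐ z ∂volume.restrict (Metric.ball Q R), ∀ k j, z ∈ foot e h ⁻¹' F k j →
      Tendsto (fun r => volume (foot e h ⁻¹' F k j ∩ Metric.closedBall z r) /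
        volume (Metric.closedBall z r)) (𝓝[>] 0) (𝓝 1) := by
    refine ae_restrict_of_ae (ae_all_iff.2 fun k => ae_all_iff.2 fun j => ?_)
    exact ae_imp_of_ae_restrict (Besicovitch.ae_tendsto_measure_inter_div volume _)
  filter_upwards [hdens, H.ae_foot hR (by linarith) hf,
    ae_restrict_mem Metric.isOpen_ball.measurableSet] with z hz1 hz2 hz3
  have hfz : foot e h z ∈ Metric.ball Q (ρ / 2) := by
    refine lt_of_le_of_lt (H.dist_foot_center_le z) (lt_of_lt_of_le ?_ (hR.trans hR₀))
    have := H.one_le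
    exact mul_lt_mul_of_pos_left hz3 (by linarith)
  have hffr : foot e h z ∈ frontier Ω :=
    (H.mem_frontier_iff (Metric.ball_subset_ball (by linarith) hfz)).2 (H.height_foot z)
  rw [Metric.tendsto_nhds]
  intro ε hε
  obtain ⟨k, hk⟩ := exists_nat_one_div_lt hε
  have hk0 : 0 < 1 / ((k : ℝ) + 1) := by positivity
  obtain ⟨δ, hδ, hδf⟩ := Metric.mem_nhdsWithin_iff.1 (Metric.tendsto_nhds.1 hz2 _ hk0)
  obtain ⟨j, hj⟩ := exists_nat_one_div_lt hδ
  have hmem : z ∈ foot e h ⁻¹' F k j := by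
    refine ⟨hffr, fun x hx hd => ?_⟩
    have := hδf ⟨Metric.mem_ball.2 (hd.trans hj), hx⟩
    have h1 : dist (f x) 0 < 1 / ((k : ℝ) + 1) := this
    rw [dist_zero_right] at h1
    exact h1.le
  have hj0 : 0 < 1 / ((j : ℝ) + 1) / 2 := by positivity
  filter_upwards [H.eventually_exists_mem_approachRegion (fun P hP => hP.1) hfz (hz1 k j hmem),
    Ioo_mem_nhdsGT hj0] with s hs hs'
  obtain ⟨P, hPF, hΓ, hd⟩ := hs
  have h1 := hPF.2 _ hΓ (hd.trans (by linarith [hs'.2]))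
  rw [dist_zero_right]
  exact h1.trans_lt hk

/-- The square of a function is integrable near the boundary if the nontangential maximal function
is square integrable: `|w x|²` is at most an average of the squared maximal function at the feet of
points `z` whose distance to `x` and whose height are comparable to the height of `x`. -/
theorem lintegral_sq_lt_top (H : IsGraphChart Ω Q ρ Λ e h) {R R₀ : ℝ}
    (hR : (1 + Λ) * ((1 + 3 * Λ) * R) ≤ R₀) (hR₀ : R₀ ≤ ρ / 2) {w : Eucl n → ℝ}
    (hw : ∫⁻ P in surfaceBall Ω Q R₀, ntMax Ω w P ^ 2 ∂(surfaceMeasure n) < ⊤) :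
    ∫⁻ x in tent Ω Q R, ‖w x‖ₑ ^ 2 < ⊤ := by
  have hΛ1 := H.one_le
  have hρ := H.pos
  rcases le_or_gt R 0 with hR0 | hR0
  · rw [tent, Metric.ball_eq_empty.2 hR0, empty_inter]; simp
  set N : Eucl n → ℝ≥0∞ := fun z => ntMax Ω w (foot e h z) ^ 2 with hN
  have hNm : Measurable N := ((measurable_ntMax Ω w).comp H.continuous_foot.measurable).pow_const 2
  have hfin := H.lintegral_foot_lt_top (R := (1 + 3 * Λ) * R) hR (by linarith)
    ((measurable_ntMax Ω w).pow_const 2) hw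
  set B' := Metric.ball Q ((1 + 3 * Λ) * R) with hB'
  set b := volume (Metric.ball (0 : Eucl n) 1) with hb
  have hb0 : b ≠ 0 := volume_unit_ball_pos.ne'
  have hbt : b ≠ ⊤ := volume_unit_ball_lt_top.ne
  set L : ℝ := Λ * (1 + Λ) with hL
  have hL1 : 2 ≤ L := by nlinarith
  have hL0 : 0 < L := by linarith
  set κ : ℝ≥0∞ := ENNReal.ofReal ((2 * L) ^ n) * b⁻¹ with hκ
  have hκt : κ ≠ ⊤ := ENNReal.mul_ne_top ENNReal.ofReal_ne_top (ENNReal.inv_ne_top.2 hb0)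
  -- the averaging kernel; its integral in `x` is bounded by a multiple of `N z`, uniformly in `z`
  set G : Eucl n → Eucl n → ℝ≥0∞ := fun x z =>
    {p : Eucl n × Eucl n | dist p.1 p.2 < 8 * h p.2}.indicator
      (fun p => ENNReal.ofReal ((h p.2 ^ n)⁻¹) * N p.2) (x, z) with hG
  have hGm : Measurable (Function.uncurry G) := by
    refine Measurable.indicator ?_ ?_
    · exact (ENNReal.measurable_ofReal.comp
        ((H.continuous.measurable.comp measurable_snd).pow_const n).inv).mul
          (hNm.comp measurable_snd)
    · exact (isOpen_lt continuous_dist (continuous_const.mul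
        (H.continuous.comp continuous_snd))).measurableSet
  have hpt : ∀ x ∈ tent Ω Q R, ‖w x‖ₑ ^ 2 ≤ κ * ∫⁻ z in B', G x z := by
    rintro x ⟨hxB, hxΩ⟩
    have hRρ : (1 + Λ) * R ≤ ρ / 2 := by nlinarith
    have hxB2 : x ∈ Metric.ball Q (ρ / 2) := Metric.ball_subset_ball (by nlinarith) hxB
    have hx0 : 0 < h x := (H.mem_iff x (Metric.ball_subset_ball (by linarith) hxB2)).1 hxΩ
    have hxd : dist x Q < R := hxB
    have hfx : foot e h x ∈ Metric.ball Q ρ := by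
      refine lt_of_le_of_lt (H.dist_foot_center_le x) ?_
      have : (1 + Λ) * dist x Q < (1 + Λ) * R := mul_lt_mul_of_pos_left hxd (by linarith)
      linarith
    have hhxR : h x ≤ Λ * R := (le_abs_self _).trans ((H.abs_height_le x).trans
      (mul_le_mul_of_nonneg_left hxd.le (by linarith)))
    obtain ⟨y, hy1, hyf, hy3⟩ := H.exists_ball_subset hxB2 hfx hx0
    set δ := h x / L with hδ
    have hδ0 : 0 < δ := by positivity
    have hδL : δ * L = h x := div_mul_cancel₀ _ hL0.ne'
    -- the points of `B` have feet `P` with `x ∈ Γ(P)`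
    set B := Metric.ball (y + h x • e) δ with hB
    have hzx : ∀ z ∈ B, dist x z < 3 * h x := by
      intro z hz
      have h1 : dist (y + h x • e) x = dist y (foot e h x) := by
        rw [dist_eq_norm, dist_eq_norm, foot]; congr 1; abel
      have h2 := dist_triangle z (y + h x • e) x
      have h3 : dist z (y + h x • e) < δ := hz
      rw [dist_comm x z]
      nlinarith
    have hhz : ∀ z ∈ B, h x / 2 ≤ h z ∧ h z ≤ 2 * h x := by
      intro z hz
      have h1 := H.lipschitz z (y + h x • e)
      have h3 : dist z (y + h x • e) < δ := hz
      have hyh : h (y + h x • e) = h x := by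
        have hy0 : h y = 0 := by
          have hyB : y ∈ Metric.ball Q ρ := by
            have h5 := dist_triangle y (foot e h x) Q
            have h6 := H.dist_foot_center_le x
            rw [Metric.mem_ball]
            nlinarith
          exact (H.mem_frontier_iff hyB).1 hyf
        rw [H.add_smul, hy0, zero_add]
      rw [hyh] at h1
      have h4 : Λ * dist z (y + h x • e) ≤ h x / 2 := by
        have : Λ * dist z (y + h x • e) ≤ Λ * δ := mul_le_mul_of_nonneg_left h3.le (by linarith)
        have h7 : 2 * (Λ * δ) ≤ h x := by rw [← hδL, hL]; nlinarith [mul_pos (zero_lt_one.trans_le hΛ1) hδ0]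
        linarith
      have := abs_le.1 (h1.trans h4)
      constructor <;> linarith [this.1, this.2]
    have hBB' : B ⊆ B' := by
      intro z hz
      have h1 := hzx z hz
      have h2 := dist_triangle z x Q
      rw [dist_comm z x] at h2
      rw [hB', Metric.mem_ball]
      linarith
    have hGB : ∀ z ∈ B, ENNReal.ofReal (((2 * h x) ^ n)⁻¹) * ‖w x‖ₑ ^ 2 ≤ G x z := by
      intro z hz
      obtain ⟨hz1, hz2⟩ := hhz z hz
      have hz0 : 0 < h z := by linarith
      have hmem : (x, z) ∈ {p : Eucl n × Eucl n | dist p.1 p.2 < 8 * h p.2} := by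
        have := hzx z hz
        change dist x z < 8 * h z
        linarith
      rw [hG]
      simp only [indicator_of_mem hmem]
      refine mul_le_mul' (ENNReal.ofReal_le_ofReal ?_) ?_
      · exact inv_anti₀ (by positivity) (pow_le_pow_left₀ hz0.le hz2 n)
      · rw [hN]
        refine pow_le_pow_left₀ (zero_le) ?_ 2
        have hfoot : foot e h (z + (-h x) • e) = foot e h z := H.foot_add_smul z _
        have hΓ : x ∈ approachRegion Ω (foot e h z) := by
          rw [← hfoot]
          refine hy3 _ ?_ ?_
          · have : dist (z + (-h x) • e) y = dist z (y + h x • e) := by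
              rw [dist_eq_norm, dist_eq_norm]; congr 1; module
            rw [this]; exact hz
          · rw [hfoot]
            refine (H.mem_frontier_iff ?_).2 (H.height_foot z)
            have h1 : dist z Q < (1 + 3 * Λ) * R := hBB' hz
            refine lt_of_le_of_lt (H.dist_foot_center_le z) ?_
            have : (1 + Λ) * dist z Q < (1 + Λ) * ((1 + 3 * Λ) * R) :=
              mul_lt_mul_of_pos_left h1 (by linarith)
            linarith
        exact le_iSup₂ (f := fun x (_ : x ∈ approachRegion Ω (foot e h z)) => ‖w x‖ₑ) x hΓ
    have hint : ENNReal.ofReal (((2 * h x) ^ n)⁻¹) * ‖w x‖ₑ ^ 2 * volume B ≤ ∫⁻ z in B', G x z := by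
      rw [← setLIntegral_const]
      exact (setLIntegral_mono' Metric.isOpen_ball.measurableSet hGB).trans (lintegral_mono_set hBB')
    have hconst : κ * (ENNReal.ofReal (((2 * h x) ^ n)⁻¹) * volume B) = 1 := by
      rw [hB, volume_ball_eq _ hδ0, hκ]
      calc _ = (ENNReal.ofReal ((2 * L) ^ n) * ENNReal.ofReal (((2 * h x) ^ n)⁻¹) *
            ENNReal.ofReal (δ ^ n)) * (b⁻¹ * b) := by ring
        _ = 1 := by
          rw [ENNReal.inv_mul_cancel hb0 hbt, mul_one, ← ENNReal.ofReal_mul (by positivity),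
            ← ENNReal.ofReal_mul (by positivity), ← inv_pow, ← mul_pow, ← mul_pow]
          rw [show 2 * L * (2 * h x)⁻¹ * δ = 1 by rw [hδ]; field_simp, one_pow, ENNReal.ofReal_one]
    calc ‖w x‖ₑ ^ 2 = κ * (ENNReal.ofReal (((2 * h x) ^ n)⁻¹) * volume B) * ‖w x‖ₑ ^ 2 := by
          rw [hconst, one_mul]
      _ = κ * (ENNReal.ofReal (((2 * h x) ^ n)⁻¹) * ‖w x‖ₑ ^ 2 * volume B) := by ring
      _ ≤ _ := by gcongr
  have htm : MeasurableSet (tent Ω Q R) :=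
    Metric.isOpen_ball.measurableSet.inter H.isOpen.measurableSet
  have hinner : ∀ z, ∫⁻ x, G x z ≤ ENNReal.ofReal (8 ^ n) * b * N z := by
    intro z
    rcases le_or_gt (h z) 0 with hz | hz
    · have : ∀ x, G x z = 0 := fun x => indicator_of_notMem (fun hx => by
        have h1 : dist x z < 8 * h z := hx
        linarith [dist_nonneg (x := x) (y := z)]) _
      simp [this]
    · have h1 : ∀ x, G x z = (Metric.ball z (8 * h z)).indicator
          (fun _ => ENNReal.ofReal ((h z ^ n)⁻¹) * N z) x := by
        intro x
        by_cases hx : dist x z < 8 * h z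
        · rw [indicator_of_mem (show x ∈ Metric.ball z (8 * h z) from hx)]
          exact indicator_of_mem (s := {p : Eucl n × Eucl n | dist p.1 p.2 < 8 * h p.2})
            (a := (x, z)) hx _
        · rw [indicator_of_notMem (show x ∉ Metric.ball z (8 * h z) from hx)]
          exact indicator_of_notMem (s := {p : Eucl n × Eucl n | dist p.1 p.2 < 8 * h p.2})
            (a := (x, z)) hx _
      simp only [h1]
      rw [lintegral_indicator_const Metric.isOpen_ball.measurableSet, volume_ball_eq _ (by positivity)]
      refine le_of_eq ?_
      calc _ = (ENNReal.ofReal ((h z ^ n)⁻¹) * ENNReal.ofReal ((8 * h z) ^ n)) * b * N z := by ring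
        _ = _ := by
          rw [← ENNReal.ofReal_mul (by positivity), mul_pow]
          congr 3
          field_simp
  calc ∫⁻ x in tent Ω Q R, ‖w x‖ₑ ^ 2 ≤ ∫⁻ x in tent Ω Q R, κ * ∫⁻ z in B', G x z :=
        setLIntegral_mono' htm hpt
    _ ≤ ∫⁻ x, κ * ∫⁻ z in B', G x z := setLIntegral_le_lintegral _ _
    _ = κ * ∫⁻ z in B', ∫⁻ x, G x z := by
        rw [lintegral_const_mul' _ _ hκt, lintegral_lintegral_swap hGm.aemeasurable]
    _ ≤ κ * ∫⁻ z in B', ENNReal.ofReal (8 ^ n) * b * N z := by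
        gcongr with z
        exact hinner z
    _ = κ * (ENNReal.ofReal (8 ^ n) * b * ∫⁻ z in B', N z) := by
        rw [lintegral_const_mul _ hNm]
    _ < ⊤ := ENNReal.mul_lt_top hκt.lt_top (ENNReal.mul_lt_top
        (ENNReal.mul_lt_top ENNReal.ofReal_lt_top hbt.lt_top) hfin)

end IsGraphChart
end Nontangential

/-! ### Hardy's inequality -/

section Hardy

variable {n m : ℕ}

theorem lintegral_sq_le_mul_measure {X : Type*} [MeasurableSpace X] {μ : Measure X} {g : X → ℝ≥0∞}
    (hg : AEMeasurable g μ) : (∫⁻ t, g t ∂μ) ^ 2 ≤ μ univ * ∫⁻ t, g t ^ 2 ∂μ := by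
  have h1 := ENNReal.lintegral_mul_le_Lp_mul_Lq μ Real.HolderConjugate.two_two hg
    (aemeasurable_const (b := (1 : ℝ≥0∞)))
  simp only [Pi.mul_apply, mul_one, lintegral_const, ENNReal.rpow_two, one_pow, one_mul] at h1
  have hsq : ∀ x : ℝ≥0∞, (x ^ (1 / 2 : ℝ)) ^ 2 = x := fun x => by
    rw [← ENNReal.rpow_two, ← ENNReal.rpow_mul]; norm_num
  calc (∫⁻ t, g t ∂μ) ^ 2 ≤ ((∫⁻ t, g t ^ 2 ∂μ) ^ (1 / 2 : ℝ) * μ univ ^ (1 / 2 : ℝ)) ^ 2 :=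
        pow_le_pow_left₀ (zero_le) h1 2
    _ = _ := by rw [mul_pow, hsq, hsq, mul_comm]

namespace IsGraphChart

variable {Ω : Set (Eucl n)} {Q e : Eucl n} {ρ Λ : ℝ} {h : Eucl n → ℝ}

theorem sub_smul_mem (H : IsGraphChart Ω Q ρ Λ e h) {R : ℝ} (hR : (1 + Λ) * R ≤ ρ) {x : Eucl n}
    (hx : x ∈ Metric.ball Q R) {t : ℝ} (ht0 : 0 ≤ t) (ht : t < h x) : x - t • e ∈ Ω := by
  have hΛ := H.one_le
  have hx' : dist x Q < R := hx
  have hR0 : 0 < R := dist_nonneg.trans_lt hx'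
  have hfx : foot e h x ∈ Metric.ball Q ρ :=
    lt_of_le_of_lt (H.dist_foot_center_le x) (lt_of_lt_of_le
      (mul_lt_mul_of_pos_left hx' (by linarith)) hR)
  have hxρ : x ∈ Metric.ball Q ρ := Metric.ball_subset_ball (by nlinarith) hx
  have hh0 : 0 < h x := ht0.trans_lt ht
  refine (H.mem_iff _ ?_).2 ?_
  · have hseg : x - t • e = (1 - t / h x) • x + (t / h x) • foot e h x := by
      rw [foot, smul_sub, smul_smul, div_mul_cancel₀ _ hh0.ne']; module
    rw [hseg]
    have h1 : t / h x ≤ 1 := (div_le_one hh0).2 ht.le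
    exact (convex_ball Q ρ) hxρ hfx (by linarith) (by positivity) (by ring)
  · have : x - t • e = x + (-t) • e := by module
    rw [this, H.add_smul]; linarith

/-- A function that tends to zero at the foot of the vertical line through `x` is controlled by the
integral of its vertical derivative. -/
theorem enorm_le_lintegral_vertical (H : IsGraphChart Ω Q ρ Λ e h) {R : ℝ}
    (hR : (1 + Λ) * R ≤ ρ) {f : Eucl n → Eucl m} (hf : ContDiffOn ℝ 1 f Ω) {x : Eucl n}
    (hx : x ∈ Metric.ball Q R) (hh0 : 0 < h x)
    (hlim : Tendsto (fun s : ℝ => f (foot e h x + s • e)) (𝓝[>] 0) (𝓝 0)) :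
    ‖f x‖ₑ ^ 2 ≤ ENNReal.ofReal (h x) *
      ∫⁻ t in Ioo 0 (h x), ‖fderiv ℝ f (x - t • e) e‖ₑ ^ 2 := by
  have hline : ContinuousOn (fun t : ℝ => fderiv ℝ f (x - t • e) e) (Ico 0 (h x)) := by
    have h1 : ContinuousOn (fun y => fderiv ℝ f y) Ω := hf.continuousOn_fderiv_of_isOpen H.isOpen le_rfl
    have h2 : ContinuousOn (fun t : ℝ => fderiv ℝ f (x - t • e)) (Ico 0 (h x)) :=
      h1.comp (by fun_prop) fun t ht => H.sub_smul_mem hR hx ht.1 ht.2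
    exact h2.clm_apply continuousOn_const
  have hbound : ∀ s ∈ Ioo 0 (h x), ‖f x‖ₑ ≤ ‖f (foot e h x + s • e)‖ₑ +
      ∫⁻ t in Ioo 0 (h x), ‖fderiv ℝ f (x - t • e) e‖ₑ := by
    rintro s ⟨hs0, hs1⟩
    have hpt : foot e h x + s • e = x - (h x - s) • e := by rw [foot]; module
    set T := h x - s with hT
    have hT0 : 0 < T := by linarith
    have hTx : T < h x := by linarith
    have hsub : uIcc 0 T ⊆ Ico 0 (h x) := by
      rw [uIcc_of_le hT0.le]; exact fun t ht => ⟨ht.1, ht.2.trans_lt hTx⟩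
    have hderiv : ∀ t ∈ uIcc 0 T, HasDerivAt (fun t : ℝ => f (x - t • e))
        (-(fderiv ℝ f (x - t • e) e)) t := by
      intro t ht
      have hmem := H.sub_smul_mem hR hx (hsub ht).1 (hsub ht).2
      have h1 := ((hf.differentiableOn one_ne_zero).differentiableAt (H.isOpen.mem_nhds hmem)).hasFDerivAt
      have h2 : HasDerivAt (fun t : ℝ => x - t • e) (-e) t := by
        simpa using ((hasDerivAt_id t).smul_const e).const_sub x
      have h3 := h1.comp_hasDerivAt t h2
      rw [map_neg] at h3
      exact h3
    have hftc := intervalIntegral.integral_eq_sub_of_hasDerivAt hderiv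
      ((hline.mono hsub).neg.intervalIntegrable)
    have h3 : f x = f (x - T • e) + ∫ t in (0 : ℝ)..T, fderiv ℝ f (x - t • e) e := by
      rw [intervalIntegral.integral_neg] at hftc
      simp only [zero_smul, sub_zero] at hftc
      have := neg_eq_iff_eq_neg.1 hftc
      rw [this]; abel
    rw [hpt]
    calc ‖f x‖ₑ ≤ ‖f (x - T • e)‖ₑ + ‖∫ t in (0 : ℝ)..T, fderiv ℝ f (x - t • e) e‖ₑ := by
          conv_lhs => rw [h3]
          exact enorm_add_le _ _
      _ ≤ _ := by
          gcongr
          rw [intervalIntegral.integral_of_le hT0.le]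
          refine (enorm_integral_le_lintegral_enorm _).trans (lintegral_mono_set ?_)
          exact fun t ht => ⟨ht.1, ht.2.trans_lt hTx⟩
  have hle : ‖f x‖ₑ ≤ ∫⁻ t in Ioo 0 (h x), ‖fderiv ℝ f (x - t • e) e‖ₑ := by
    have h1 : Tendsto (fun s : ℝ => ‖f (foot e h x + s • e)‖ₑ +
        ∫⁻ t in Ioo 0 (h x), ‖fderiv ℝ f (x - t • e) e‖ₑ) (𝓝[>] 0)
        (𝓝 (0 + ∫⁻ t in Ioo 0 (h x), ‖fderiv ℝ f (x - t • e) e‖ₑ)) := by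
      refine Tendsto.add ?_ tendsto_const_nhds
      simpa using hlim.enorm
    rw [zero_add] at h1
    refine ge_of_tendsto h1 ?_
    filter_upwards [Ioo_mem_nhdsGT hh0] with s hs using hbound s hs
  calc ‖f x‖ₑ ^ 2 ≤ (∫⁻ t in Ioo 0 (h x), ‖fderiv ℝ f (x - t • e) e‖ₑ) ^ 2 :=
        pow_le_pow_left₀ (zero_le) hle 2
    _ ≤ _ := by
        refine (lintegral_sq_le_mul_measure ?_).trans (le_of_eq ?_)
        · exact ((hline.mono Ioo_subset_Ico_self).aestronglyMeasurable measurableSet_Ioo).enorm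
        · rw [Measure.restrict_apply_univ, Real.volume_Ioo, sub_zero]

/-- Hardy's inequality in a strip: integrate the one-dimensional bound over the strip and
interchange the order of integration; for fixed `t` the points `x - t e` are a translate. -/
theorem lintegral_strip_le (H : IsGraphChart Ω Q ρ Λ e h) {R ε : ℝ} (hR : (1 + Λ) * R ≤ ρ)
    {f : Eucl n → Eucl m} (hf : ContDiffOn ℝ 1 f Ω)
    (hlim : ∀ᵐ z ∂volume.restrict (Metric.ball Q R),
      Tendsto (fun s : ℝ => f (foot e h z + s • e)) (𝓝[>] 0) (𝓝 0)) :
    ∫⁻ x in tent Ω Q R ∩ {x | h x < ε}, ‖f x‖ₑ ^ 2 ≤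
      ENNReal.ofReal ε ^ 2 * ∫⁻ x in tent Ω Q (R + ε) ∩ {x | h x < ε}, ‖fderiv ℝ f x e‖ₑ ^ 2 := by
  have hΛ := H.one_le
  set A := tent Ω Q R ∩ {x | h x < ε} with hA
  set A' := tent Ω Q (R + ε) ∩ {x | h x < ε} with hA'
  have hlt : MeasurableSet {x | h x < ε} := (isOpen_lt H.continuous continuous_const).measurableSet
  have hAm : MeasurableSet A :=
    (Metric.isOpen_ball.measurableSet.inter H.isOpen.measurableSet).inter hlt
  have hA'm : MeasurableSet A' :=
    (Metric.isOpen_ball.measurableSet.inter H.isOpen.measurableSet).inter hlt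
  set W : Eucl n → ℝ≥0∞ := A'.indicator fun x => ‖fderiv ℝ f x e‖ₑ ^ 2 with hW
  have hWm : Measurable W :=
    (((measurable_fderiv_apply_const ℝ f e).enorm).pow_const 2).indicator hA'm
  have hAB : A ⊆ Metric.ball Q R := fun x hx => hx.1.1
  have hpt : ∀ᵐ x ∂volume.restrict A,
      ‖f x‖ₑ ^ 2 ≤ ENNReal.ofReal ε * ∫⁻ t in Ioo 0 ε, W (x - t • e) := by
    filter_upwards [ae_restrict_of_ae_restrict_of_subset hAB hlim, ae_restrict_mem hAm] with x hx hxA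
    obtain ⟨⟨hxB, hxΩ⟩, hxε⟩ := hxA
    have hxε : h x < ε := hxε
    have hxR : dist x Q < R := hxB
    have hxρ : x ∈ Metric.ball Q ρ := by
      have hR0 : 0 < R := dist_nonneg.trans_lt hxR
      exact Metric.ball_subset_ball (by nlinarith) hxB
    have hh0 : 0 < h x := (H.mem_iff x hxρ).1 hxΩ
    refine (H.enorm_le_lintegral_vertical hR hf hxB hh0 hx).trans ?_
    gcongr ?_ * ?_
    · exact ENNReal.ofReal_le_ofReal hxε.le
    · refine (setLIntegral_mono' measurableSet_Ioo fun t ht => ?_).trans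
        (lintegral_mono_set (Ioo_subset_Ioo_right hxε.le))
      have hmem : x - t • e ∈ A' := by
        refine ⟨⟨?_, H.sub_smul_mem hR hxB ht.1.le ht.2⟩, ?_⟩
        · rw [Metric.mem_ball]
          have h1 := dist_triangle (x - t • e) x Q
          have h2 : dist (x - t • e) x = t := by
            rw [dist_eq_norm, sub_sub_cancel_left, norm_neg, norm_smul, H.norm_eq, mul_one,
              Real.norm_of_nonneg ht.1.le]
          linarith [ht.2]
        · have h1 : x - t • e = x + (-t) • e := by module
          change h (x - t • e) < ε
          rw [h1, H.add_smul]; linarith [ht.1]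
      rw [hW, indicator_of_mem hmem]
  have hWm2 : Measurable (Function.uncurry fun (x : Eucl n) (t : ℝ) => W (x - t • e)) :=
    hWm.comp (by fun_prop : Continuous fun p : Eucl n × ℝ => p.1 - p.2 • e).measurable
  calc ∫⁻ x in A, ‖f x‖ₑ ^ 2 ≤ ∫⁻ x in A, ENNReal.ofReal ε * ∫⁻ t in Ioo 0 ε, W (x - t • e) :=
        lintegral_mono_ae hpt
    _ ≤ ∫⁻ x, ENNReal.ofReal ε * ∫⁻ t in Ioo 0 ε, W (x - t • e) := setLIntegral_le_lintegral _ _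
    _ = ENNReal.ofReal ε * ∫⁻ t in Ioo 0 ε, ∫⁻ x, W (x - t • e) := by
        rw [lintegral_const_mul' _ _ ENNReal.ofReal_ne_top, lintegral_lintegral_swap hWm2.aemeasurable]
    _ = ENNReal.ofReal ε * ∫⁻ t in Ioo 0 ε, ∫⁻ x, W x := by
        congr 1
        exact lintegral_congr fun t => lintegral_sub_right_eq_self W (t • e)
    _ = _ := by
        rw [setLIntegral_const, Real.volume_Ioo, sub_zero, hW, lintegral_indicator hA'm]
        ring

end IsGraphChart

theorem fderiv_multiD_apply_le {Ω : Set (Eucl n)} (hΩ : IsOpen Ω) {N : ℕ} {u : Eucl n → Eucl m}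
    (hu : ContDiffOn ℝ N u Ω) {e : Eucl n} (he : ‖e‖ = 1) {α : Fin n → ℕ}
    (hα : ∑ i, α i + 1 ≤ N) {x : Eucl n} (hx : x ∈ Ω) :
    ‖fderiv ℝ (multiD α u) x e‖ ≤ derivSum (∑ i, α i + 1) u x := by
  have h1 : e = ∑ i, e i • EuclideanSpace.single i (1 : ℝ) := by
    ext j
    simp [Finset.sum_apply, Pi.single_apply]
  have h2 : ∀ i, |e i| ≤ 1 := fun i => by
    have := PiLp.norm_apply_le e i
    rwa [he, Real.norm_eq_abs] at this
  calc ‖fderiv ℝ (multiD α u) x e‖ = ‖∑ i, e i • multiD (α + Pi.single i 1) u x‖ := by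
        conv_lhs => rw [h1]
        rw [map_sum]
        congr 1
        refine Finset.sum_congr rfl fun i _ => ?_
        rw [map_smul]
        congr 1
        exact partialD_multiD hΩ hu α i hα hx
    _ ≤ ∑ i, ‖multiD (α + Pi.single i 1) u x‖ := by
        refine (norm_sum_le _ _).trans (Finset.sum_le_sum fun i _ => ?_)
        rw [norm_smul, Real.norm_eq_abs]
        exact mul_le_of_le_one_left (norm_nonneg _) (h2 i)
    _ = ∑ β ∈ Finset.univ.image fun i => α + Pi.single i 1, ‖multiD β u x‖ := by
        rw [Finset.sum_image]
        intro i _ j _ hij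
        have h3 : (Pi.single i 1 : Fin n → ℕ) = Pi.single j 1 := add_left_cancel hij
        by_contra hne
        have h4 := congrFun h3 i
        simp [hne] at h4
    _ ≤ _ := by
        refine Finset.sum_le_sum_of_subset_of_nonneg ?_ fun _ _ _ => norm_nonneg _
        intro β hβ
        obtain ⟨i, -, rfl⟩ := Finset.mem_image.1 hβ
        rw [mem_multiIndices]
        simp [Finset.sum_add_distrib]

theorem enorm_derivSum_sq_le (k : ℕ) (u : Eucl n → Eucl m) (x : Eucl n) :
    ‖derivSum k u x‖ₑ ^ 2 ≤
      (multiIndices n k).card * ∑ α ∈ multiIndices n k, ‖multiD α u x‖ₑ ^ 2 := by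
  simp only [enorm_sq_eq_ofReal]
  rw [← ENNReal.ofReal_sum_of_nonneg fun _ _ => sq_nonneg _, ← ENNReal.ofReal_natCast,
    ← ENNReal.ofReal_mul (Nat.cast_nonneg _), Real.norm_eq_abs, sq_abs]
  exact ENNReal.ofReal_le_ofReal sq_sum_le_card_mul_sum_sq

theorem lintegral_derivSum_sq_le {Ω A : Set (Eucl n)} (hΩ : IsOpen Ω) (hA : MeasurableSet A)
    (hAΩ : A ⊆ Ω) {N k : ℕ} {u : Eucl n → Eucl m} (hu : ContDiffOn ℝ N u Ω) (hk : k ≤ N) :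
    ∫⁻ x in A, ‖derivSum k u x‖ₑ ^ 2 ≤
      (multiIndices n k).card * ∑ α ∈ multiIndices n k, ∫⁻ x in A, ‖multiD α u x‖ₑ ^ 2 := by
  refine (lintegral_mono fun x => enorm_derivSum_sq_le k u x).trans ?_
  rw [lintegral_const_mul' _ _ (by simp), lintegral_finsetSum']
  intro α hα
  have h1 : ContinuousOn (multiD α u) Ω :=
    (hu.multiD hΩ α (k := 0) (by rw [mem_multiIndices.1 hα]; omega)).continuousOn
  exact ((h1.mono hAΩ).aestronglyMeasurable hA).enorm.pow_const 2

namespace IsGraphChart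

variable {Ω : Set (Eucl n)} {Q e : Eucl n} {ρ Λ : ℝ} {h : Eucl n → ℝ}

theorem lintegral_strip_derivSum_le (H : IsGraphChart Ω Q ρ Λ e h) {R ε : ℝ} (hR : (1 + Λ) * R ≤ ρ)
    {k N : ℕ} (hk : k + 1 ≤ N) {u : Eucl n → Eucl m} (hu : ContDiffOn ℝ N u Ω)
    (hlim : ∀ α : Fin n → ℕ, ∑ i, α i = k → ∀ᵐ z ∂volume.restrict (Metric.ball Q R),
      Tendsto (fun s : ℝ => multiD α u (foot e h z + s • e)) (𝓝[>] 0) (𝓝 0)) :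
    ∫⁻ x in tent Ω Q R ∩ {x | h x < ε}, ‖derivSum k u x‖ₑ ^ 2 ≤
      (multiIndices n k).card ^ 2 * ENNReal.ofReal ε ^ 2 *
        ∫⁻ x in tent Ω Q (R + ε) ∩ {x | h x < ε}, ‖derivSum (k + 1) u x‖ₑ ^ 2 := by
  have hm : ∀ r, MeasurableSet (tent Ω Q r ∩ {x | h x < ε}) := fun r =>
    (Metric.isOpen_ball.measurableSet.inter H.isOpen.measurableSet).inter
      (isOpen_lt H.continuous continuous_const).measurableSet
  refine (lintegral_derivSum_sq_le H.isOpen (hm R) (fun x hx => hx.1.2) hu (by omega)).trans ?_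
  calc _ ≤ ((multiIndices n k).card : ℝ≥0∞) * ∑ _α ∈ multiIndices n k, ENNReal.ofReal ε ^ 2 *
        ∫⁻ x in tent Ω Q (R + ε) ∩ {x | h x < ε}, ‖derivSum (k + 1) u x‖ₑ ^ 2 := by
        gcongr with α hα
        have hαk := mem_multiIndices.1 hα
        refine (H.lintegral_strip_le hR (hu.multiD H.isOpen α (k := 1) (by omega))
          (hlim α hαk)).trans ?_
        refine mul_le_mul' le_rfl ?_
        refine setLIntegral_mono' (hm _) fun x hx => ?_
        rw [enorm_sq_eq_ofReal, enorm_sq_eq_ofReal, Real.norm_of_nonneg (derivSum_nonneg _ _ _)]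
        refine ENNReal.ofReal_le_ofReal (pow_le_pow_left₀ (norm_nonneg _) ?_ 2)
        rw [← hαk]
        exact fderiv_multiD_apply_le H.isOpen hu H.norm_eq (by omega) hx.1.2
    _ = _ := by rw [Finset.sum_const, nsmul_eq_mul]; ring

/-- The iterated Hardy inequality: in a strip of height `ε`, each further derivative gains a factor
`ε ^ 2`, at the expense of enlarging the radius by `ε`. -/
theorem exists_strip_bound (n N : ℕ) : ∃ D : ℝ≥0, ∀ {m : ℕ} {Ω : Set (Eucl n)} {Q e : Eucl n}
    {ρ Λ : ℝ} {h : Eucl n → ℝ}, IsGraphChart Ω Q ρ Λ e h → ∀ {R₁ ε : ℝ}, (1 + Λ) * R₁ ≤ ρ → 0 ≤ ε →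
    ∀ {u : Eucl n → Eucl m}, ContDiffOn ℝ N u Ω →
    (∀ α : Fin n → ℕ, ∑ i, α i < N → ∀ᵐ z ∂volume.restrict (Metric.ball Q R₁),
      Tendsto (fun s : ℝ => multiD α u (foot e h z + s • e)) (𝓝[>] 0) (𝓝 0)) →
    ∀ (j k : ℕ) (R : ℝ), k + j ≤ N → R + j * ε ≤ R₁ →
    ∫⁻ x in tent Ω Q R ∩ {x | h x < ε}, ‖derivSum k u x‖ₑ ^ 2 ≤ D ^ j * ENNReal.ofReal ε ^ (2 * j) *
      ∫⁻ x in tent Ω Q (R + j * ε) ∩ {x | h x < ε}, ‖derivSum (k + j) u x‖ₑ ^ 2 := by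
  set D : ℝ≥0 := ∑ k ∈ Finset.range N, ((multiIndices n k).card : ℝ≥0) ^ 2 with hD
  refine ⟨D, fun {m Ω Q e ρ Λ h} H {R₁ ε} hR₁ hε {u} hu hlim j => ?_⟩
  induction j with
  | zero => intro k R _ _; simp
  | succ j ih =>
    intro k R hkj hRj
    have hjε : 0 ≤ j * ε := by positivity
    push_cast at hRj
    have hRR : R ≤ R₁ := by linarith
    have hΛ := H.one_le
    have h1 := H.lintegral_strip_derivSum_le (R := R) (ε := ε) (k := k) (N := N)
      (le_trans (mul_le_mul_of_nonneg_left hRR (by linarith)) hR₁) (by omega) hu fun α hα =>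
        ae_restrict_of_ae_restrict_of_subset (Metric.ball_subset_ball hRR) (hlim α (by omega))
    have h2 := ih (k + 1) (R + ε) (by omega) (by linarith)
    have hcard : ((multiIndices n k).card : ℝ≥0∞) ^ 2 ≤ D := by
      have : ((multiIndices n k).card : ℝ≥0) ^ 2 ≤ D :=
        Finset.single_le_sum (f := fun k => ((multiIndices n k).card : ℝ≥0) ^ 2)
          (fun _ _ => zero_le) (Finset.mem_range.2 (by omega))
      exact_mod_cast this
    calc _ ≤ _ := h1
      _ ≤ _ := mul_le_mul' (mul_le_mul' hcard le_rfl) h2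
      _ = _ := by
        rw [show R + ((j + 1 : ℕ) : ℝ) * ε = R + ε + j * ε by push_cast; ring,
          show k + (j + 1) = k + 1 + j by ring]
        ring

end IsGraphChart
end Hardy

/-! ### Mollification and cutoff functions -/

section Mollification

open scoped Convolution
open ContinuousLinearMap (lsmul)

variable {n : ℕ} {F : Type*} [NormedAddCommGroup F] [NormedSpace ℝ F]

theorem HasCompactSupport.partialD {f : Eucl n → F} (hf : HasCompactSupport f) (i : Fin n) :
    HasCompactSupport (partialD i f) :=
  hf.fderiv_apply (𝕜 := ℝ) _

theorem partialD_convolution {f : Eucl n → ℝ} (hf : LocallyIntegrable f) {g : Eucl n → F}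
    (hgc : HasCompactSupport g) (hg : ContDiff ℝ 1 g) (i : Fin n) :
    partialD i (f ⋆[lsmul ℝ ℝ, volume] g) = f ⋆[lsmul ℝ ℝ, volume] partialD i g := by
  funext x
  rw [partialD, (hgc.hasFDerivAt_convolution_right (lsmul ℝ ℝ) hf hg x).fderiv,
    convolution_precompR_apply _ hf (hgc.fderiv ℝ) (hg.continuous_fderiv one_ne_zero)]
  rfl

/-- Derivatives of a convolution fall on the smooth factor. -/
theorem multiD_convolution {f : Eucl n → ℝ} (hf : LocallyIntegrable f) {g : Eucl n → F}
    (hgc : HasCompactSupport g) {N : ℕ} (hg : ContDiff ℝ N g) (α : Fin n → ℕ)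
    (hα : ∑ i, α i ≤ N) :
    multiD α (f ⋆[lsmul ℝ ℝ, volume] g) = f ⋆[lsmul ℝ ℝ, volume] multiD α g := by
  simp only [multiD_eq_listD]
  rw [← length_coordList] at hα
  revert hα
  induction coordList α with
  | nil => intro _; rfl
  | cons i I ih =>
    intro hI
    have hc : HasCompactSupport (listD I g) := by
      clear hI ih
      induction I with
      | nil => exact hgc
      | cons j J ih => exact ih.partialD j
    have hd : ContDiff ℝ (1 : ℕ) (listD I g) := contDiffOn_univ.1
      ((contDiffOn_univ.2 hg).listD isOpen_univ I (k := 1) (by simp at hI; omega))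
    rw [listD_cons, ih (by simp at hI; omega), partialD_convolution hf hc (by exact_mod_cast hd) i]
    rfl

/-- Smooth cutoff functions for a measurable set `A` on the scale `r`, with bounds for the
derivatives that do not depend on `A`. -/
theorem exists_cutoff (n : ℕ) : ∃ C : ℕ → ℝ, (∀ j, 0 ≤ C j) ∧ ∀ A : Set (Eucl n), MeasurableSet A →
    ∀ r : ℝ, 0 < r → ∃ χ : Eucl n → ℝ, ContDiff ℝ ∞ χ ∧ (∀ x, χ x ∈ Icc 0 1) ∧
      (∀ x, Metric.ball x r ⊆ A → χ x = 1) ∧ (∀ x, Disjoint (Metric.ball x r) A → χ x = 0) ∧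
      ∀ j x, ‖iteratedFDeriv ℝ j χ x‖ ≤ C j * r⁻¹ ^ j := by
  let Φ : ContDiffBump (0 : Eucl n) := ⟨1 / 2, 1, by norm_num, by norm_num⟩
  set φ : Eucl n → ℝ := Φ.normed volume with hφ
  have hφs : ContDiff ℝ ∞ φ := Φ.contDiff_normed
  have hφc : HasCompactSupport φ := Φ.hasCompactSupport_normed
  have hφ0 : ∀ x, 0 ≤ φ x := Φ.nonneg_normed
  have hφ1 : ∫ x, φ x = 1 := Φ.integral_normed
  have hφi : Integrable φ := Φ.integrable_normed
  have hφsupp : ∀ x, 1 ≤ ‖x‖ → φ x = 0 := fun x hx => by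
    by_contra h
    have h1 : x ∈ Function.support φ := h
    rw [Φ.support_normed_eq, mem_ball_zero_iff] at h1
    exact absurd (lt_of_lt_of_le h1 hx) (lt_irrefl _)
  clear_value φ
  set c : (Fin n → ℕ) → ℝ := fun α => ∫ x, ‖multiD α φ x‖ with hc
  refine ⟨fun j => (n : ℝ) ^ j * ∑ α ∈ multiIndices n j, c α, fun j => mul_nonneg (by positivity)
    (Finset.sum_nonneg fun α _ => integral_nonneg fun _ => norm_nonneg _), fun A hA r hr => ?_⟩
  -- mollify the indicator function at unit scale and rescale
  set A' : Set (Eucl n) := (fun y => r • y) ⁻¹' A with hA'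
  have hA'm : MeasurableSet A' := hA.preimage (measurable_const_smul r)
  set f : Eucl n → ℝ := A'.indicator fun _ => 1 with hf
  have hfl : LocallyIntegrable f := (locallyIntegrable_const 1).indicator hA'm
  have hf0 : ∀ x, 0 ≤ f x := fun x => indicator_nonneg (fun _ _ => zero_le_one) x
  have hf1 : ∀ x, f x ≤ 1 := fun x => indicator_le_self' (fun _ _ => zero_le_one) x
  have hshift : ∀ x, ∫ t, φ (x - t) = 1 := fun x => by rw [integral_sub_left_eq_self, hφ1]
  set ψ : Eucl n → ℝ := f ⋆[lsmul ℝ ℝ, volume] φ with hψ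
  have hψx : ∀ x, ψ x = ∫ t, f t * φ (x - t) := fun x => rfl
  have hψs : ContDiff ℝ ∞ ψ := hφc.contDiff_convolution_right _ hfl hφs
  have hint : ∀ x, Integrable fun t => φ (x - t) := fun x => hφi.comp_sub_left x
  have hψ1 : ∀ x, ψ x ≤ 1 := fun x => by
    rw [hψx, ← hshift x]
    refine integral_mono_of_nonneg (ae_of_all _ fun t => mul_nonneg (hf0 t) (hφ0 _)) (hint x)
      (ae_of_all _ fun t => mul_le_of_le_one_left (hφ0 _) (hf1 t))
  have hψd : ∀ (α : Fin n → ℕ) x, ‖multiD α ψ x‖ ≤ c α := fun α x => by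
    rw [hψ, multiD_convolution hfl hφc (N := ∑ i, α i) (hφs.of_le (by exact_mod_cast le_top)) α le_rfl]
    have hi : Integrable (multiD α φ) :=
      (hφs.multiD α).continuous.integrable_of_hasCompactSupport (hφc.multiD α)
    have h1 : (f ⋆[lsmul ℝ ℝ, volume] multiD α φ) x = ∫ t, f t * multiD α φ (x - t) := rfl
    rw [h1, hc]
    calc ‖∫ t, f t * multiD α φ (x - t)‖ ≤ ∫ t, ‖multiD α φ (x - t)‖ := by
          refine norm_integral_le_of_norm_le (hi.norm.comp_sub_left x) (ae_of_all _ fun t => ?_)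
          rw [norm_mul, Real.norm_of_nonneg (hf0 t)]
          exact mul_le_of_le_one_left (norm_nonneg _) (hf1 t)
      _ = _ := integral_sub_left_eq_self (fun y => ‖multiD α φ y‖) volume x
  have hball : ∀ x t : Eucl n, ‖r⁻¹ • x - t‖ < 1 → r • t ∈ Metric.ball x r := fun x t ht => by
    have h1 : r • t - x = -(r • (r⁻¹ • x - t)) := by
      rw [smul_sub, smul_inv_smul₀ hr.ne']; abel
    rw [Metric.mem_ball, dist_eq_norm, h1, norm_neg, norm_smul, Real.norm_of_nonneg hr.le]
    nlinarith
  set χ : Eucl n → ℝ := fun x => ψ (0 + r⁻¹ • x) with hχ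
  have hχs : ContDiff ℝ ∞ χ := hψs.comp (contDiff_const.add (contDiff_const_smul _))
  refine ⟨χ, hχs, fun x => ⟨?_, hψ1 _⟩, fun x hx => ?_, fun x hx => ?_, fun j x => ?_⟩
  · rw [hχ]; simp only [hψx]
    exact integral_nonneg fun t => mul_nonneg (hf0 t) (hφ0 _)
  · rw [hχ]; simp only [hψx, zero_add]
    rw [← hshift (r⁻¹ • x)]
    refine integral_congr_ae (ae_of_all _ fun t => ?_)
    by_cases ht : ‖r⁻¹ • x - t‖ < 1
    · have : t ∈ A' := hx (hball x t ht)
      simp only [hf, indicator_of_mem this, one_mul]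
    · simp only [hφsupp _ (not_lt.1 ht), mul_zero]
  · rw [hχ]; simp only [hψx, zero_add]
    rw [← integral_zero (Eucl n) ℝ (μ := volume)]
    refine integral_congr_ae (ae_of_all _ fun t => ?_)
    by_cases ht : ‖r⁻¹ • x - t‖ < 1
    · have : t ∉ A' := fun h => Set.disjoint_left.1 hx (hball x t ht) h
      simp only [hf, indicator_of_notMem this, zero_mul]
    · simp only [hφsupp _ (not_lt.1 ht), mul_zero]
  · refine (norm_iteratedFDeriv_le_sum isOpen_univ (N := j)
      (contDiffOn_univ.2 (hχs.of_le (by exact_mod_cast le_top))) le_rfl (mem_univ x)).trans ?_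
    rw [mul_assoc, Finset.sum_mul]
    refine mul_le_mul_of_nonneg_left (Finset.sum_le_sum fun α hα => ?_) (by positivity)
    have hr' : 0 ≤ r⁻¹ ^ j := by positivity
    rw [hχ, multiD_comp_affine, mem_multiIndices.1 hα, norm_smul, mul_comm,
      Real.norm_of_nonneg hr']
    exact mul_le_mul_of_nonneg_right (hψd α _) hr'

/-- Mollification: a compactly supported `C^N` function is approximated uniformly, together with its
derivatives up to order `N`, by smooth functions supported in the same open set. -/
theorem exists_smooth_approx [CompleteSpace F] {Ω : Set (Eucl n)} (hΩ : IsOpen Ω) {N : ℕ} {w : Eucl n → F}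
    (hw : ContDiff ℝ N w) (hwc : HasCompactSupport w) (hwΩ : tsupport w ⊆ Ω) {η : ℝ} (hη : 0 < η) :
    ∃ v : Eucl n → F, ContDiff ℝ ∞ v ∧ HasCompactSupport v ∧ tsupport v ⊆ Ω ∧
      ∀ α : Fin n → ℕ, ∑ i, α i ≤ N → ∀ x, ‖multiD α v x - multiD α w x‖ ≤ η := by
  have hcont : ∀ α : Fin n → ℕ, ∑ i, α i ≤ N → Continuous (multiD α w) := fun α hα =>
    (contDiffOn_univ.1 ((contDiffOn_univ.2 hw).multiD isOpen_univ α (k := 0) (by omega))).continuous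
  obtain ⟨d, hd, hdΩ⟩ := hwc.isCompact.exists_cthickening_subset_open hΩ hwΩ
  have huc : ∃ δ : ℝ, 0 < δ ∧ ∀ α : Fin n → ℕ, ∑ i, α i ≤ N → ∀ x y, dist x y < δ →
      dist (multiD α w x) (multiD α w y) ≤ η := by
    set S := (Finset.range (N + 1)).biUnion fun k => multiIndices n k with hS
    have h1 : ∀ α : Fin n → ℕ, ∃ δ : ℝ, 0 < δ ∧ (∑ i, α i ≤ N → ∀ x y, dist x y < δ →
        dist (multiD α w x) (multiD α w y) ≤ η) := by
      intro α
      by_cases hα : ∑ i, α i ≤ N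
      · have h2 := (hwc.multiD α).uniformContinuous_of_continuous (hcont α hα)
        obtain ⟨δ, hδ, h3⟩ := Metric.uniformContinuous_iff.1 h2 η hη
        exact ⟨δ, hδ, fun _ x y hxy => (h3 hxy).le⟩
      · exact ⟨1, one_pos, fun h => absurd h hα⟩
    choose δ hδ h3 using h1
    have hSne : S.Nonempty := ⟨0, by
      rw [hS, Finset.mem_biUnion]
      exact ⟨0, by simp, mem_multiIndices.2 (by simp)⟩⟩
    refine ⟨S.inf' hSne δ, (Finset.lt_inf'_iff hSne).2 fun α _ => hδ α, fun α hα x y hxy => ?_⟩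
    refine h3 α hα x y (hxy.trans_le (Finset.inf'_le _ ?_))
    rw [hS, Finset.mem_biUnion]
    exact ⟨_, Finset.mem_range.2 (Nat.lt_succ_of_le hα), mem_multiIndices.2 rfl⟩
  obtain ⟨δ, hδ, hδw⟩ := huc
  set s := min d δ with hs
  have hs0 : 0 < s := lt_min hd hδ
  let Φ : ContDiffBump (0 : Eucl n) := ⟨s / 2, s, by positivity, by linarith⟩
  have hΦl : LocallyIntegrable (Φ.normed volume : Eucl n → ℝ) :=
    Φ.integrable_normed.locallyIntegrable
  refine ⟨(Φ.normed volume : Eucl n → ℝ) ⋆[lsmul ℝ ℝ, volume] w, ?_, ?_, ?_, fun α hα x => ?_⟩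
  · exact Φ.hasCompactSupport_normed.contDiff_convolution_left _ Φ.contDiff_normed
      hw.continuous.locallyIntegrable
  · exact Φ.hasCompactSupport_normed.convolution _ hwc
  · refine (closure_minimal ?_ (Metric.isClosed_cthickening (δ := d))).trans hdΩ
    refine (support_convolution_subset _).trans ?_
    rintro _ ⟨y, hy, z, hz, rfl⟩
    rw [Φ.support_normed_eq, mem_ball_zero_iff] at hy
    have hy' : ‖y‖ < s := hy
    refine Metric.mem_cthickening_of_dist_le _ z _ _ (subset_tsupport _ hz) ?_
    rw [dist_eq_norm, add_sub_cancel_right]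
    exact hy'.le.trans (min_le_left _ _)
  · rw [multiD_convolution hΦl hwc hw α hα, ← dist_eq_norm]
    refine Φ.dist_normed_convolution_le (hcont α hα).aestronglyMeasurable fun y hy => ?_
    exact hδw α hα y x (lt_of_lt_of_le hy (min_le_right _ _))

end Mollification

/-! ### Approximation by test functions -/

section Approximation

variable {n m : ℕ}

/-- A cutoff function at height `ε`. It is a mollification, since `h` itself is only Lipschitz. -/
theorem exists_height_cutoff (n : ℕ) : ∃ C : ℕ → ℝ, (∀ j, 0 ≤ C j) ∧ ∀ {Ω : Set (Eucl n)}
    {Q e : Eucl n} {ρ Λ : ℝ} {h : Eucl n → ℝ}, IsGraphChart Ω Q ρ Λ e h → ∀ ε : ℝ, 0 < ε →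
    ∃ χ : Eucl n → ℝ, ContDiff ℝ ∞ χ ∧ (∀ x, χ x ∈ Icc 0 1) ∧ (∀ x, ε ≤ h x → χ x = 1) ∧
      (∀ x, h x ≤ ε / 2 → χ x = 0) ∧
      ∀ j x, ‖iteratedFDeriv ℝ j χ x‖ ≤ C j * ((4 * Λ) ^ j * ε⁻¹ ^ j) := by
  obtain ⟨C, hC0, hC⟩ := exists_cutoff n
  refine ⟨C, hC0, fun {Ω Q e ρ Λ h} H ε hε => ?_⟩
  have hΛ : 0 < Λ := zero_lt_one.trans_le H.one_le
  have hr : 0 < ε / (4 * Λ) := by positivity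
  have hΛr : Λ * (ε / (4 * Λ)) = ε / 4 := by field_simp
  have hosc : ∀ x, ∀ y ∈ Metric.ball x (ε / (4 * Λ)), |h y - h x| < ε / 4 := fun x y hy => by
    rw [← hΛr]
    exact (H.lipschitz y x).trans_lt (mul_lt_mul_of_pos_left hy hΛ)
  obtain ⟨χ, hχs, hχ01, hχ1, hχ0, hχd⟩ := hC {x | 3 * ε / 4 < h x}
    (isOpen_lt continuous_const H.continuous).measurableSet _ hr
  refine ⟨χ, hχs, hχ01, fun x hx => hχ1 x fun y hy => ?_, fun x hx => hχ0 x ?_, fun j x => ?_⟩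
  · have := abs_lt.1 (hosc x y hy)
    change 3 * ε / 4 < h y
    linarith [this.1]
  · refine Set.disjoint_left.2 fun y hy hy' => ?_
    have h1 := abs_lt.1 (hosc x y hy)
    have h2 : 3 * ε / 4 < h y := hy'
    linarith [h1.2]
  · refine (hχd j x).trans (le_of_eq ?_)
    rw [← mul_pow, inv_div, div_eq_mul_inv]

theorem norm_multiD_cutoff_smul_sub_le {Ω : Set (Eucl n)} (hΩ : IsOpen Ω) {N : ℕ}
    {u : Eucl n → Eucl m} (hu : ContDiffOn ℝ N u Ω) {χ : Eucl n → ℝ} (hχ : ContDiff ℝ ∞ χ)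
    (hχ01 : ∀ x, χ x ∈ Icc 0 1) {C : ℕ → ℝ} {Λ t : ℝ} (hC0 : ∀ j, 0 ≤ C j) (hΛ : 0 ≤ Λ)
    (ht : 0 ≤ t) (hχd : ∀ j x, ‖iteratedFDeriv ℝ j χ x‖ ≤ C j * ((4 * Λ) ^ j * t ^ j))
    {α : Fin n → ℕ} {k : ℕ} (hα : ∑ i, α i = k) (hk : k ≤ N) {x : Eucl n} (hx : x ∈ Ω) :
    ‖multiD α (fun y => χ y • u y) x - multiD α u x‖ ≤ ∑ i ∈ Finset.range (k + 1),
      ((k.choose i : ℝ) * (C i + 1) * (4 * Λ) ^ i * ((n : ℝ) ^ (k - i) + 1)) * t ^ i *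
        derivSum (k - i) u x := by
  have h1 := norm_multiD_smul_sub_le hΩ hχ hu α (hα.trans_le hk) hx
  rw [hα] at h1
  have h2 : multiD α (fun y => χ y • u y) x - multiD α u x =
      (multiD α (fun y => χ y • u y) x - χ x • multiD α u x) - (1 - χ x) • multiD α u x := by module
  rw [h2, Finset.sum_range_succ']
  refine (norm_sub_le _ _).trans (add_le_add (h1.trans (Finset.sum_le_sum fun j hj => ?_)) ?_)
  · have hj' := Finset.mem_range.1 hj
    have h3 := norm_iteratedFDeriv_le_sum hΩ hu (k := k - (j + 1)) (by omega) hx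
    have h4 : ‖iteratedFDeriv ℝ (k - (j + 1)) u x‖ ≤
        ((n : ℝ) ^ (k - (j + 1)) + 1) * derivSum (k - (j + 1)) u x :=
      h3.trans (mul_le_mul_of_nonneg_right (by linarith) (derivSum_nonneg _ _ _))
    have h5 : ‖iteratedFDeriv ℝ (j + 1) χ x‖ ≤ (C (j + 1) + 1) * ((4 * Λ) ^ (j + 1) * t ^ (j + 1)) :=
      (hχd _ x).trans (mul_le_mul_of_nonneg_right (by linarith) (by positivity))
    have hC1 : 0 ≤ C (j + 1) + 1 := by linarith [hC0 (j + 1)]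
    calc _ ≤ (k.choose (j + 1) : ℝ) * ((C (j + 1) + 1) * ((4 * Λ) ^ (j + 1) * t ^ (j + 1))) *
          (((n : ℝ) ^ (k - (j + 1)) + 1) * derivSum (k - (j + 1)) u x) := by
          refine mul_le_mul (mul_le_mul_of_nonneg_left h5 (by positivity)) h4 (norm_nonneg _) ?_
          exact mul_nonneg (by positivity) (mul_nonneg hC1 (by positivity))
      _ = _ := by ring
  · rw [norm_smul, Real.norm_of_nonneg (by linarith [(hχ01 x).2])]
    simp only [Nat.choose_zero_right, Nat.cast_one, pow_zero, mul_one, one_mul, Nat.sub_zero]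
    have h3 := norm_multiD_le_derivSum hα u x
    have h4 : (1 : ℝ) ≤ (C 0 + 1) * ((n : ℝ) ^ k + 1) := by
      have : (0 : ℝ) ≤ (n : ℝ) ^ k := by positivity
      nlinarith [hC0 0]
    calc (1 - χ x) * ‖multiD α u x‖ ≤ 1 * derivSum k u x :=
          mul_le_mul (by linarith [(hχ01 x).1]) h3 (norm_nonneg _) zero_le_one
      _ ≤ _ := mul_le_mul_of_nonneg_right h4 (derivSum_nonneg _ _ _)

theorem enorm_sum_sq_le {ι : Type*} (s : Finset ι) (f : ι → ℝ) :
    ‖∑ i ∈ s, f i‖ₑ ^ 2 ≤ s.card * ∑ i ∈ s, ‖f i‖ₑ ^ 2 := by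
  simp only [enorm_sq_eq_ofReal, Real.norm_eq_abs, sq_abs]
  rw [← ENNReal.ofReal_sum_of_nonneg fun _ _ => sq_nonneg _, ← ENNReal.ofReal_natCast,
    ← ENNReal.ofReal_mul (Nat.cast_nonneg _)]
  exact ENNReal.ofReal_le_ofReal sq_sum_le_card_mul_sum_sq

theorem continuousOn_derivSum {Ω : Set (Eucl n)} (hΩ : IsOpen Ω) {N k : ℕ} {u : Eucl n → Eucl m}
    (hu : ContDiffOn ℝ N u Ω) (hk : k ≤ N) : ContinuousOn (derivSum k u) Ω :=
  continuousOn_finsetSum _ fun α hα =>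
    (hu.multiD hΩ α (k := 0) (by rw [mem_multiIndices.1 hα]; omega)).continuousOn.norm

namespace IsGraphChart

variable {Ω : Set (Eucl n)} {Q e : Eucl n} {ρ Λ : ℝ} {h : Eucl n → ℝ}

/-- Cutting off a function at height `ε` costs an error in the Sobolev norm of order `N` that is
controlled by the derivatives of order `N` in a strip: each derivative of order `i` of the cutoff
contributes a factor `ε⁻ⁱ`, which the iterated Hardy inequality compensates. -/
theorem exists_cutoff_smul_bound (H : IsGraphChart Ω Q ρ Λ e h) {N : ℕ} {R₁ R₂ : ℝ}
    (hR₁ : (1 + Λ) * R₁ ≤ ρ) {u : Eucl n → Eucl m} (hu : ContDiffOn ℝ N u Ω)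
    (hlim : ∀ α : Fin n → ℕ, ∑ i, α i < N → ∀ᵐ z ∂volume.restrict (Metric.ball Q R₁),
      Tendsto (fun s : ℝ => multiD α u (foot e h z + s • e)) (𝓝[>] 0) (𝓝 0)) :
    ∃ K : ℝ≥0, ∀ ε : ℝ, 0 < ε → ε ≤ 1 → R₂ + N * (2 * ε) ≤ R₁ →
      ∃ χ : Eucl n → ℝ, ContDiff ℝ ∞ χ ∧ (∀ x, h x ≤ ε / 2 → χ x = 0) ∧
        ∀ α : Fin n → ℕ, ∑ i, α i ≤ N →
          ∫⁻ x in tent Ω Q R₂, ‖multiD α (fun y => χ y • u y) x - multiD α u x‖ₑ ^ 2 ≤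
            K * ∫⁻ x in tent Ω Q R₁ ∩ {x | h x < 2 * ε}, ‖derivSum N u x‖ₑ ^ 2 := by
  obtain ⟨C, hC0, hC⟩ := exists_height_cutoff n
  obtain ⟨D, hD⟩ := exists_strip_bound n N
  have hΛ : 0 ≤ Λ := zero_le_one.trans H.one_le
  -- coefficients in `norm_multiD_cutoff_smul_sub_le`
  set E : ℕ → ℕ → ℝ := fun k i =>
    (k.choose i : ℝ) * (C i + 1) * (4 * Λ) ^ i * ((n : ℝ) ^ (k - i) + 1) with hE
  set Kk : ℕ → ℝ≥0 := fun k => ((Finset.range (k + 1)).card : ℝ≥0) *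
    ∑ i ∈ Finset.range (k + 1), (E k i ^ 2 * 4 ^ N).toNNReal * D ^ (N - k + i) with hKk
  refine ⟨∑ k ∈ Finset.range (N + 1), Kk k, fun ε hε hε1 hRε => ?_⟩
  obtain ⟨χ, hχs, hχ01, hχ1, hχ0, hχd⟩ := hC H ε hε
  refine ⟨χ, hχs, hχ0, fun α hα => ?_⟩
  obtain ⟨k, hk⟩ : ∃ k, ∑ i, α i = k := ⟨_, rfl⟩
  rw [hk] at hα
  have hkK : (Kk k : ℝ≥0∞) ≤ ((∑ k ∈ Finset.range (N + 1), Kk k : ℝ≥0) : ℝ≥0∞) :=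
    ENNReal.coe_le_coe.2 (Finset.single_le_sum (f := Kk) (fun _ _ => zero_le)
      (Finset.mem_range.2 (by omega)))
  refine le_trans ?_ (mul_le_mul' hkK le_rfl)
  set J := ∫⁻ x in tent Ω Q R₁ ∩ {x | h x < 2 * ε}, ‖derivSum N u x‖ₑ ^ 2 with hJ
  set B : Set (Eucl n) := {x | h x < 2 * ε} with hB
  have hBm : MeasurableSet B := (isOpen_lt H.continuous continuous_const).measurableSet
  set g : Eucl n → ℝ := fun x => ∑ i ∈ Finset.range (k + 1),
    E k i * ε⁻¹ ^ i * derivSum (k - i) u x with hg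
  have htm : MeasurableSet (tent Ω Q R₂) :=
    Metric.isOpen_ball.measurableSet.inter H.isOpen.measurableSet
  have hpt : ∀ x ∈ tent Ω Q R₂, ‖multiD α (fun y => χ y • u y) x - multiD α u x‖ₑ ^ 2 ≤
      B.indicator (fun x => ‖g x‖ₑ ^ 2) x := by
    intro x hx
    by_cases hxB : x ∈ B
    · rw [indicator_of_mem hxB, enorm_sq_eq_ofReal, enorm_sq_eq_ofReal]
      refine ENNReal.ofReal_le_ofReal (pow_le_pow_left₀ (norm_nonneg _) ?_ 2)
      exact (norm_multiD_cutoff_smul_sub_le H.isOpen hu hχs hχ01 hC0 hΛ (inv_nonneg.2 hε.le) hχd hk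
        hα hx.2).trans (le_abs_self _)
    -- at heights above `ε` the cutoff function is `1`
    · have hxε : ε < h x := by
        have : ¬ h x < 2 * ε := hxB
        linarith
      have h1 : EqOn (fun y => χ y • u y) u {y | ε < h y} := fun y hy => by
        simp only [hχ1 y (le_of_lt hy), one_smul]
      rw [multiD_congr (isOpen_lt continuous_const H.continuous) h1 α hxε, sub_self]
      simp
  have hstrip : ∀ i ∈ Finset.range (k + 1),
      ∫⁻ x in tent Ω Q R₂ ∩ B, ‖E k i * ε⁻¹ ^ i * derivSum (k - i) u x‖ₑ ^ 2 ≤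
        ((E k i ^ 2 * 4 ^ N).toNNReal * D ^ (N - k + i) : ℝ≥0) * J := by
    intro i hi
    have hik : i ≤ k := Nat.lt_succ_iff.1 (Finset.mem_range.1 hi)
    -- from order `k - i` to order `N`; the factor `ε ^ (2 j)` absorbs `ε⁻¹ ^ (2 i)` as `i ≤ j`
    set j := N - k + i with hj
    have hjN : j ≤ N := by omega
    have hj2 : k - i + j = N := by omega
    have hjr : R₂ + j * (2 * ε) ≤ R₁ := by
      have : (j : ℝ) ≤ N := by exact_mod_cast hjN
      nlinarith
    have h1 := hD H hR₁ (by linarith : 0 ≤ 2 * ε) hu hlim j (k - i) R₂ hj2.le hjr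
    rw [hj2] at h1
    have h2 : ∫⁻ x in tent Ω Q (R₂ + j * (2 * ε)) ∩ B, ‖derivSum N u x‖ₑ ^ 2 ≤ J :=
      lintegral_mono_set (inter_subset_inter_left _
        (inter_subset_inter_left _ (Metric.ball_subset_ball hjr)))
    have h3 : ∀ x, ‖E k i * ε⁻¹ ^ i * derivSum (k - i) u x‖ₑ ^ 2 =
        ENNReal.ofReal ((E k i * ε⁻¹ ^ i) ^ 2) * ‖derivSum (k - i) u x‖ₑ ^ 2 := fun x => by
      rw [enorm_mul, mul_pow, enorm_sq_eq_ofReal (E k i * ε⁻¹ ^ i), Real.norm_eq_abs, sq_abs]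
    simp only [h3]
    rw [lintegral_const_mul' _ _ ENNReal.ofReal_ne_top]
    have h4 : ENNReal.ofReal ((E k i * ε⁻¹ ^ i) ^ 2) * ENNReal.ofReal (2 * ε) ^ (2 * j) ≤
        ((E k i ^ 2 * 4 ^ N).toNNReal : ℝ≥0∞) := by
      rw [← ENNReal.ofReal_pow (by linarith), ← ENNReal.ofReal_mul (sq_nonneg _)]
      refine ENNReal.ofReal_le_ofReal ?_
      have h5 : (E k i * ε⁻¹ ^ i) ^ 2 * (2 * ε) ^ (2 * j) =
          E k i ^ 2 * (4 ^ j * (ε ^ 2) ^ (j - i)) := by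
        have h6 : (2 * ε) ^ (2 * j) = 4 ^ j * ((ε ^ 2) ^ (j - i) * (ε ^ 2) ^ i) := by
          rw [← pow_add, Nat.sub_add_cancel (by omega), pow_mul, ← mul_pow]
          congr 1; ring
        have h7 : (ε⁻¹ ^ i) ^ 2 * (ε ^ 2) ^ i = 1 := by
          rw [← pow_mul, ← pow_mul, mul_comm 2 i, ← mul_pow, inv_mul_cancel₀ hε.ne', one_pow]
        calc _ = E k i ^ 2 * (4 ^ j * (ε ^ 2) ^ (j - i)) * ((ε⁻¹ ^ i) ^ 2 * (ε ^ 2) ^ i) := by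
              rw [h6]; ring
          _ = _ := by rw [h7, mul_one]
      rw [h5]
      refine mul_le_mul_of_nonneg_left ?_ (sq_nonneg _)
      calc (4 : ℝ) ^ j * (ε ^ 2) ^ (j - i) ≤ 4 ^ N * 1 := by
            refine mul_le_mul (pow_le_pow_right₀ (by norm_num) hjN) ?_ (by positivity) (by positivity)
            exact pow_le_one₀ (sq_nonneg _) (pow_le_one₀ hε.le hε1)
        _ = 4 ^ N := mul_one _
    calc _ ≤ ENNReal.ofReal ((E k i * ε⁻¹ ^ i) ^ 2) *
          (D ^ j * ENNReal.ofReal (2 * ε) ^ (2 * j) * J) :=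
          mul_le_mul' le_rfl (h1.trans (mul_le_mul' le_rfl h2))
      _ = (ENNReal.ofReal ((E k i * ε⁻¹ ^ i) ^ 2) * ENNReal.ofReal (2 * ε) ^ (2 * j)) * D ^ j * J := by
          ring
      _ ≤ ((E k i ^ 2 * 4 ^ N).toNNReal : ℝ≥0∞) * D ^ j * J :=
          mul_le_mul' (mul_le_mul' h4 le_rfl) le_rfl
      _ = _ := by push_cast; rfl
  calc ∫⁻ x in tent Ω Q R₂, ‖multiD α (fun y => χ y • u y) x - multiD α u x‖ₑ ^ 2
      ≤ ∫⁻ x in tent Ω Q R₂, B.indicator (fun x => ‖g x‖ₑ ^ 2) x := setLIntegral_mono' htm hpt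
    _ = ∫⁻ x in tent Ω Q R₂ ∩ B, ‖g x‖ₑ ^ 2 := by
        rw [setLIntegral_indicator hBm, inter_comm]
    _ ≤ ∫⁻ x in tent Ω Q R₂ ∩ B, ((Finset.range (k + 1)).card : ℝ≥0∞) *
          ∑ i ∈ Finset.range (k + 1), ‖E k i * ε⁻¹ ^ i * derivSum (k - i) u x‖ₑ ^ 2 :=
        lintegral_mono fun x => enorm_sum_sq_le _ _
    _ = ((Finset.range (k + 1)).card : ℝ≥0∞) * ∑ i ∈ Finset.range (k + 1),
          ∫⁻ x in tent Ω Q R₂ ∩ B, ‖E k i * ε⁻¹ ^ i * derivSum (k - i) u x‖ₑ ^ 2 := by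
        rw [lintegral_const_mul' _ _ (by simp), lintegral_finsetSum']
        intro i hi
        have h1 := (continuousOn_derivSum H.isOpen hu (k := k - i) (by omega)).mono
          (fun x (hx : x ∈ tent Ω Q R₂ ∩ B) => hx.1.2)
        exact ((continuousOn_const.mul h1).aestronglyMeasurable (htm.inter hBm)).enorm.pow_const 2
    _ ≤ ((Finset.range (k + 1)).card : ℝ≥0∞) * ∑ i ∈ Finset.range (k + 1),
          ((E k i ^ 2 * 4 ^ N).toNNReal * D ^ (N - k + i) : ℝ≥0) * J := by
        gcongr with i hi
        exact hstrip i hi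
    _ = Kk k * J := by
        rw [← Finset.sum_mul, ← mul_assoc, hKk]; push_cast; rfl

theorem tendsto_lintegral_strip (H : IsGraphChart Ω Q ρ Λ e h) {R : ℝ} (hR : R ≤ ρ)
    {f : Eucl n → ℝ≥0∞} (hf : ∫⁻ x in tent Ω Q R, f x < ⊤) :
    Tendsto (fun k : ℕ => ∫⁻ x in tent Ω Q R ∩ {x | h x < 2 * (1 / ((k : ℝ) + 1))}, f x) atTop
      (𝓝 0) := by
  set B : ℕ → Set (Eucl n) := fun k => {x | h x < 2 * (1 / ((k : ℝ) + 1))} with hB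
  have hBm : ∀ k, MeasurableSet (B k) := fun k =>
    (isOpen_lt H.continuous continuous_const).measurableSet
  have htm : MeasurableSet (tent Ω Q R) :=
    Metric.isOpen_ball.measurableSet.inter H.isOpen.measurableSet
  have hempty : (volume.restrict (tent Ω Q R)) (⋂ k, B k) = 0 := by
    rw [Measure.restrict_apply (MeasurableSet.iInter hBm)]
    have : (⋂ k, B k) ∩ tent Ω Q R = ∅ := by
      refine eq_empty_iff_forall_notMem.2 fun x hx => ?_
      have h0 : 0 < h x := (H.mem_iff x (Metric.ball_subset_ball hR hx.2.1)).1 hx.2.2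
      obtain ⟨k, hk⟩ := exists_nat_one_div_lt (half_pos h0)
      have h1 : h x < 2 * (1 / ((k : ℝ) + 1)) := mem_iInter.1 hx.1 k
      linarith
    rw [this, measure_empty]
  have hmeas : Tendsto (fun k => (volume.restrict (tent Ω Q R)) (B k)) atTop (𝓝 0) := by
    rw [← hempty]
    refine tendsto_measure_iInter_atTop (fun k => (hBm k).nullMeasurableSet) ?_ ⟨0, ?_⟩
    · intro k l hkl x hx
      have h1 : h x < 2 * (1 / ((l : ℝ) + 1)) := hx
      change h x < 2 * (1 / ((k : ℝ) + 1))
      have h2 : 1 / ((l : ℝ) + 1) ≤ 1 / ((k : ℝ) + 1) := by gcongr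
      linarith
    · refine ((measure_mono (subset_univ _)).trans_lt ?_).ne
      rw [Measure.restrict_apply_univ]
      exact (measure_mono inter_subset_left).trans_lt measure_ball_lt_top
  have := tendsto_setLIntegral_zero hf.ne hmeas
  refine this.congr fun k => ?_
  rw [Measure.restrict_restrict (hBm k), inter_comm]

/-- A function whose derivatives of order less than `N` tend to zero along almost every vertical
line and whose derivatives of order `N` are square integrable is a limit in the Sobolev norm of test
functions. -/
theorem sobolevApprox (H : IsGraphChart Ω Q ρ Λ e h) {N : ℕ} {R₁ R₂ : ℝ}
    (hR₁ : (1 + Λ) * R₁ ≤ ρ) (hR₂ : 0 < R₂) (hR : R₂ < R₁) {u : Eucl n → Eucl m}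
    (hu : ContDiffOn ℝ N u Ω)
    (hlim : ∀ α : Fin n → ℕ, ∑ i, α i < N → ∀ᵐ z ∂volume.restrict (Metric.ball Q R₁),
      Tendsto (fun s : ℝ => multiD α u (foot e h z + s • e)) (𝓝[>] 0) (𝓝 0))
    (hfin : ∫⁻ x in tent Ω Q R₁, ‖derivSum N u x‖ₑ ^ 2 < ⊤) :
    SobolevApprox N Ω (Metric.ball Q R₂) u := by
  intro δ hδ
  obtain ⟨K, hK⟩ := H.exists_cutoff_smul_bound (R₂ := R₂) hR₁ hu hlim
  have hΛ := H.one_le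
  have hR₁ρ : R₁ < ρ := by nlinarith
  have hts := ENNReal.Tendsto.const_mul (a := ((2 * K : ℝ≥0) : ℝ≥0∞))
    (H.tendsto_lintegral_strip hR₁ρ.le hfin) (Or.inr ENNReal.coe_ne_top)
  rw [mul_zero] at hts
  have hd2 : 0 < δ / 2 := ENNReal.half_pos hδ.ne'
  have h0 : Tendsto (fun k : ℕ => 1 / ((k : ℝ) + 1)) atTop (𝓝 0) :=
    tendsto_one_div_add_atTop_nhds_zero_nat
  have h1 : Tendsto (fun k : ℕ => R₂ + N * (2 * (1 / ((k : ℝ) + 1)))) atTop (𝓝 R₂) := by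
    simpa using ((h0.const_mul 2).const_mul (N : ℝ)).const_add R₂
  obtain ⟨k, hk1, hk2⟩ := ((hts.eventually (gt_mem_nhds hd2)).and
    (h1.eventually (gt_mem_nhds hR))).exists
  set ε : ℝ := 1 / ((k : ℝ) + 1) with hε
  have hε0 : 0 < ε := by positivity
  have hε1 : ε ≤ 1 := by
    rw [hε, div_le_one (by positivity)]; linarith [(Nat.cast_nonneg k : (0 : ℝ) ≤ k)]
  obtain ⟨χ, hχs, hχ0, hχu⟩ := hK ε hε0 hε1 hk2.le
  let Z : ContDiffBump Q := ⟨R₂, R₁, hR₂, hR⟩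
  have hZs : ContDiff ℝ ∞ Z := Z.contDiff
  have hZ1 : ∀ x ∈ Metric.ball Q R₂, Z x = 1 := fun x hx =>
    Z.one_of_mem_closedBall (Metric.ball_subset_closedBall hx)
  set w : Eucl n → Eucl m := fun x => (Z x * χ x) • u x with hw
  have hwsupp : tsupport w ⊆ Metric.closedBall Q R₁ ∩ {x | ε / 2 ≤ h x} := by
    refine closure_minimal (fun x hx => ⟨?_, ?_⟩)
      (Metric.isClosed_closedBall.inter (isClosed_le continuous_const H.continuous))
    · by_contra hxQ
      refine hx ?_
      have : Z x = 0 := Z.zero_of_le_dist (not_le.1 hxQ).le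
      simp only [hw, this, zero_mul, zero_smul]
    · by_contra hxh
      refine hx ?_
      simp only [hw, hχ0 x (not_le.1 hxh).le, mul_zero, zero_smul]
  have hwΩ : tsupport w ⊆ Ω := fun x hx => by
    obtain ⟨hx1, hx2⟩ := hwsupp hx
    have hx2 : ε / 2 ≤ h x := hx2
    refine (H.mem_iff x ?_).2 (by linarith)
    exact lt_of_le_of_lt hx1 hR₁ρ
  have hwc : HasCompactSupport w :=
    (isCompact_closedBall Q R₁).of_isClosed_subset (isClosed_tsupport w)
      (hwsupp.trans inter_subset_left)
  have hZχ : ContDiff ℝ (N : ℕ∞ω) fun x => Z x * χ x :=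
    (hZs.mul hχs).of_le (by exact_mod_cast le_top)
  have hwd : ContDiff ℝ (N : ℕ∞ω) w :=
    contDiff_of_tsupport_subset H.isOpen (hZχ.contDiffOn.smul hu) hwΩ
  set V := volume (Metric.ball Q R₂) with hV
  have hVt : V ≠ ⊤ := measure_ball_lt_top.ne
  obtain ⟨η, hη0, hηV⟩ : ∃ η : ℝ, 0 < η ∧ 2 * (ENNReal.ofReal (η ^ 2) * V) ≤ δ / 2 := by
    have h2 : Tendsto (fun η : ℝ => 2 * (ENNReal.ofReal (η ^ 2) * V)) (𝓝[>] 0) (𝓝 0) := by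
      have h3 : Tendsto (fun η : ℝ => ENNReal.ofReal (η ^ 2)) (𝓝[>] 0) (𝓝 0) := by
        have : Continuous fun η : ℝ => ENNReal.ofReal (η ^ 2) :=
          ENNReal.continuous_ofReal.comp (continuous_pow 2)
        simpa using (this.tendsto 0).mono_left nhdsWithin_le_nhds
      simpa using ENNReal.Tendsto.const_mul (a := 2)
        (ENNReal.Tendsto.mul_const (b := V) h3 (Or.inr hVt)) (Or.inr (by simp))
    obtain ⟨η, h4, h5⟩ := ((h2.eventually (gt_mem_nhds hd2)).and self_mem_nhdsWithin).exists
    exact ⟨η, h5, h4.le⟩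
  obtain ⟨v, hv, hvc, hvΩ, hvw⟩ := exists_smooth_approx H.isOpen hwd hwc hwΩ hη0
  refine ⟨v, hv, hvc, hvΩ, fun α hα => ?_⟩
  have hopen : IsOpen (tent Ω Q R₂) := Metric.isOpen_ball.inter H.isOpen
  have heq : EqOn (multiD α w) (multiD α fun y => χ y • u y) (tent Ω Q R₂) :=
    multiD_congr hopen (fun x hx => by simp only [hw, hZ1 x hx.1, one_mul]) α
  have hcontw : Continuous (multiD α w) :=
    (contDiffOn_univ.1 ((contDiffOn_univ.2 hwd).multiD isOpen_univ α (k := 0) (by omega))).continuous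
  change ∫⁻ x in tent Ω Q R₂, ‖multiD α v x - multiD α u x‖ₑ ^ 2 ≤ δ
  have hpt : ∀ x ∈ tent Ω Q R₂, ‖multiD α v x - multiD α u x‖ₑ ^ 2 ≤
      2 * ENNReal.ofReal (η ^ 2) +
        2 * ‖multiD α (fun y => χ y • u y) x - multiD α u x‖ₑ ^ 2 := by
    intro x hx
    refine (enorm_sq_le_two_mul _ (multiD α v x - multiD α w x)).trans ?_
    have h2 : multiD α v x - multiD α w x - (multiD α v x - multiD α u x) =
        -(multiD α w x - multiD α u x) := by abel
    rw [h2, enorm_neg, heq hx]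
    refine add_le_add (mul_le_mul' le_rfl ?_) le_rfl
    rw [enorm_sq_eq_ofReal, ← heq hx]
    exact ENNReal.ofReal_le_ofReal (pow_le_pow_left₀ (norm_nonneg _) (hvw α hα x) 2)
  calc _ ≤ ∫⁻ x in tent Ω Q R₂, (2 * ENNReal.ofReal (η ^ 2) +
        2 * ‖multiD α (fun y => χ y • u y) x - multiD α u x‖ₑ ^ 2) :=
        setLIntegral_mono' hopen.measurableSet hpt
    _ = 2 * ENNReal.ofReal (η ^ 2) * volume (tent Ω Q R₂) +
        2 * ∫⁻ x in tent Ω Q R₂, ‖multiD α (fun y => χ y • u y) x - multiD α u x‖ₑ ^ 2 := by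
        rw [lintegral_add_left measurable_const, setLIntegral_const,
          lintegral_const_mul' _ _ (by simp)]
    _ ≤ δ / 2 + δ / 2 := by
        refine add_le_add ?_ ?_
        · rw [mul_assoc]
          exact (mul_le_mul' le_rfl (mul_le_mul' le_rfl (measure_mono inter_subset_left))).trans hηV
        · refine le_trans (mul_le_mul' le_rfl (hχu α hα)) ?_
          rw [← mul_assoc]
          refine le_trans (le_of_eq ?_) hk1.le
          push_cast; rfl
    _ = δ := ENNReal.add_halves δ

end IsGraphChart
end Approximation

/-! ### The decay estimate -/

section Decay

variable {n m : ℕ}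

theorem SobolevApprox.mono {ℓ : ℕ} {Ω V V' : Set (Eucl n)} {u : Eucl n → Eucl m}
    (hu : SobolevApprox ℓ Ω V u) (hV : V' ⊆ V) : SobolevApprox ℓ Ω V' u := fun δ hδ => by
  obtain ⟨v, hv, hvc, hvΩ, hvu⟩ := hu δ hδ
  exact ⟨v, hv, hvc, hvΩ, fun α hα =>
    (lintegral_mono_set (inter_subset_inter_left _ hV)).trans (hvu α hα)⟩

theorem enorm_gradNorm_sq (k : ℕ) (u : Eucl n → Eucl m) (x : Eucl n) :
    ‖gradNorm k u x‖ₑ ^ 2 = ∑ α ∈ multiIndices n k, ‖multiD α u x‖ₑ ^ 2 := by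
  simp only [enorm_sq_eq_ofReal]
  rw [← ENNReal.ofReal_sum_of_nonneg fun _ _ => sq_nonneg _, Real.norm_eq_abs, sq_abs, gradNorm,
    Real.sq_sqrt (Finset.sum_nonneg fun _ _ => sq_nonneg _)]

theorem lintegral_derivSum_sq_le_gradNorm (k : ℕ) (u : Eucl n → Eucl m) (A : Set (Eucl n)) :
    ∫⁻ x in A, ‖derivSum k u x‖ₑ ^ 2 ≤
      (multiIndices n k).card * ∫⁻ x in A, ‖gradNorm k u x‖ₑ ^ 2 := by
  rw [← lintegral_const_mul' _ _ (by simp)]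
  refine lintegral_mono fun x => ?_
  rw [enorm_gradNorm_sq]
  exact enorm_derivSum_sq_le k u x

/-- Poincaré's inequality with a loss of radius, for functions whose derivatives of order at most
`k - 1` vanish on the boundary. -/
theorem exists_poincare (n k N : ℕ) (hk : k ≤ N) : ∃ D : ℝ≥0, ∀ {m : ℕ} {Ω : Set (Eucl n)}
    {Q e : Eucl n} {ρ Λ : ℝ} {h : Eucl n → ℝ}, IsGraphChart Ω Q ρ Λ e h → ∀ {R R₁ : ℝ}, 0 ≤ R →
    (1 + Λ) * R₁ ≤ ρ → R + k * (Λ * R) ≤ R₁ → ∀ {u : Eucl n → Eucl m}, ContDiffOn ℝ N u Ω →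
    (∀ α : Fin n → ℕ, ∑ i, α i < N → ∀ᵐ z ∂volume.restrict (Metric.ball Q R₁),
      Tendsto (fun s : ℝ => multiD α u (foot e h z + s • e)) (𝓝[>] 0) (𝓝 0)) →
    ∫⁻ x in tent Ω Q R, ‖u x‖ₑ ^ 2 ≤
      D * ENNReal.ofReal ((Λ * R) ^ (2 * k)) * ∫⁻ x in tent Ω Q R₁, ‖gradNorm k u x‖ₑ ^ 2 := by
  obtain ⟨D, hD⟩ := IsGraphChart.exists_strip_bound n N
  refine ⟨D ^ k * (multiIndices n k).card, fun {m Ω Q e ρ Λ h} H {R R₁} hR hR₁ hRR₁ {u} hu hlim => ?_⟩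
  have hΛ : 0 < Λ := zero_lt_one.trans_le H.one_le
  have hΛR : 0 ≤ Λ * R := by positivity
  have h1 := hD H hR₁ hΛR hu hlim k 0 R (by omega) hRR₁
  have h2 : tent Ω Q R ⊆ tent Ω Q R ∩ {x | h x < Λ * R} := fun x hx =>
    ⟨hx, ((le_abs_self _).trans (H.abs_height_le x)).trans_lt (mul_lt_mul_of_pos_left hx.1 hΛ)⟩
  have h3 : ∀ x, ‖derivSum 0 u x‖ₑ ^ 2 = ‖u x‖ₑ ^ 2 := fun x => by
    rw [derivSum_zero, enorm_norm]
  simp only [h3, zero_add] at h1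
  rw [← ENNReal.ofReal_pow hΛR] at h1
  calc ∫⁻ x in tent Ω Q R, ‖u x‖ₑ ^ 2 ≤ ∫⁻ x in tent Ω Q R ∩ {x | h x < Λ * R}, ‖u x‖ₑ ^ 2 :=
        lintegral_mono_set h2
    _ ≤ D ^ k * ENNReal.ofReal ((Λ * R) ^ (2 * k)) *
          ((multiIndices n k).card * ∫⁻ x in tent Ω Q R₁, ‖gradNorm k u x‖ₑ ^ 2) := by
        refine h1.trans (mul_le_mul' le_rfl (le_trans (lintegral_mono_set ?_)
          (lintegral_derivSum_sq_le_gradNorm k u _)))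
        exact inter_subset_left.trans (inter_subset_inter_left _ (Metric.ball_subset_ball hRR₁))
    _ = _ := by push_cast; ring

/-- The decay estimate in a chart. For radii of comparable size it is trivial. Otherwise the
Caccioppoli inequality, the decay of `u` and Poincaré's inequality are combined. -/
theorem exists_gradNorm_decay (n m : ℕ) {ℓ : ℕ} (hℓ : 1 ≤ ℓ) {μ C lam₀ lam ρ Λ : ℝ} (hμ : 0 < μ)
    (hC : 0 < C) (hlam0 : 0 < lam) (hlam : lam ≤ lam₀) (hΛ : 1 ≤ Λ) :
    ∃ C' : ℝ, 0 < C' ∧ ∀ (Ω : Set (Eucl n)) (Q e : Eucl n) (h : Eucl n → ℝ),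
      IsGraphChart Ω Q ρ Λ e h → ∀ a : Coeffs n m, IsSymmElliptic ℓ μ a →
      ∀ R₀ : ℝ, R₀ ≤ ρ / 2 → ∀ u : Eucl n → Eucl m, IsSolution ℓ a Ω u →
      (∫⁻ P in surfaceBall Ω Q R₀, ntMax Ω (gradNorm ℓ u) P ^ 2 ∂(surfaceMeasure n) < ⊤) →
      (∀ α : Fin n → ℕ, ∑ i, α i ≤ ℓ - 1 → VanishesNT Ω (surfaceBall Ω Q R₀) (multiD α u)) →
      (∀ r R : ℝ, 0 < r → r < R → R < R₀ → ∫⁻ x in tent Ω Q r, ‖u x‖ₑ ^ 2 ≤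
        ENNReal.ofReal (C * (r / R) ^ (lam₀ + 2 * (ℓ : ℝ) - 2)) *
          ∫⁻ x in tent Ω Q R, ‖u x‖ₑ ^ 2) →
      ∀ r R : ℝ, 0 < r → r < R → R < R₀ →
        ∫⁻ x in tent Ω Q r, ‖gradNorm (ℓ - 1) u x‖ₑ ^ 2 ≤
          ENNReal.ofReal (C' * (r / R) ^ lam) *
            ∫⁻ x in tent Ω Q R, ‖gradNorm (ℓ - 1) u x‖ₑ ^ 2 := by
  obtain ⟨K, hK⟩ := exists_caccioppoli n m (ℓ := ℓ) hμ
  obtain ⟨k, rfl⟩ : ∃ k, ℓ = k + 1 := ⟨ℓ - 1, by omega⟩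
  simp only [Nat.add_sub_cancel]
  obtain ⟨D, hD⟩ := exists_poincare n k (k + 1) (by omega)
  -- the loss of radius in `IsGraphChart.lintegral_sq_lt_top`
  set L : ℝ := (1 + Λ) * (1 + 3 * Λ) with hL
  have hL1 : 8 ≤ L := by nlinarith
  -- small enough that the enlargements of the radius `c * R` in Poincaré's inequality stay within
  -- `R / (2 * L)`
  set c : ℝ := 1 / (2 * (k + 1) * Λ * L) with hc
  have hc0 : 0 < c := by positivity
  set κ : ℝ := (multiIndices n k).card * (K * D) with hκ
  have hκ0 : 0 ≤ κ := by positivity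
  set M : ℝ := κ * (C * (2 * Λ) ^ (2 * k) * (2 / c) ^ lam) with hM
  have hM0 : 0 ≤ M := by positivity
  refine ⟨(c / 2) ^ (-lam) + M, by positivity, fun Ω Q e h H a ha R₀ hR₀ u hu hN hV hdec r R hr hrR
    hRR₀ => ?_⟩
  have hR : 0 < R := hr.trans hrR
  have hrR0 : 0 < r / R := div_pos hr hR
  set p := (r / R) ^ lam with hp
  have hp0 : 0 < p := Real.rpow_pos_of_pos hrR0 _
  rcases le_or_gt (c / 2) (r / R) with hcr | hcr
  · have h1 : 1 ≤ ((c / 2) ^ (-lam) + M) * p := by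
      have h2 : (c / 2) ^ lam ≤ p := Real.rpow_le_rpow (by positivity) hcr hlam0.le
      have h3 : (c / 2) ^ (-lam) * (c / 2) ^ lam = 1 := by
        rw [← Real.rpow_add (by positivity), neg_add_cancel, Real.rpow_zero]
      have h4 : 0 < (c / 2) ^ (-lam) := by positivity
      calc 1 = (c / 2) ^ (-lam) * (c / 2) ^ lam := h3.symm
        _ ≤ (c / 2) ^ (-lam) * p := mul_le_mul_of_nonneg_left h2 h4.le
        _ ≤ _ := mul_le_mul_of_nonneg_right (by linarith) hp0.le
    calc _ ≤ 1 * ∫⁻ x in tent Ω Q R, ‖gradNorm k u x‖ₑ ^ 2 := by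
          rw [one_mul]
          exact lintegral_mono_set (inter_subset_inter_left _ (Metric.ball_subset_ball hrR.le))
      _ ≤ _ := mul_le_mul' (ENNReal.one_le_ofReal.2 h1) le_rfl
  -- the radii of the three steps: `2 r < R₃ ≤ R₂ < R₁ < R`
  set R₁ := R / L with hR₁
  set R₃ := c * R with hR₃
  have hR₁0 : 0 < R₁ := by positivity
  have hR₃0 : 0 < R₃ := by positivity
  have hLR : L * R₁ = R := mul_div_cancel₀ _ (by linarith)
  have hcR : 2 * (((k : ℝ) + 1) * (Λ * R₃)) = R₁ := by
    rw [hR₃, hc, hR₁]; field_simp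
  have hkR : (0 : ℝ) ≤ k * (Λ * R₃) := by positivity
  have hΛR₃ : R₃ ≤ Λ * R₃ := le_mul_of_one_le_left hR₃0.le hΛ
  have hR₃₁ : R₃ + k * (Λ * R₃) ≤ R₁ / 2 := by linarith
  have hLR' : (1 + Λ) * ((1 + 3 * Λ) * R₁) = R := by rw [← hLR, hL]; ring
  have hR₁R : (1 + Λ) * R₁ ≤ R := by
    rw [← hLR']; exact mul_le_mul_of_nonneg_left (by nlinarith) (by linarith)
  have hR₁R' : R₁ ≤ R := by nlinarith
  have h2r : 2 * r < R₃ := by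
    have := (div_lt_iff₀ hR).1 hcr
    rw [hR₃]; linarith
  have hρ := H.pos
  have hucd : ContDiffOn ℝ ((k + 1 : ℕ) : ℕ∞ω) u Ω :=
    hu.contDiffOn.of_le (by exact_mod_cast (by omega : k + 1 ≤ 2 * (k + 1)))
  have hlim : ∀ α : Fin n → ℕ, ∑ i, α i < k + 1 → ∀ᵐ z ∂volume.restrict (Metric.ball Q R₁),
      Tendsto (fun s : ℝ => multiD α u (foot e h z + s • e)) (𝓝[>] 0) (𝓝 0) := fun α hα =>
    H.ae_tendsto_vertical (hR₁R.trans hRR₀.le) hR₀ (hV α (by omega))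
  have hfin : ∫⁻ x in tent Ω Q R₁, ‖derivSum (k + 1) u x‖ₑ ^ 2 < ⊤ :=
    (lintegral_derivSum_sq_le_gradNorm _ _ _).trans_lt (ENNReal.mul_lt_top (by simp)
      (H.lintegral_sq_lt_top (hLR'.le.trans hRR₀.le) hR₀ hN))
  have happ : SobolevApprox (k + 1) Ω (Metric.ball Q (2 * r)) u :=
    (H.sobolevApprox (R₁ := R₁) (R₂ := R₁ / 2) (by linarith) (by linarith) (by linarith) hucd hlim
      hfin).mono (Metric.ball_subset_ball (by linarith))
  have hpoin := hD H hR₃0.le (by linarith : (1 + Λ) * R₁ ≤ ρ) (by linarith) hucd hlim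
  have hdecay := hdec (2 * r) R₃ (by linarith) h2r (by linarith)
  set G := ∫⁻ x in tent Ω Q R, ‖gradNorm k u x‖ₑ ^ 2 with hG
  have hG₁ : ∫⁻ x in tent Ω Q R₁, ‖gradNorm k u x‖ₑ ^ 2 ≤ G :=
    lintegral_mono_set (inter_subset_inter_left _ (Metric.ball_subset_ball hR₁R'))
  set t := 2 * r / R₃ with ht
  have ht0 : 0 < t := by positivity
  have ht1 : t ≤ 1 := ((div_lt_one hR₃0).2 h2r).le
  have hreal : (r ^ (2 * k))⁻¹ * (K * (C * t ^ (lam₀ + 2 * ((k + 1 : ℕ) : ℝ) - 2) *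
      (D * (Λ * R₃) ^ (2 * k)))) ≤ K * D * (C * (2 * Λ) ^ (2 * k) * (2 / c) ^ lam) * p := by
    -- the part `2ℓ - 2` of the exponent pays for the powers of the radii in the Caccioppoli and
    -- Poincaré inequalities
    have h1 : t ^ (lam₀ + 2 * ((k + 1 : ℕ) : ℝ) - 2) = t ^ lam₀ * t ^ (2 * k) := by
      rw [← Real.rpow_natCast t, ← Real.rpow_add ht0]
      congr 1; push_cast; ring
    have h2 : t ^ lam₀ ≤ (2 / c) ^ lam * p := by
      refine (Real.rpow_le_rpow_of_exponent_ge ht0 ht1 hlam).trans (le_of_eq ?_)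
      rw [hp, ← Real.mul_rpow (by positivity) hrR0.le]
      congr 1
      rw [ht, hR₃]; field_simp
    have h3 : t ^ (2 * k) * (Λ * R₃) ^ (2 * k) = (2 * Λ) ^ (2 * k) * r ^ (2 * k) := by
      rw [← mul_pow, ← mul_pow]
      congr 1
      rw [ht]; field_simp
    have h4 : (r ^ (2 * k))⁻¹ * r ^ (2 * k) = 1 := inv_mul_cancel₀ (by positivity)
    calc _ = K * D * C * t ^ lam₀ * ((r ^ (2 * k))⁻¹ * (t ^ (2 * k) * (Λ * R₃) ^ (2 * k))) := by
          rw [h1]; ring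
      _ = K * D * C * (2 * Λ) ^ (2 * k) * ((r ^ (2 * k))⁻¹ * r ^ (2 * k)) * t ^ lam₀ := by
          rw [h3]; ring
      _ ≤ K * D * C * (2 * Λ) ^ (2 * k) * ((r ^ (2 * k))⁻¹ * r ^ (2 * k)) * ((2 / c) ^ lam * p) :=
          mul_le_mul_of_nonneg_left h2 (by positivity)
      _ = _ := by rw [h4]; ring
  have hα : ∀ α ∈ multiIndices n k, ∫⁻ x in tent Ω Q r, ‖multiD α u x‖ₑ ^ 2 ≤
      ENNReal.ofReal (K * D * (C * (2 * Λ) ^ (2 * k) * (2 / c) ^ lam) * p) * G := by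
    intro α hα
    have hαk := mem_multiIndices.1 hα
    have hcacc := hK a ha Ω H.isOpen u hu Q r hr happ α (by omega)
    rw [hαk] at hcacc
    have hr2 : (0 : ℝ) < r ^ (2 * k) := by positivity
    calc ∫⁻ x in tent Ω Q r, ‖multiD α u x‖ₑ ^ 2
        = ENNReal.ofReal (r ^ (2 * k))⁻¹ * (ENNReal.ofReal (r ^ (2 * k)) *
            ∫⁻ x in tent Ω Q r, ‖multiD α u x‖ₑ ^ 2) := by
          rw [← mul_assoc, ← ENNReal.ofReal_mul (inv_nonneg.2 hr2.le), inv_mul_cancel₀ hr2.ne',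
            ENNReal.ofReal_one, one_mul]
      _ ≤ ENNReal.ofReal (r ^ (2 * k))⁻¹ * (K * (ENNReal.ofReal
            (C * t ^ (lam₀ + 2 * ((k + 1 : ℕ) : ℝ) - 2)) *
              (D * ENNReal.ofReal ((Λ * R₃) ^ (2 * k)) * G))) := by
          refine mul_le_mul' le_rfl (hcacc.trans (mul_le_mul' le_rfl (hdecay.trans
            (mul_le_mul' le_rfl (hpoin.trans (mul_le_mul' le_rfl hG₁))))))
      _ = ENNReal.ofReal ((r ^ (2 * k))⁻¹ * (K * (C * t ^ (lam₀ + 2 * ((k + 1 : ℕ) : ℝ) - 2) *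
            (D * (Λ * R₃) ^ (2 * k))))) * G := by
          rw [ENNReal.ofReal_mul (p := (r ^ (2 * k))⁻¹) (by positivity),
            ENNReal.ofReal_mul (p := (K : ℝ)) (by positivity),
            ENNReal.ofReal_mul (p := C * t ^ (lam₀ + 2 * ((k + 1 : ℕ) : ℝ) - 2)) (by positivity),
            ENNReal.ofReal_mul (p := (D : ℝ)) (by positivity),
            ENNReal.ofReal_coe_nnreal, ENNReal.ofReal_coe_nnreal]
          ring
      _ ≤ _ := mul_le_mul' (ENNReal.ofReal_le_ofReal hreal) le_rfl
  calc ∫⁻ x in tent Ω Q r, ‖gradNorm k u x‖ₑ ^ 2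
      = ∑ α ∈ multiIndices n k, ∫⁻ x in tent Ω Q r, ‖multiD α u x‖ₑ ^ 2 := by
        simp only [enorm_gradNorm_sq]
        refine lintegral_finsetSum' _ fun α hα => ?_
        have h1 : ContinuousOn (multiD α u) Ω := (hucd.multiD H.isOpen α (k := 0)
          (by rw [mem_multiIndices.1 hα]; omega)).continuousOn
        exact ((h1.mono inter_subset_right).aestronglyMeasurable
          (Metric.isOpen_ball.measurableSet.inter H.isOpen.measurableSet)).enorm.pow_const 2
    _ ≤ ∑ _α ∈ multiIndices n k,
          ENNReal.ofReal (K * D * (C * (2 * Λ) ^ (2 * k) * (2 / c) ^ lam) * p) * G :=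
        Finset.sum_le_sum hα
    _ = ENNReal.ofReal (M * p) * G := by
        rw [Finset.sum_const, nsmul_eq_mul, ← mul_assoc, ← ENNReal.ofReal_natCast,
          ← ENNReal.ofReal_mul (by positivity), hM, hκ]
        congr 2; ring
    _ ≤ ENNReal.ofReal (((c / 2) ^ (-lam) + M) * p) * G := by
        refine mul_le_mul' (ENNReal.ofReal_le_ofReal (mul_le_mul_of_nonneg_right ?_ hp0.le)) le_rfl
        have : 0 < (c / 2) ^ (-lam) := by positivity
        linarith

end Decay

end

theorem theorem2p14 {n : ℕ} (Ω : Set (Eucl n)) (hΩ : IsBoundedLipschitzDomain Ω) :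
    ∃ r₀ : ℝ, 0 < r₀ ∧
      ∀ (m ℓ : ℕ), 1 ≤ ℓ →
      ∀ (μ C lam₀ lam : ℝ), 0 < μ → 0 < C → 0 < lam → lam < lam₀ →
      ∃ C' : ℝ, 0 < C' ∧
        ∀ (a : Coeffs n m), IsSymmElliptic ℓ μ a →
        ∀ Q ∈ frontier Ω, ∀ R₀ : ℝ, 0 < R₀ → R₀ ≤ r₀ →
        ∀ u : Eucl n → Eucl m, IsSolution ℓ a Ω u →
          (∫⁻ P in surfaceBall Ω Q R₀, ntMax Ω (gradNorm ℓ u) P ^ 2 ∂(surfaceMeasure n) < ∞) →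
          (∀ α : Fin n → ℕ, ∑ i, α i ≤ ℓ - 1 →
            VanishesNT Ω (surfaceBall Ω Q R₀) (multiD α u)) →
          (∀ r R : ℝ, 0 < r → r < R → R < R₀ →
            ∫⁻ x in tent Ω Q r, ‖u x‖ₑ ^ 2 ≤
              ENNReal.ofReal (C * (r / R) ^ (lam₀ + 2 * (ℓ : ℝ) - 2)) *
                ∫⁻ x in tent Ω Q R, ‖u x‖ₑ ^ 2) →
          ∀ r R : ℝ, 0 < r → r < R → R < R₀ →
            ∫⁻ x in tent Ω Q r, ‖gradNorm (ℓ - 1) u x‖ₑ ^ 2 ≤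
              ENNReal.ofReal (C' * (r / R) ^ lam) *
                ∫⁻ x in tent Ω Q R, ‖gradNorm (ℓ - 1) u x‖ₑ ^ 2 := by
  obtain ⟨ρ, Λ, hρ, hΛ, hchart⟩ := hΩ.exists_uniform_chart
  refine ⟨ρ / 2, half_pos hρ, fun m ℓ hℓ μ C lam₀ lam hμ hC hlam0 hlam => ?_⟩
  obtain ⟨C', hC'0, hC'⟩ := exists_gradNorm_decay (ρ := ρ) n m hℓ hμ hC hlam0 hlam.le hΛ
  refine ⟨C', hC'0, fun a ha Q hQ R₀ _ hR₀ u hu hN hV hdec => ?_⟩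
  obtain ⟨e, h, H⟩ := hchart Q hQ
  exact hC' Ω Q e h H a ha R₀ hR₀ u hu hN hV hdec
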